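/- Let $q\in(0,1)$ and $\alpha>0$. On $\ell_2(\mathbb N)$ with standard basis $(e_n)_{n\ge 0}$ let $s e_n=e_{n+1}$, $z e_n=\sqrt{1-q^{2(n+1)}}\,e_{n+1}$ (so $z^*e_n=\sqrt{1-q^{2n}}\,e_{n-1}$) and $y e_n=q^n e_n$; then $y=\sqrt{1-zz^*}$. Let $\mathcal O(D_q)$ be the $*$-algebra generated by $z$, let $\mathcal F(D_q)$ be the $*$-algebra of all operators $\sum_{n=0}^N s^n g_n(y)+\sum_{n=1}^M g_{-n}(y)s^{*n}$ with $g_j$ bounded on $\mathrm{spec}(y)$, and let $\mathcal F^{(1)}(D_q)$ be the set of all operators $\sum_{n=0}^N z^n f_n(y^2)+\sum_{n=1}^M f_{-n}(y^2)z^{*n}$ with $f_j\in C^{(1)}(\mathrm{spec}(y^2))$ (i.e. $f_j$ is continuous and differentiable at $0$ along $\mathrm{spec}(y^2)$). Then $\mathcal F^{(1)}(D_q)$ is a $*$-algebra with $\mathcal O(D_q)\subset\mathcal F^{(1)}(D_q)\subset\mathcal F(D_q)$. Let $S^1=\mathbb R/2\pi\mathbb Z$ with coordinate $t$ and Lebesgue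 measure $\lambda$ of total mass $2\pi$. Define an inner product on $\mathcal F(D_q)\otimes L_\infty(S^1)$ by $$\langle f\otimes\phi,g\otimes\psi\rangle=(1-q)\,\mathrm{Tr}(f^*g\,y^\alpha)\int_{S^1}\bar\phi\,\psi\,d\lambda ,$$ and let $L_2(D_q)\bar\otimes L_2(S^1)$ denote the Hilbert space completion. The subspace $\mathcal F^{(1)}(D_q)\otimes C^{(1)}(S^1)$ is a $*$-subalgebra of $\mathcal F(D_q)\otimes L_\infty(S^1)$. (1) Put $a^{\#k}=a^k$ for $k\ge 0$ and $a^{\#k}=(a^*)^{-k}$ for $k<0$, and let $\delta_{q^n}(x)=1$ if $x=q^n$ and $0$ otherwise. The elements $$e_{nkl}=\frac{q^{-\alpha n/2}}{\sqrt{1-q}}\,s^{\#(k-n)}\delta_{q^n}(y)\otimes\frac1{\sqrt{2\pi}}e^{ilt},\qquad n,k\in\mathbb N,\ l\in\mathbb Z,$$ lie in $\mathcal F^{(1)}(D_q)\otimes C^{(1)}(S^1)$ and form an orthonormal basis of $L_2(D_q)\bar\otimes L_2(S^1)$. (Below, terms with a negative first or second index have coefficient $0$.) (2) Left multiplication $x(f\otimes\psi)=xf\otimes\psi$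 defines a bounded $*$-representation of $\mathcal O(D_q)$ on $L_2(D_q)\bar\otimes L_2(S^1)$; left multiplication by $y$ also extends to a bounded operator, $y=\sqrt{1-zz^*}$, and $$z e_{nkl}=\sqrt{1-q^{2(k+1)}}\,e_{n,k+1,l},\quad z^*e_{nkl}=\sqrt{1-q^{2k}}\,e_{n,k-1,l},\quad y e_{nkl}=q^k e_{nkl}.$$ (3) Right multiplication $x^{op}(f\otimes\psi)=fx\otimes\psi$ defines a bounded representation of the opposite algebra $\mathcal O(D_q)^{op}$ which is not a $*$-representation; right multiplication by $y$ also extends to a bounded operator $y^{op}$. One has $z^{*op}=q^{\alpha}(z^{op})^*$, $y^{op}=(y^{op})^*$, $y^{op}=\sqrt{1-z^{*op}z^{op}}$, and $$z^{op}e_{nkl}=q^{-\alpha/2}\sqrt{1-q^{2n}}\,e_{n-1,k,l},\quad z^{*op}e_{nkl}=q^{\alpha/2}\sqrt{1-q^{2(n+1)}}\,e_{n+1,k,l},\quad y^{op}e_{nkl}=q^n e_{nkl}.$$ (4) Let $C(SU_q(2))$ be the C*-algebra generated by the operators $c(e_n\otimes b_k)=q^ne_n\otimes b_{k+1}$ and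 $d(e_n\otimes b_k)=\sqrt{1-q^{2(n+1)}}\,e_{n+1}\otimes b_k$ on $\ell_2(\mathbb N)\bar\otimes\ell_2(\mathbb Z)$, where $(b_k)$ is the standard basis of $\ell_2(\mathbb Z)$, and let $u(e^{it})=e^{it}$. Setting $$c:=y\otimes u,\quad d:=z\otimes 1,\quad c^{op}:=y^{op}\otimes u^*,\quad d^{op}:=q^{\alpha/2}z^{op}\otimes 1$$ yields commuting $*$-representations of $C(SU_q(2))$ and $C(SU_q(2))^{op}$ on $L_2(D_q)\bar\otimes L_2(S^1)$, given by left and right multiplication, respectively. In particular, the operators $c,d$ satisfy $$cd=qdc,\quad c^*d=qdc^*,\quad cc^*=c^*c,\quad d^*d+q^2cc^*=1,\quad dd^*+cc^*=1,$$ and $c^{op},d^{op}$ satisfy the opposite relations. On basis vectors, $$c e_{nkl}=q^ke_{n,k,l+1},\quad d e_{nkl}=\sqrt{1-q^{2(k+1)}}\,e_{n,k+1,l},\quad c^{op}e_{nkl}=q^ne_{n,k,l-1},\quad d^{op}e_{nkl}=\sqrt{1-q^{2n}}\,e_{n-1,k,l}.$$ (5) For $g\in\mathcal F^{(1)}(D_q)$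 the partial derivatives $$\frac{\partial g}{\partial z}=\frac{1}{1-q^2}\,y^{-2}[z^*,g],\qquad \frac{\partial g}{\partial\bar z}=\frac{-1}{1-q^2}\,y^{-2}[z,g]$$ are well defined elements of $\mathcal F(D_q)$. There are linear maps $\frac{\partial}{\partial z},\frac{\partial}{\partial\bar z},\frac{\partial}{\partial t}$ from $\mathcal F^{(1)}(D_q)\otimes C^{(1)}(S^1)$ to $\mathcal F(D_q)\otimes L_\infty(S^1)$ with $\frac{\partial}{\partial z}(g\otimes\phi)=\frac{\partial g}{\partial z}\otimes\phi$, $\frac{\partial}{\partial\bar z}(g\otimes\phi)=\frac{\partial g}{\partial\bar z}\otimes\phi$, $\frac{\partial}{\partial t}(g\otimes\phi)=g\otimes\frac{\partial\phi}{\partial t}$, and $$\frac{\partial}{\partial z}e_{nkl}=\frac{q^{-2k}}{1-q^2}\Big(q^2\sqrt{1-q^{2k}}\,e_{n,k-1,l}-q^{\alpha/2}\sqrt{1-q^{2(n+1)}}\,e_{n+1,k,l}\Big),$$ $$\frac{\partial}{\partial\bar z}e_{nkl}=-\frac{q^{-2k}}{1-q^2}\Big(q^{-2}\sqrt{1-q^{2(k+1)}}\,e_{n,k+1,l}-q^{-\alpha/2}\sqrt{1-q^{2n}}\,e_{n-1,k,l}\Big),\qquad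 \frac{\partial}{\partial t}e_{nkl}=il\,e_{nkl}.$$ (6) In terms of the bases $(e_{nkl})$, the representations of $C(SU_q(2))$ and $C(SU_q(2))^{op}$ do not depend on $\alpha$, but the actions of $\frac{\partial}{\partial z}$ and $\frac{\partial}{\partial\bar z}$ do: for every $\beta>0$, the unitary operator from the completion for $\alpha$ to the one for $\beta$ that maps $e_{nkl}$ to $e_{nkl}$ intertwines the two pairs of representations, and for $\beta\neq\alpha$ it intertwines neither the actions of $\frac{\partial}{\partial z}$ nor those of $\frac{\partial}{\partial\bar z}$ on the basis vectors. -/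

import Mathlib

open scoped TensorProduct ENNReal ComplexConjugate InnerProductSpace
open MeasureTheory

noncomputable section
namespace QuantumSU2

/-- The Hilbert space `ℓ²(ι)`. -/
abbrev Ell2 (ι : Type) : Type := lp (fun _ : ι => ℂ) 2
/-- Bounded operators on `ℓ²(ι)`. -/
abbrev Op (ι : Type) : Type := Ell2 ι →L[ℂ] Ell2 ι

/-- The standard orthonormal basis vector `e_i` of `ℓ²(ι)`. -/
def basisVec {ι : Type} [DecidableEq ι] (i : ι) : Ell2 ι := lp.single 2 i 1

theorem summable_sq {ι : Type} (x : Ell2 ι) : Summable fun i => ‖x i‖ ^ 2 := by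
  have := (lp.memℓp x).summable (by norm_num)
  simpa using this

theorem norm_sq_eq {ι : Type} (x : Ell2 ι) : ‖x‖ ^ 2 = ∑' i, ‖x i‖ ^ 2 := by
  have := lp.norm_rpow_eq_tsum (p := 2) (by norm_num) x
  simpa using this

theorem memℓp_pull {ι : Type} {σ : ι → ι} (hσ : Function.Injective σ) {a : ι → ℂ} {C : ℝ}
    (ha : ∀ i, ‖a i‖ ≤ C) (x : Ell2 ι) : Memℓp (fun i => a i * x (σ i)) 2 := by
  apply memℓp_gen
  have h : Summable fun i => C ^ 2 * ‖x (σ i)‖ ^ 2 :=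
    ((summable_sq x).comp_injective hσ).mul_left _
  refine Summable.of_nonneg_of_le (fun i => by positivity) (fun i => ?_) h
  simp only [ENNReal.toReal_ofNat, Real.rpow_ofNat, norm_mul, mul_pow]
  gcongr
  exact ha i

/-- The bounded operator `(x_i)_i ↦ (a_i x_{σ i})_i`. -/
def pull {ι : Type} (σ : ι ↪ ι) (a : ι → ℂ) (C : ℝ) (ha : ∀ i, ‖a i‖ ≤ C) : Op ι :=
  LinearMap.mkContinuous
    { toFun := fun x => ⟨fun i => a i * x (σ i), memℓp_pull σ.injective ha x⟩
      map_add' := fun x w => by ext i; exact mul_add (a i) (x (σ i)) (w (σ i))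
      map_smul' := fun c x => by ext i; simp [mul_left_comm] } |C| (by
    intro x
    apply le_of_sq_le_sq _ (by positivity)
    rw [mul_pow, sq_abs, norm_sq_eq, norm_sq_eq]
    have h : Summable fun i => C ^ 2 * ‖x (σ i)‖ ^ 2 :=
      ((summable_sq x).comp_injective σ.injective).mul_left _
    have hle : ∀ i, ‖a i * x (σ i)‖ ^ 2 ≤ C ^ 2 * ‖x (σ i)‖ ^ 2 := fun i => by
      rw [norm_mul, mul_pow]
      gcongr
      exact ha i
    calc _ ≤ ∑' i, C ^ 2 * ‖x (σ i)‖ ^ 2 :=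
          Summable.tsum_le_tsum hle (Summable.of_nonneg_of_le (fun i => by positivity) hle h) h
      _ = C ^ 2 * ∑' i, ‖x (σ i)‖ ^ 2 := tsum_mul_left
      _ ≤ _ := by
          refine mul_le_mul_of_nonneg_left ?_ (sq_nonneg C)
          exact tsum_comp_le_tsum_of_inj (summable_sq x) (fun i => by positivity) σ.injective)

open Classical in
/-- The weighted shift `e_i ↦ a_i e_{σ i}` for a bounded sequence `a` and an injection `σ`
(see `wshift_basisVec`); it is the adjoint of `x ↦ (conj (a_i) x_{σ i})_i`.
All sequences used below are bounded; the value `0` for unbounded `a` is never relevant. -/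
def wshift {ι : Type} (σ : ι ↪ ι) (a : ι → ℂ) : Op ι :=
  if h : ∃ C : ℝ, ∀ i, ‖conj (a i)‖ ≤ C then
    star (pull σ (fun i => conj (a i)) h.choose h.choose_spec)
  else 0

theorem inner_basisVec {ι : Type} [DecidableEq ι] (i : ι) (x : Ell2 ι) :
    ⟪basisVec i, x⟫_ℂ = x i := by
  simp [basisVec, lp.inner_single_left]

theorem star_wshift_apply {ι : Type} (σ : ι ↪ ι) (a : ι → ℂ) (ha : ∃ C : ℝ, ∀ i, ‖a i‖ ≤ C)
    (x : Ell2 ι) (i : ι) : (star (wshift σ a) x) i = conj (a i) * x (σ i) := by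
  have h : ∃ C : ℝ, ∀ i, ‖conj (a i)‖ ≤ C := by simpa using ha
  rw [wshift, dif_pos h, star_star]
  rfl

theorem wshift_basisVec {ι : Type} [DecidableEq ι] (σ : ι ↪ ι) (a : ι → ℂ)
    (ha : ∃ C : ℝ, ∀ i, ‖a i‖ ≤ C) (i : ι) :
    wshift σ a (basisVec i) = a i • basisVec (σ i) := by
  apply ext_inner_right ℂ
  intro x
  rw [← ContinuousLinearMap.adjoint_inner_right, inner_basisVec,
    ← ContinuousLinearMap.star_eq_adjoint, star_wshift_apply σ a ha, inner_smul_left,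
    inner_basisVec]


/-- The square root of a (positive) operator, by the continuous functional calculus. -/
def opSqrt {E : Type} [NormedAddCommGroup E] [InnerProductSpace ℂ E] [CompleteSpace E]
    (T : E →L[ℂ] E) : E →L[ℂ] E := CFC.sqrt T

/-- The parameter `q ∈ (0,1)`. -/
abbrev QParam : Type := Set.Ioo (0 : ℝ) 1
/-- The parameter `α > 0`. -/
abbrev AParam : Type := Set.Ioi (0 : ℝ)

def succEmb : ℕ ↪ ℕ := ⟨Nat.succ, Nat.succ_injective⟩

/-- The unilateral shift `s e_n = e_{n+1}`. -/
def sOp : Op ℕ := wshift succEmb fun _ => 1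

/-- `z e_n = √(1 - q^{2(n+1)}) e_{n+1}`; its adjoint is `z^* e_n = √(1 - q^{2n}) e_{n-1}`. -/
def zOp (q : QParam) : Op ℕ :=
  wshift succEmb fun n => ((√(1 - (q : ℝ) ^ (2 * (n + 1))) : ℝ) : ℂ)

/-- The spectral calculus `g(y)` of `y`: as `y` is diagonal with eigenvalues `q^n` on the vectors
`e_n`, `g(y)` is the diagonal operator `e_n ↦ g(q^n) e_n`. -/
def ofY (q : QParam) (g : ℝ → ℂ) : Op ℕ :=
  wshift (Function.Embedding.refl ℕ) fun n => g ((q : ℝ) ^ n)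

/-- `y e_n = q^n e_n`. -/
def yOp (q : QParam) : Op ℕ := ofY q fun t => (t : ℂ)

/-- The quantum disc algebra `O(D_q)`: the `*`-algebra generated by `z`. -/
def discPoly (q : QParam) : StarSubalgebra ℂ (Op ℕ) := StarAlgebra.adjoin ℂ {zOp q}

/-- `g ∈ L_∞(spec(y))`: `g` is bounded on the spectrum of `y`. -/
def BddOnSpec (q : QParam) (g : ℝ → ℂ) : Prop := ∃ C : ℝ, ∀ t ∈ spectrum ℝ (yOp q), ‖g t‖ ≤ C

/-- The set of all `∑_{n=0}^N s^n g_n(y) + ∑_{n=1}^M g_{-n}(y) s^{*n}` with `g_j ∈ L_∞(spec(y))`. -/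
def discSet (q : QParam) : Set (Op ℕ) :=
  {T | ∃ (N M : ℕ) (g : ℤ → ℝ → ℂ), (∀ j, BddOnSpec q (g j)) ∧
    T = ∑ n ∈ Finset.range (N + 1), sOp ^ n * ofY q (g n) +
      ∑ n ∈ Finset.Icc 1 M, ofY q (g (-n)) * star sOp ^ n}

/-- Matrix entries with respect to the standard basis. -/
def entry (T : Op ℕ) (i j : ℕ) : ℂ := T (basisVec j) i

theorem entry_eq (T : Op ℕ) (i j : ℕ) : entry T i j = ⟪basisVec i, T (basisVec j)⟫_ℂ :=
  (inner_basisVec i _).symm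

theorem entry_star (T : Op ℕ) (i j : ℕ) : entry (star T) i j = conj (entry T j i) := by
  rw [entry_eq, entry_eq, ContinuousLinearMap.star_eq_adjoint,
    ContinuousLinearMap.adjoint_inner_right, inner_conj_symm]

theorem norm_basisVec (i : ℕ) : ‖basisVec i‖ = 1 := by simp [basisVec, lp.norm_single]

theorem norm_entry_le (T : Op ℕ) (i j : ℕ) : ‖entry T i j‖ ≤ ‖T‖ := by
  rw [entry_eq]
  refine (norm_inner_le_norm _ _).trans ?_
  rw [norm_basisVec, one_mul]
  simpa [norm_basisVec] using T.le_opNorm (basisVec j)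

theorem op_ext {T S : Op ℕ} (h : ∀ i j, entry T i j = entry S i j) : T = S := by
  have key : ∀ (T : Op ℕ) (x : Ell2 ℕ) (i : ℕ), T x i = ⟪star T (basisVec i), x⟫_ℂ := by
    intro T x i
    rw [ContinuousLinearMap.star_eq_adjoint, ContinuousLinearMap.adjoint_inner_left,
      inner_basisVec]
  have h2 : ∀ i, star T (basisVec i) = star S (basisVec i) := by
    intro i
    ext j
    have := congrArg conj (h i j)
    rw [← entry_star, ← entry_star] at this
    exact this
  ext x i
  rw [key, key, h2]

/-- Operators whose matrix has bandwidth at most `K`. -/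
def IsBand (K : ℕ) (T : Op ℕ) : Prop := ∀ i j, (i + K < j ∨ j + K < i) → entry T i j = 0

theorem entry_add (T S : Op ℕ) (i j : ℕ) : entry (T + S) i j = entry T i j + entry S i j := rfl

theorem entry_sum {κ : Type} (F : Finset κ) (T : κ → Op ℕ) (i j : ℕ) :
    entry (∑ k ∈ F, T k) i j = ∑ k ∈ F, entry (T k) i j := by
  classical
  induction F using Finset.induction_on with
  | empty => rfl
  | insert a F ha ih => rw [Finset.sum_insert ha, Finset.sum_insert ha, entry_add, ih]

theorem entry_smul (c : ℂ) (T : Op ℕ) (i j : ℕ) : entry (c • T) i j = c * entry T i j := rfl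

theorem entry_wshift (σ : ℕ ↪ ℕ) (a : ℕ → ℂ) (ha : ∃ C : ℝ, ∀ i, ‖a i‖ ≤ C) (i j : ℕ) :
    entry (wshift σ a) i j = if i = σ j then a j else 0 := by
  rw [entry, wshift_basisVec σ a ha]
  simp [basisVec, lp.single_apply, Pi.single_apply]

theorem IsBand.add {K L : ℕ} {T S : Op ℕ} (hT : IsBand K T) (hS : IsBand L S) :
    IsBand (K + L) (T + S) := by
  intro i j h
  rw [entry_add, hT i j (by omega), hS i j (by omega), add_zero]

theorem IsBand.smul {K : ℕ} {T : Op ℕ} (hT : IsBand K T) (c : ℂ) : IsBand K (c • T) := by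
  intro i j h
  rw [entry_smul, hT i j h, mul_zero]

theorem IsBand.star {K : ℕ} {T : Op ℕ} (hT : IsBand K T) : IsBand K (star T) := by
  intro i j h
  rw [entry_star, hT j i (by omega), map_zero]

theorem apply_eq_sum {K : ℕ} {T : Op ℕ} (hT : IsBand K T) (j : ℕ) :
    T (basisVec j) = ∑ k ∈ Finset.range (j + K + 1), entry T k j • basisVec k := by
  ext i
  have h : (∑ k ∈ Finset.range (j + K + 1), entry T k j • basisVec k : Ell2 ℕ) i =
      ∑ k ∈ Finset.range (j + K + 1), entry T k j * (basisVec k : Ell2 ℕ) i := by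
    rw [← inner_basisVec, inner_sum]
    simp_rw [inner_smul_right, inner_basisVec]
  rw [h]
  have h2 : ∀ k, (basisVec k : Ell2 ℕ) i = if k = i then 1 else 0 := by
    intro k
    simp [basisVec, lp.single_apply, Pi.single_apply, eq_comm]
  simp_rw [h2, mul_ite, mul_one, mul_zero, Finset.sum_ite_eq']
  split_ifs with hi
  · rfl
  · exact hT i j (by simp at hi; omega)

theorem entry_mul {L : ℕ} {T S : Op ℕ} (hS : IsBand L S) (i j : ℕ) :
    entry (T * S) i j = ∑ k ∈ Finset.range (j + L + 1), entry T i k * entry S k j := by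
  rw [entry_eq, mul_apply_eq_comp, apply_eq_sum hS, map_sum, inner_sum]
  simp_rw [map_smul, inner_smul_right, ← entry_eq, mul_comm]

theorem IsBand.mul {K L : ℕ} {T S : Op ℕ} (hT : IsBand K T) (hS : IsBand L S) :
    IsBand (K + L) (T * S) := by
  intro i j h
  rw [entry_mul hS]
  refine Finset.sum_eq_zero fun k _ => ?_
  by_cases hk : k + L < j ∨ j + L < k
  · rw [hS k j hk, mul_zero]
  · rw [hT i k (by omega), zero_mul]

theorem isBand_diag (a : ℕ → ℂ) (ha : ∃ C : ℝ, ∀ i, ‖a i‖ ≤ C) :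
    IsBand 0 (wshift (Function.Embedding.refl ℕ) a) := by
  intro i j h
  rw [entry_wshift _ _ ha, if_neg]
  simp; omega

theorem isBand_shift (a : ℕ → ℂ) (ha : ∃ C : ℝ, ∀ i, ‖a i‖ ≤ C) :
    IsBand 1 (wshift succEmb a) := by
  intro i j h
  rw [entry_wshift _ _ ha, if_neg]
  simp [succEmb]; omega

/-- The `*`-algebra of all banded operators. -/
def bandAlg : StarSubalgebra ℂ (Op ℕ) where
  carrier := {T | ∃ K, IsBand K T}
  mul_mem' := by
    rintro T S ⟨K, hT⟩ ⟨L, hS⟩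
    exact ⟨_, hT.mul hS⟩
  add_mem' := by
    rintro T S ⟨K, hT⟩ ⟨L, hS⟩
    exact ⟨_, hT.add hS⟩
  algebraMap_mem' := by
    intro r
    refine ⟨0, ?_⟩
    rw [Algebra.algebraMap_eq_smul_one]
    refine IsBand.smul ?_ r
    intro i j h
    rw [entry, one_apply_eq_self, basisVec, lp.single_apply_ne]
    omega
  star_mem' := by
    rintro T ⟨K, hT⟩
    exact ⟨K, hT.star⟩

theorem bdd_one : ∃ C : ℝ, ∀ i : ℕ, ‖(fun _ => 1 : ℕ → ℂ) i‖ ≤ C := ⟨1, by simp⟩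

theorem pow_pos_q (q : QParam) (n : ℕ) : 0 < (q : ℝ) ^ n := pow_pos q.2.1 n
theorem pow_le_q (q : QParam) (n : ℕ) : (q : ℝ) ^ n ≤ 1 := pow_le_one₀ q.2.1.le q.2.2.le

theorem bdd_pow (q : QParam) : ∃ C : ℝ, ∀ n : ℕ, ‖(((q : ℝ) ^ n : ℝ) : ℂ)‖ ≤ C :=
  ⟨1, fun n => by
    rw [Complex.norm_real, Real.norm_of_nonneg (pow_pos_q q n).le]; exact pow_le_q q n⟩

theorem bdd_sqrt (q : QParam) :
    ∃ C : ℝ, ∀ n : ℕ, ‖((√(1 - (q : ℝ) ^ (2 * (n + 1))) : ℝ) : ℂ)‖ ≤ C :=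
  ⟨1, fun n => by
    rw [Complex.norm_real, Real.norm_of_nonneg (Real.sqrt_nonneg _)]
    refine Real.sqrt_le_one.mpr ?_
    linarith [pow_pos_q q (2 * (n + 1))]⟩

theorem mem_spec (q : QParam) (n : ℕ) : (q : ℝ) ^ n ∈ spectrum ℝ (yOp q) := by
  rw [spectrum.mem_iff]
  intro h
  obtain ⟨U, hU⟩ := h
  have h1 : (algebraMap ℝ (Op ℕ) ((q : ℝ) ^ n) - yOp q) (basisVec n) = 0 := by
    rw [_root_.sub_apply, yOp, ofY, wshift_basisVec _ _ (bdd_pow q),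
      Algebra.algebraMap_eq_smul_one, Complex.coe_smul]
    exact sub_self _
  rw [← hU] at h1
  have h2 : (↑U⁻¹ * ↑U : Op ℕ) (basisVec n) = 0 := by
    rw [mul_apply_eq_comp, h1, map_zero]
  rw [Units.inv_mul, one_apply_eq_self] at h2
  have := norm_basisVec n
  rw [h2, norm_zero] at this
  exact zero_ne_one this

theorem BddOnSpec.bdd {q : QParam} {g : ℝ → ℂ} (h : BddOnSpec q g) :
    ∃ C : ℝ, ∀ n : ℕ, ‖g ((q : ℝ) ^ n)‖ ≤ C := by
  obtain ⟨C, hC⟩ := h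
  exact ⟨C, fun n => hC _ (mem_spec q n)⟩

theorem s_band : IsBand 1 sOp := isBand_shift _ bdd_one

theorem ofY_band {q : QParam} {g : ℝ → ℂ} (h : BddOnSpec q g) : IsBand 0 (ofY q g) :=
  isBand_diag _ h.bdd


theorem s_pow_basisVec (n j : ℕ) : (sOp ^ n) (basisVec j) = basisVec (j + n) := by
  induction n with
  | zero => rfl
  | succ n ih =>
    rw [pow_succ', mul_apply_eq_comp, ih, sOp, wshift_basisVec _ _ bdd_one, one_smul]
    rfl

theorem entry_basis (i j : ℕ) : (basisVec j : Ell2 ℕ) i = if i = j then 1 else 0 := by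
  simp [basisVec, lp.single_apply, Pi.single_apply]

theorem entry_s_pow_ofY {q : QParam} {g : ℝ → ℂ} (h : BddOnSpec q g) (n i j : ℕ) :
    entry (sOp ^ n * ofY q g) i j = if i = j + n then g ((q : ℝ) ^ j) else 0 := by
  rw [entry, mul_apply_eq_comp, ofY, wshift_basisVec _ _ h.bdd, map_smul]
  simp only [Function.Embedding.refl_apply, s_pow_basisVec]
  change _ * (basisVec (j + n) : Ell2 ℕ) i = _
  rw [entry_basis, mul_ite, mul_one, mul_zero]

theorem entry_ofY {q : QParam} {g : ℝ → ℂ} (h : BddOnSpec q g) (i j : ℕ) :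
    entry (ofY q g) i j = if i = j then g ((q : ℝ) ^ j) else 0 := by
  simpa using entry_s_pow_ofY h 0 i j

theorem BddOnSpec.conj {q : QParam} {g : ℝ → ℂ} (h : BddOnSpec q g) :
    BddOnSpec q fun t => conj (g t) := by
  obtain ⟨C, hC⟩ := h
  exact ⟨C, fun t ht => by simpa using hC t ht⟩

theorem star_ofY {q : QParam} {g : ℝ → ℂ} (h : BddOnSpec q g) :
    star (ofY q g) = ofY q fun t => conj (g t) := by
  apply op_ext
  intro i j
  rw [entry_star, entry_ofY h, entry_ofY h.conj]
  by_cases hij : i = j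
  · subst hij; simp
  · rw [if_neg (Ne.symm hij), if_neg hij, map_zero]

theorem entry_ofY_star_pow {q : QParam} {g : ℝ → ℂ} (h : BddOnSpec q g) (n i j : ℕ) :
    entry (ofY q g * star sOp ^ n) i j = if j = i + n then g ((q : ℝ) ^ i) else 0 := by
  have : ofY q g * star sOp ^ n = star (sOp ^ n * ofY q fun t => conj (g t)) := by
    rw [star_mul, star_pow, star_ofY h.conj]
    simp
  rw [this, entry_star, entry_s_pow_ofY h.conj]
  split_ifs <;> simp

open Classical in
/-- The coefficient functions of a banded operator. -/
def coefFn (q : QParam) (T : Op ℕ) (k : ℤ) : ℝ → ℂ := fun t =>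
  if h : ∃ m : ℕ, t = (q : ℝ) ^ m then
    if 0 ≤ k then entry T (h.choose + k.toNat) h.choose
    else entry T h.choose (h.choose + (-k).toNat)
  else 0

theorem coefFn_bdd (q : QParam) (T : Op ℕ) (k : ℤ) : BddOnSpec q (coefFn q T k) := by
  refine ⟨‖T‖, fun t _ => ?_⟩
  rw [coefFn]
  split_ifs
  · exact norm_entry_le _ _ _
  · exact norm_entry_le _ _ _
  · simp

theorem coefFn_pow (q : QParam) (T : Op ℕ) (k : ℤ) (m : ℕ) :
    coefFn q T k ((q : ℝ) ^ m) =
      if 0 ≤ k then entry T (m + k.toNat) m else entry T m (m + (-k).toNat) := by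
  have h : ∃ m' : ℕ, (q : ℝ) ^ m = (q : ℝ) ^ m' := ⟨m, rfl⟩
  have h2 : h.choose = m :=
    (pow_right_injective₀ q.2.1 q.2.2.ne h.choose_spec).symm
  rw [coefFn, dif_pos h, h2]

theorem discSet_eq (q : QParam) : discSet q = (bandAlg : Set (Op ℕ)) := by
  ext T
  constructor
  · rintro ⟨N, M, g, hg, rfl⟩
    have hs : sOp ∈ bandAlg := ⟨1, s_band⟩
    have hY : ∀ j, ofY q (g j) ∈ bandAlg := fun j => ⟨0, ofY_band (hg j)⟩
    exact add_mem (sum_mem fun n _ => mul_mem (pow_mem hs n) (hY _))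
      (sum_mem fun n _ => mul_mem (hY _) (pow_mem (star_mem hs) n))
  · rintro ⟨K, hT⟩
    refine ⟨K, K, coefFn q T, coefFn_bdd q T, op_ext fun i j => ?_⟩
    rw [entry_add, entry_sum, entry_sum]
    simp_rw [entry_s_pow_ofY (coefFn_bdd q T _), entry_ofY_star_pow (coefFn_bdd q T _), coefFn_pow]
    rcases le_or_gt j i with hij | hij
    · rw [Finset.sum_eq_single (i - j), Finset.sum_eq_zero]
      · rw [if_pos (by omega), if_pos (by omega), add_zero]
        congr 1
        omega
      · intro n hn
        rw [if_neg]
        simp at hn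
        omega
      · intro n _ hn
        rw [if_neg]
        omega
      · intro hn
        rw [if_pos (by omega), if_pos (by omega)]
        simp at hn
        exact (congrArg (fun t => entry T t j) (by omega)).trans (hT i j (by omega))
    · rw [Finset.sum_eq_zero, Finset.sum_eq_single (j - i)]
      · rw [if_pos (by omega), if_neg (by omega), zero_add]
        congr 1
        omega
      · intro n hn hn2
        rw [if_neg]
        omega
      · intro hn
        rw [if_pos (by omega), if_neg (by omega)]
        simp at hn
        exact (congrArg (fun t => entry T i t) (by omega)).trans (hT i j (by omega))
      · intro n hn
        rw [if_neg]
        omega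

/-- The `*`-algebra `F(D_q)`, with underlying set `discSet q`. -/
def discAlg (q : QParam) : StarSubalgebra ℂ (Op ℕ) := bandAlg.copy (discSet q) (discSet_eq q)

theorem mem_discAlg_iff (q : QParam) (T : Op ℕ) : T ∈ discAlg q ↔ ∃ K, IsBand K T := by
  have : T ∈ discAlg q ↔ T ∈ discSet q := Iff.rfl
  rw [this, discSet_eq]
  rfl

theorem z_mem (q : QParam) : zOp q ∈ discAlg q :=
  (mem_discAlg_iff q _).mpr ⟨1, isBand_shift _ (bdd_sqrt q)⟩

theorem s_mem (q : QParam) : sOp ∈ discAlg q := (mem_discAlg_iff q _).mpr ⟨1, s_band⟩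

theorem y_mem (q : QParam) : yOp q ∈ discAlg q :=
  (mem_discAlg_iff q _).mpr ⟨0, isBand_diag _ (bdd_pow q)⟩

theorem discPoly_le (q : QParam) : discPoly q ≤ discAlg q :=
  StarAlgebra.adjoin_le (by simpa using z_mem q)

/-- The function `δ_{q^n}`. -/
def deltaFn (q : QParam) (n : ℕ) : ℝ → ℂ := fun t => if t = (q : ℝ) ^ n then 1 else 0

theorem deltaFn_bdd (q : QParam) (n : ℕ) : BddOnSpec q (deltaFn q n) :=
  ⟨1, fun t _ => by rw [deltaFn]; split_ifs <;> simp⟩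

theorem delta_mem (q : QParam) (n : ℕ) : ofY q (deltaFn q n) ∈ discAlg q :=
  (mem_discAlg_iff q _).mpr ⟨0, ofY_band (deltaFn_bdd q n)⟩

/-! opTrace -/
/-- The operator `y^α`. -/
def yPow (q : QParam) (α : AParam) : Op ℕ := ofY q fun t => ((t ^ (α : ℝ) : ℝ) : ℂ)

/-- The trace of an operator on `ℓ²(ℕ)`, evaluated in the standard basis. -/
def opTrace (T : Op ℕ) : ℂ := ∑' n, ⟪basisVec n, T (basisVec n)⟫_ℂ

theorem bdd_yPow (q : QParam) (α : AParam) :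
    ∃ C : ℝ, ∀ n : ℕ, ‖(((((q : ℝ) ^ n) ^ (α : ℝ) : ℝ)) : ℂ)‖ ≤ C :=
  ⟨1, fun n => by
    rw [Complex.norm_real, Real.norm_of_nonneg (Real.rpow_nonneg (pow_pos_q q n).le _)]
    exact Real.rpow_le_one (pow_pos_q q n).le (pow_le_q q n) (le_of_lt α.2)⟩

/-- `(1-q) Tr(f^* g y^α)`. -/
def discInner (q : QParam) (α : AParam) (f g : Op ℕ) : ℂ :=
  ((1 - (q : ℝ) : ℝ) : ℂ) * opTrace (star f * g * yPow q α)

theorem trace_term (q : QParam) (α : AParam) (f g : Op ℕ) (n : ℕ) :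
    ⟪basisVec n, (star f * g * yPow q α) (basisVec n)⟫_ℂ =
      ((((q : ℝ) ^ n) ^ (α : ℝ) : ℝ) : ℂ) * ⟪f (basisVec n), g (basisVec n)⟫_ℂ := by
  rw [mul_apply_eq_comp, mul_apply_eq_comp, yPow, ofY, wshift_basisVec _ _ (bdd_yPow q α),
    ContinuousLinearMap.star_eq_adjoint, ContinuousLinearMap.adjoint_inner_right, map_smul,
    inner_smul_right]
  rfl

theorem summable_weight (q : QParam) (α : AParam) :
    Summable fun n : ℕ => ((q : ℝ) ^ n) ^ (α : ℝ) := by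
  have : ∀ n : ℕ, ((q : ℝ) ^ n) ^ (α : ℝ) = ((q : ℝ) ^ (α : ℝ)) ^ n := fun n => by
    rw [← Real.rpow_natCast, ← Real.rpow_natCast, ← Real.rpow_mul q.2.1.le,
      ← Real.rpow_mul q.2.1.le, mul_comm]
  simp_rw [this]
  exact summable_geometric_of_lt_one (Real.rpow_nonneg q.2.1.le _)
    (Real.rpow_lt_one q.2.1.le q.2.2 α.2)

theorem norm_apply_basisVec_le (f : Op ℕ) (n : ℕ) : ‖f (basisVec n)‖ ≤ ‖f‖ := by
  simpa [norm_basisVec] using f.le_opNorm (basisVec n)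

theorem summable_trace (q : QParam) (α : AParam) (f g : Op ℕ) :
    Summable fun n => ⟪basisVec n, (star f * g * yPow q α) (basisVec n)⟫_ℂ := by
  refine Summable.of_norm_bounded ((summable_weight q α).mul_right (‖f‖ * ‖g‖)) fun n => ?_
  rw [trace_term, norm_mul, Complex.norm_real,
    Real.norm_of_nonneg (Real.rpow_nonneg (pow_pos_q q n).le _)]
  refine mul_le_mul_of_nonneg_left ?_ (Real.rpow_nonneg (pow_pos_q q n).le _)
  exact (norm_inner_le_norm _ _).trans (mul_le_mul (norm_apply_basisVec_le f n)
    (norm_apply_basisVec_le g n) (norm_nonneg _) (norm_nonneg _))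

theorem trace_eq (q : QParam) (α : AParam) (f g : Op ℕ) :
    opTrace (star f * g * yPow q α) =
      ∑' n : ℕ, ((((q : ℝ) ^ n) ^ (α : ℝ) : ℝ) : ℂ) * ⟪f (basisVec n), g (basisVec n)⟫_ℂ :=
  tsum_congr fun n => trace_term q α f g n

/-- `F(D_q)` with the inner product `⟨f, g⟩ = (1-q) Tr(f^* g y^α)`. -/
def PreDisc (q : QParam) (_α : AParam) : Type := discAlg q


instance (q : QParam) (α : AParam) : AddCommGroup (PreDisc q α) := inferInstanceAs (AddCommGroup (discAlg q))
instance (q : QParam) (α : AParam) : Module ℂ (PreDisc q α) := inferInstanceAs (Module ℂ (discAlg q))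

/-- The identity `F(D_q) → F(D_q)`. -/
def PreDisc.equiv (q : QParam) (α : AParam) : discAlg q ≃ₗ[ℂ] PreDisc q α := LinearEquiv.refl ℂ (discAlg q)

/-- The underlying operator. -/
def PreDisc.op {q : QParam} {α : AParam} (f : PreDisc q α) : Op ℕ :=
  ((PreDisc.equiv q α).symm f : Op ℕ)

/-- The inner product `⟨f, g⟩ = (1-q) Tr(f^* g y^α)` on `F(D_q)`. -/
@[reducible] def PreDisc.core (q : QParam) (α : AParam) : InnerProductSpace.Core ℂ (PreDisc q α) where
  inner f g := discInner q α f.op g.op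
  conj_inner_symm f g := by
    simp only [discInner, trace_eq, map_mul, Complex.conj_ofReal, Complex.conj_tsum,
      inner_conj_symm]
  re_inner_nonneg f := by
    have : discInner q α f.op f.op = (((1 - (q : ℝ)) *
        ∑' n : ℕ, ((q : ℝ) ^ n) ^ (α : ℝ) * ‖f.op (basisVec n)‖ ^ 2 : ℝ) : ℂ) := by
      simp [discInner, trace_eq, inner_self_eq_norm_sq_to_K, Complex.ofReal_tsum]
    change 0 ≤ (discInner q α f.op f.op).re
    rw [this, Complex.ofReal_re]
    refine mul_nonneg (by linarith [q.2.2]) (tsum_nonneg fun n => ?_)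
    exact mul_nonneg (Real.rpow_nonneg (pow_pos_q q n).le _) (sq_nonneg _)
  add_left f g h := by
    have h1 := summable_trace q α f.op h.op
    have h2 := summable_trace q α g.op h.op
    simp only [trace_term] at h1 h2
    change discInner q α (f.op + g.op) h.op = _
    simp only [discInner, trace_eq, _root_.add_apply, inner_add_left, mul_add]
    rw [h1.tsum_add h2, mul_add]
  smul_left f g c := by
    change discInner q α (c • f.op) g.op = _
    simp only [discInner, trace_eq, _root_.smul_apply, inner_smul_left]
    simp_rw [mul_left_comm _ (conj c) _]
    rw [tsum_mul_left, mul_left_comm]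
  definite f hf := by
    have hq : (1 - (q : ℝ)) ≠ 0 := by linarith [q.2.2]
    have : discInner q α f.op f.op = (((1 - (q : ℝ)) *
        ∑' n : ℕ, ((q : ℝ) ^ n) ^ (α : ℝ) * ‖f.op (basisVec n)‖ ^ 2 : ℝ) : ℂ) := by
      simp [discInner, trace_eq, inner_self_eq_norm_sq_to_K, Complex.ofReal_tsum]
    change discInner q α f.op f.op = 0 at hf
    rw [this, Complex.ofReal_eq_zero, mul_eq_zero, or_iff_right hq] at hf
    have hs : Summable fun n : ℕ => ((q : ℝ) ^ n) ^ (α : ℝ) * ‖f.op (basisVec n)‖ ^ 2 := by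
      refine Summable.of_nonneg_of_le (fun n =>
        mul_nonneg (Real.rpow_nonneg (pow_pos_q q n).le _) (sq_nonneg _)) (fun n => ?_)
        ((summable_weight q α).mul_right (‖f.op‖ ^ 2))
      refine mul_le_mul_of_nonneg_left ?_ (Real.rpow_nonneg (pow_pos_q q n).le _)
      exact pow_le_pow_left₀ (norm_nonneg _) (norm_apply_basisVec_le f.op n) 2
    have h0 := (hasSum_zero_iff_of_nonneg (fun n =>
      mul_nonneg (Real.rpow_nonneg (pow_pos_q q n).le _) (sq_nonneg _))).mp (hf ▸ hs.hasSum)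
    have h1 : f.op = 0 := by
      apply op_ext
      intro i j
      have := congrFun h0 j
      simp only [Pi.zero_apply, mul_eq_zero, (Real.rpow_pos_of_pos (pow_pos_q q j) _).ne',
        false_or] at this
      rw [entry, norm_eq_zero.mp (pow_eq_zero_iff (two_ne_zero) |>.mp this)]
      rfl
    exact Subtype.ext h1

instance (q : QParam) (α : AParam) : NormedAddCommGroup (PreDisc q α) := (PreDisc.core q α).toNormedAddCommGroup
instance (q : QParam) (α : AParam) : InnerProductSpace ℂ (PreDisc q α) := InnerProductSpace.ofCore (PreDisc.core q α).toCore


instance : Fact (0 < 2 * Real.pi) := ⟨Real.two_pi_pos⟩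

/-- The circle `S¹ = ℝ / 2πℤ` (coordinate `t`), with Lebesgue measure `volume` of total mass `2π`. -/
abbrev S1 : Type := AddCircle (2 * Real.pi)


/-- The `*`-algebra `L_∞(S¹)` of essentially bounded functions modulo null functions. -/
def Linf : Type := Lp ℂ ∞ (volume : Measure S1)

instance : AddCommGroup Linf := inferInstanceAs (AddCommGroup (Lp ℂ ∞ (volume : Measure S1)))
instance : Module ℂ Linf := inferInstanceAs (Module ℂ (Lp ℂ ∞ (volume : Measure S1)))

/-- The almost everywhere defined function underlying an element of `L_∞(S¹)`. -/
def Linf.fn (φ : Linf) : S1 →ₘ[volume] ℂ := Subtype.val φ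

theorem Linf.memLp (φ : Linf) : MemLp φ.fn ∞ (volume : Measure S1) := Lp.memLp φ

/-- An element of `L_∞(S¹)` from an essentially bounded function. -/
def Linf.mk (φ : S1 →ₘ[volume] ℂ) (h : MemLp φ ∞ (volume : Measure S1)) : Linf :=
  ⟨φ, Lp.mem_Lp_iff_memLp.mpr h⟩

theorem Linf.fn_mk (φ : S1 →ₘ[volume] ℂ) (h : MemLp φ ∞ (volume : Measure S1)) :
    (Linf.mk φ h).fn = φ := rfl

theorem Linf.ext_ae {φ ψ : Linf} (h : φ.fn =ᵐ[volume] ψ.fn) : φ = ψ :=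
  Subtype.ext (AEEqFun.ext h)

instance : Mul Linf := ⟨fun φ ψ => Linf.mk (φ.fn * ψ.fn)
  ((ψ.memLp.mul φ.memLp (r := ∞)).ae_eq (AEEqFun.coeFn_mul _ _).symm)⟩

instance : One Linf := ⟨Linf.mk 1 ((memLp_top_const (1 : ℂ)).ae_eq AEEqFun.coeFn_one.symm)⟩

instance : Star Linf := ⟨fun φ => Linf.mk (star φ.fn)
  (φ.memLp.star.ae_eq (AEEqFun.coeFn_star _).symm)⟩

theorem Linf.coe_add (φ ψ : Linf) : (φ + ψ).fn =ᵐ[volume] φ.fn + ψ.fn :=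
  AEEqFun.coeFn_add φ.fn ψ.fn
theorem Linf.coe_mul (φ ψ : Linf) : (φ * ψ).fn =ᵐ[volume] φ.fn * ψ.fn :=
  AEEqFun.coeFn_mul φ.fn ψ.fn
theorem Linf.coe_smul (c : ℂ) (φ : Linf) : (c • φ).fn =ᵐ[volume] c • ⇑φ.fn :=
  AEEqFun.coeFn_smul c φ.fn
theorem Linf.coe_star (φ : Linf) : (star φ).fn =ᵐ[volume] star ⇑φ.fn :=
  AEEqFun.coeFn_star φ.fn
theorem Linf.coe_one : (1 : Linf).fn =ᵐ[volume] 1 := AEEqFun.coeFn_one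
theorem Linf.coe_zero : (0 : Linf).fn =ᵐ[volume] 0 := AEEqFun.coeFn_zero

theorem Linf.mul_comm' (φ ψ : Linf) : φ * ψ = ψ * φ := Subtype.ext (mul_comm φ.fn ψ.fn)

theorem Linf.left_distrib' (φ ψ χ : Linf) : φ * (ψ + χ) = φ * ψ + φ * χ := by
  apply Linf.ext_ae
  filter_upwards [Linf.coe_mul φ (ψ + χ), Linf.coe_add ψ χ, Linf.coe_add (φ * ψ) (φ * χ),
    Linf.coe_mul φ ψ, Linf.coe_mul φ χ] with t h1 h2 h3 h4 h5
  simp [h1, h2, h3, h4, h5, mul_add]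

theorem Linf.zero_mul' (φ : Linf) : 0 * φ = 0 := by
  apply Linf.ext_ae
  filter_upwards [Linf.coe_mul 0 φ, Linf.coe_zero] with t h1 h2
  simp [h1, h2]

instance : CommRing Linf :=
  { (inferInstance : AddCommGroup Linf) with
    mul := (· * ·)
    one := 1
    mul_comm := Linf.mul_comm'
    mul_assoc := fun φ ψ χ => Subtype.ext (mul_assoc φ.fn ψ.fn χ.fn)
    one_mul := fun φ => Subtype.ext (one_mul φ.fn)
    mul_one := fun φ => Subtype.ext (mul_one φ.fn)
    left_distrib := Linf.left_distrib'
    right_distrib := fun φ ψ χ => by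
      rw [Linf.mul_comm', Linf.left_distrib', Linf.mul_comm' χ, Linf.mul_comm' χ]
    zero_mul := Linf.zero_mul'
    mul_zero := fun φ => by rw [Linf.mul_comm', Linf.zero_mul'] }

theorem Linf.smul_mul' (c : ℂ) (φ ψ : Linf) : c • φ * ψ = c • (φ * ψ) := by
  apply Linf.ext_ae
  filter_upwards [Linf.coe_mul (c • φ) ψ, Linf.coe_smul c φ, Linf.coe_smul c (φ * ψ),
    Linf.coe_mul φ ψ] with t h1 h2 h3 h4
  simp [h1, h2, h3, h4, mul_assoc]

instance : Algebra ℂ Linf := Algebra.ofModule Linf.smul_mul' fun c φ ψ => by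
  rw [mul_comm, Linf.smul_mul', mul_comm]

instance : StarRing Linf where
  star_involutive φ := Subtype.ext (star_star φ.fn)
  star_mul φ ψ := by
    apply Linf.ext_ae
    filter_upwards [Linf.coe_star (φ * ψ), Linf.coe_mul φ ψ, Linf.coe_mul (star ψ) (star φ),
      Linf.coe_star φ, Linf.coe_star ψ] with t h1 h2 h3 h4 h5
    rw [h1, h3, Pi.star_apply, Pi.mul_apply, h2, h4, h5, Pi.mul_apply, star_mul]
    rfl
  star_add φ ψ := by
    apply Linf.ext_ae
    filter_upwards [Linf.coe_star (φ + ψ), Linf.coe_add φ ψ, Linf.coe_add (star φ) (star ψ),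
      Linf.coe_star φ, Linf.coe_star ψ] with t h1 h2 h3 h4 h5
    simp [h1, h2, h3, h4, h5]

instance : StarModule ℂ Linf where
  star_smul c φ := by
    apply Linf.ext_ae
    filter_upwards [Linf.coe_star (c • φ), Linf.coe_smul c φ, Linf.coe_smul (star c) (star φ),
      Linf.coe_star φ] with t h1 h2 h3 h4
    rw [h1, h3, Pi.star_apply, Pi.smul_apply, h2, h4, Pi.smul_apply, star_smul]
    rfl

/-- `L_∞(S¹)` with the inner product `⟨φ, ψ⟩ = ∫ conj φ ψ dλ`. -/
def PreCirc : Type := Linf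

instance : AddCommGroup PreCirc := inferInstanceAs (AddCommGroup Linf)
instance : Module ℂ PreCirc := inferInstanceAs (Module ℂ Linf)

/-- The identity `L_∞(S¹) → L_∞(S¹)`. -/
def PreCirc.equiv : Linf ≃ₗ[ℂ] PreCirc := LinearEquiv.refl ℂ Linf

/-- The underlying element of `L_∞(S¹)`. -/
def PreCirc.linf (φ : PreCirc) : Linf := PreCirc.equiv.symm φ

/-- `∫ conj φ ψ dλ`. -/
def circInner (φ ψ : Linf) : ℂ := ∫ t : S1, conj (φ.fn t) * ψ.fn t

theorem circInner_integrable (φ ψ : Linf) :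
    Integrable (fun t : S1 => conj (φ.fn t) * ψ.fn t) volume := by
  have h : MemLp (fun t : S1 => conj (φ.fn t) * ψ.fn t) ∞ volume :=
    ψ.memLp.mul φ.memLp.star (r := ∞)
  exact h.integrable le_top

/-- The inner product `⟨φ, ψ⟩ = ∫ conj φ ψ dλ` on `L_∞(S¹)`. -/
@[reducible] def PreCirc.core : InnerProductSpace.Core ℂ PreCirc where
  inner φ ψ := circInner φ.linf ψ.linf
  conj_inner_symm φ ψ := by
    change conj (circInner ψ.linf φ.linf) = circInner φ.linf ψ.linf
    rw [circInner, circInner, ← integral_conj]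
    congr 1
    ext t
    rw [map_mul, Complex.conj_conj, mul_comm]
  re_inner_nonneg φ := by
    have : circInner φ.linf φ.linf = ((∫ t : S1, ‖φ.linf.fn t‖ ^ 2 : ℝ) : ℂ) := by
      rw [circInner, ← integral_complex_ofReal]
      simp [Complex.conj_mul']
    change 0 ≤ (circInner φ.linf φ.linf).re
    rw [this, Complex.ofReal_re]
    exact integral_nonneg fun t => sq_nonneg _
  add_left φ ψ χ := by
    change circInner (φ.linf + ψ.linf) χ.linf = circInner φ.linf χ.linf + circInner ψ.linf χ.linf
    rw [circInner, circInner, circInner, ← integral_add (circInner_integrable _ _)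
      (circInner_integrable _ _)]
    apply integral_congr_ae
    filter_upwards [Linf.coe_add φ.linf ψ.linf] with t h
    simp [h, add_mul]
  smul_left φ ψ c := by
    change circInner (c • φ.linf) ψ.linf = conj c * circInner φ.linf ψ.linf
    rw [circInner, circInner, ← integral_const_mul]
    apply integral_congr_ae
    filter_upwards [Linf.coe_smul c φ.linf] with t h
    simp [h, mul_assoc]
  definite φ hφ := by
    have : circInner φ.linf φ.linf = ((∫ t : S1, ‖φ.linf.fn t‖ ^ 2 : ℝ) : ℂ) := by
      rw [circInner, ← integral_complex_ofReal]
      simp [Complex.conj_mul']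
    have hint : Integrable (fun t : S1 => ‖φ.linf.fn t‖ ^ 2) volume := by
      have := (circInner_integrable φ.linf φ.linf).norm
      simpa [sq] using this
    change circInner φ.linf φ.linf = 0 at hφ
    rw [this, Complex.ofReal_eq_zero, integral_eq_zero_iff_of_nonneg (fun t => sq_nonneg _) hint]
      at hφ
    have h0 : φ.linf = 0 := by
      apply Linf.ext_ae
      filter_upwards [hφ, Linf.coe_zero] with t h1 h2
      rw [h2]
      simpa using h1
    exact h0

instance : NormedAddCommGroup PreCirc := PreCirc.core.toNormedAddCommGroup
instance : InnerProductSpace ℂ PreCirc := InnerProductSpace.ofCore PreCirc.core.toCore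

/-- A continuous function on the circle as an element of `L_∞(S¹)`. -/
def ofCont (f : C(S1, ℂ)) : Linf := ContinuousMap.toLp ∞ (volume : Measure S1) ℂ f


/-- The `*`-algebra `F(D_q) ⊗ L_∞(S¹)`. -/
abbrev ChartAlg (q : QParam) : Type := discAlg q ⊗[ℂ] Linf

/-- `F(D_q) ⊗ L_∞(S¹)` with the tensor product inner product. -/
abbrev PreHilb (q : QParam) (α : AParam) : Type := PreDisc q α ⊗[ℂ] PreCirc

/-- The Hilbert space completion `L_2(D_q) ⊗ L_2(S¹)` of `F(D_q) ⊗ L_∞(S¹)`. -/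
abbrev Hilb (q : QParam) (α : AParam) : Type := UniformSpace.Completion (PreHilb q α)

/-- The identity `F(D_q) ⊗ L_∞(S¹) → F(D_q) ⊗ L_∞(S¹)`. -/
def toPre (q : QParam) (α : AParam) : ChartAlg q ≃ₗ[ℂ] PreHilb q α :=
  TensorProduct.congr (PreDisc.equiv q α) PreCirc.equiv

/-- The canonical map of `F(D_q) ⊗ L_∞(S¹)` into its completion. -/
def toHilb (q : QParam) (α : AParam) : ChartAlg q →ₗ[ℂ] Hilb q α :=
  (UniformSpace.Completion.toComplₗᵢ (𝕜 := ℂ) (E := PreHilb q α)).toLinearMap ∘ₗ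
    (toPre q α).toLinearMap

theorem inner_toHilb_tmul (q : QParam) (α : AParam) (f g : discAlg q) (φ ψ : Linf) :
    ⟪toHilb q α (f ⊗ₜ φ), toHilb q α (g ⊗ₜ ψ)⟫_ℂ =
      discInner q α f g * circInner φ ψ := by
  change ⟪((toPre q α (f ⊗ₜ φ) : PreHilb q α) : Hilb q α), ((toPre q α (g ⊗ₜ ψ) : PreHilb q α) : Hilb q α)⟫_ℂ = _
  rw [UniformSpace.Completion.inner_coe]
  exact TensorProduct.inner_tmul ℂ _ _ _ _

theorem denseRange_toHilb (q : QParam) (α : AParam) : DenseRange (toHilb q α) :=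
  UniformSpace.Completion.denseRange_coe.comp (toPre q α).surjective.denseRange
    (UniformSpace.Completion.continuous_coe _)


/-- `f(y²)`. -/
def ofYSq (q : QParam) (f : ℝ → ℂ) : Op ℕ := ofY q fun t => f (t ^ 2)

/-- `f ∈ C^(1)(spec(y²))`. The only accumulation point of the spectrum is `0`, so this is
differentiability at `0` along the spectrum. -/
def DiffOnSpec (q : QParam) (f : ℝ → ℂ) : Prop := DifferentiableOn ℝ f (spectrum ℝ (yOp q ^ 2))

/-- `F^(1)(D_q)`: the set of all `∑_{n=0}^N z^n f_n(y²) + ∑_{n=1}^M f_{-n}(y²) z^{*n}` with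
`f_j ∈ C^(1)(spec(y²))`. -/
def discDiff (q : QParam) : Set (Op ℕ) :=
  {T | ∃ (N M : ℕ) (f : ℤ → ℝ → ℂ), (∀ j, DiffOnSpec q (f j)) ∧
    T = ∑ n ∈ Finset.range (N + 1), zOp q ^ n * ofYSq q (f n) +
      ∑ n ∈ Finset.Icc 1 M, ofYSq q (f (-n)) * star (zOp q) ^ n}

/-- The continuous function `φ` on the circle is differentiable with continuous derivative `φ'`
with respect to `t`. -/
def HasCircDeriv (φ φ' : C(S1, ℂ)) : Prop :=
  ∀ t : ℝ, HasDerivAt (fun r : ℝ => φ (r : S1)) (φ' (t : S1)) t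

/-- `C^(1)(S¹)` as a subset of `L_∞(S¹)`. -/
def circDiff : Set Linf := {ψ | ∃ φ φ' : C(S1, ℂ), HasCircDeriv φ φ' ∧ ψ = ofCont φ}

/-- `F^(1)(D_q) ⊗ C^(1)(S¹)` as a subspace of `F(D_q) ⊗ L_∞(S¹)`. -/
def chartDiff (q : QParam) : Submodule ℂ (ChartAlg q) :=
  Submodule.span ℂ {w | ∃ (g : discAlg q) (φ : Linf),
    (g : Op ℕ) ∈ discDiff q ∧ φ ∈ circDiff ∧ w = g ⊗ₜ[ℂ] φ}

theorem tmul_mem_chartDiff {q : QParam} {g : discAlg q} {φ : Linf}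
    (hg : (g : Op ℕ) ∈ discDiff q) (hφ : φ ∈ circDiff) : g ⊗ₜ[ℂ] φ ∈ chartDiff q :=
  Submodule.subset_span ⟨g, φ, hg, hφ, rfl⟩

/-- `h = ∂g/∂z = (1-q²)⁻¹ y⁻² [z^*, g]`, where `y⁻²` is the (unbounded) inverse of the injective
operator `y²`. -/
def IsPartialZ (q : QParam) (g h : Op ℕ) : Prop :=
  yOp q ^ 2 * h = (((1 - (q : ℝ) ^ 2)⁻¹ : ℝ) : ℂ) • (star (zOp q) * g - g * star (zOp q))

/-- `h = ∂g/∂z̄ = -(1-q²)⁻¹ y⁻² [z, g]`. -/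
def IsPartialZbar (q : QParam) (g h : Op ℕ) : Prop :=
  yOp q ^ 2 * h = ((-(1 - (q : ℝ) ^ 2)⁻¹ : ℝ) : ℂ) • (zOp q * g - g * zOp q)

/-- `a^{#k} = a^k` for `k ≥ 0` and `(a^*)^{-k}` for `k < 0`. -/
def sharp {A : Type} [Monoid A] [Star A] (a : A) (k : ℤ) : A :=
  if 0 ≤ k then a ^ k.toNat else star a ^ (-k).toNat

/-- `s` as an element of `F(D_q)`. -/
def sElt (q : QParam) : discAlg q := ⟨sOp, s_mem q⟩

/-- `z` as an element of `F(D_q)`. -/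
def zElt (q : QParam) : discAlg q := ⟨zOp q, z_mem q⟩

/-- `y` as an element of `F(D_q)`. -/
def yElt (q : QParam) : discAlg q := ⟨yOp q, y_mem q⟩

/-- `δ_{q^n}(y)` as an element of `F(D_q)`. -/
def deltaElt (q : QParam) (n : ℕ) : discAlg q := ⟨ofY q (deltaFn q n), delta_mem q n⟩

/-- `z` as an element of `O(D_q)`. -/
def zGen (q : QParam) : discPoly q :=
  ⟨zOp q, StarAlgebra.subset_adjoin ℂ {zOp q} (Set.mem_singleton _)⟩

/-- An element of `O(D_q)` as an element of `F(D_q)`. -/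
def polyToDisc {q : QParam} (x : discPoly q) : discAlg q := ⟨x, discPoly_le q x.2⟩

/-- The unitary generator `u(e^{it}) = e^{it}`. -/
def uElt : Linf := ofCont (fourier 1)

/-- `e_{nkl} = q^{-αn/2} (1-q)^{-1/2} s^{#(k-n)} δ_{q^n}(y) ⊗ (2π)^{-1/2} e^{ilt}`. -/
def basisFn (q : QParam) (α : AParam) (n k : ℕ) (l : ℤ) : ChartAlg q :=
  ((((q : ℝ) ^ (-((α : ℝ) * n / 2)) / √(1 - (q : ℝ)) : ℝ) : ℂ) •
      (sharp (sElt q) ((k : ℤ) - n) * deltaElt q n)) ⊗ₜ[ℂ]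
    (((1 / √(2 * Real.pi) : ℝ) : ℂ) • ofCont (fourier l))

/-- The bounded operator `T` on the completion extends left multiplication by `x`. -/
def IsLeftMul (q : QParam) (α : AParam) (T : Hilb q α →L[ℂ] Hilb q α) (x : ChartAlg q) : Prop :=
  ∀ w : ChartAlg q, T (toHilb q α w) = toHilb q α (x * w)

/-- The bounded operator `T` on the completion extends right multiplication by `x`. -/
def IsRightMul (q : QParam) (α : AParam) (T : Hilb q α →L[ℂ] Hilb q α) (x : ChartAlg q) : Prop :=
  ∀ w : ChartAlg q, T (toHilb q α w) = toHilb q α (w * x)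

/-- The injection `(n, k) ↦ (n, k + 1)`. -/
def rightEmb : ℕ × ℤ ↪ ℕ × ℤ :=
  ⟨fun p => (p.1, p.2 + 1), fun p r h => by
    simp only [Prod.mk.injEq, add_left_inj] at h
    exact Prod.ext h.1 h.2⟩

/-- The injection `(n, k) ↦ (n + 1, k)`. -/
def upEmb : ℕ × ℤ ↪ ℕ × ℤ :=
  ⟨fun p => (p.1 + 1, p.2), fun p r h => by
    simp only [Prod.mk.injEq, add_left_inj] at h
    exact Prod.ext h.1 h.2⟩

/-- `c (e_n ⊗ b_k) = q^n e_n ⊗ b_{k+1}` on `ℓ²(ℕ) ⊗ ℓ²(ℤ) = ℓ²(ℕ × ℤ)`. -/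
def cOp (q : QParam) : Op (ℕ × ℤ) := wshift rightEmb fun p => (((q : ℝ) ^ p.1 : ℝ) : ℂ)

/-- `d (e_n ⊗ b_k) = √(1 - q^{2(n+1)}) e_{n+1} ⊗ b_k` on `ℓ²(ℕ) ⊗ ℓ²(ℤ) = ℓ²(ℕ × ℤ)`. -/
def dOp (q : QParam) : Op (ℕ × ℤ) :=
  wshift upEmb fun p => ((√(1 - (q : ℝ) ^ (2 * (p.1 + 1))) : ℝ) : ℂ)

/-- The C*-algebra `C(SU_q(2))`: the norm closure of the `*`-algebra generated by the operators
`c` and `d` on `ℓ²(ℕ) ⊗ ℓ²(ℤ)`. -/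
def CSU (q : QParam) : StarSubalgebra ℂ (Op (ℕ × ℤ)) :=
  (StarAlgebra.adjoin ℂ {cOp q, dOp q}).topologicalClosure

/-- The generator `c` of `C(SU_q(2))`. -/
def cGen (q : QParam) : CSU q :=
  ⟨cOp q, StarSubalgebra.le_topologicalClosure _
    (StarAlgebra.subset_adjoin ℂ {cOp q, dOp q} (by simp))⟩

/-- The generator `d` of `C(SU_q(2))`. -/
def dGen (q : QParam) : CSU q :=
  ⟨dOp q, StarSubalgebra.le_topologicalClosure _
    (StarAlgebra.subset_adjoin ℂ {cOp q, dOp q} (by simp))⟩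

/-- The defining relations of the `*`-algebra `O(SU_q(2))`. -/
def SUqRel (q : QParam) {A : Type} [Ring A] [StarRing A] [Algebra ℂ A] (c d : A) : Prop :=
  c * d = ((q : ℝ) : ℂ) • (d * c) ∧ star c * d = ((q : ℝ) : ℂ) • (d * star c) ∧
    c * star c = star c * c ∧
    star d * d + (((q : ℝ) ^ 2 : ℝ) : ℂ) • (c * star c) = 1 ∧ d * star d + c * star c = 1

/-- The representation of `C(SU_q(2))` sends `c` and `d` to left multiplication by `y ⊗ u` and
`z ⊗ 1`. -/
def IsChartRep (q : QParam) (α : AParam) (π : CSU q →⋆ₐ[ℂ] (Hilb q α →L[ℂ] Hilb q α)) : Prop :=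
  IsLeftMul q α (π (cGen q)) (yElt q ⊗ₜ[ℂ] uElt) ∧ IsLeftMul q α (π (dGen q)) (zElt q ⊗ₜ[ℂ] 1)

/-- The representation of `C(SU_q(2))^op` sends `c^op` and `d^op` to right multiplication by
`y ⊗ u^*` and `q^{α/2} z ⊗ 1`. -/
def IsChartRepOp (q : QParam) (α : AParam)
    (ρ : (CSU q)ᵐᵒᵖ →⋆ₐ[ℂ] (Hilb q α →L[ℂ] Hilb q α)) : Prop :=
  IsRightMul q α (ρ (MulOpposite.op (cGen q))) (yElt q ⊗ₜ[ℂ] star uElt) ∧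
    IsRightMul q α (ρ (MulOpposite.op (dGen q)))
      ((((q : ℝ) ^ ((α : ℝ) / 2) : ℝ) : ℂ) • (zElt q ⊗ₜ[ℂ] 1))

end QuantumSU2

end

open QuantumSU2

noncomputable section
namespace QuantumSU2

open Filter Topology

/-! Everything is read off from matrices. An element `f` of `F(D_q)` is a bounded banded matrix, and
`⟨f, g⟩` is the weighted Hilbert–Schmidt product `(1-q) ∑_n q^{αn} ∑_k conj f_{kn} g_{kn}`. With
`N_n = q^{-αn/2} (1-q)^{-1/2}` (`normConst`), `e_{nkl}` is `N_n` times the matrix unit in row `k`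
and column `n`, tensored with a normalized character, so the coefficient of `f ⊗ φ` at `e_{nkl}` is
`N_n⁻¹ f_{kn}` times a Fourier coefficient of `φ`. Parseval in each column of `f` and on the circle
gives Parseval for pure tensors (`hasSum_sq_discInner`, `hasSum_sq_circInner`), and equality in
Bessel's inequality puts them in the closed span of the `e_{nkl}` (`mem_closure_span_of_hasSum`).

In these coordinates left multiplication acts on the row index `k` and right multiplication, by
transposition, on the column index `n`. Both are amplifications (`amp`) of operators on a small `ℓ²`
space, transported along the basis (`transport`), so boundedness and `*`-compatibility are
inherited. On the right, the ratio `N_{n+1} / N_n = q^{-α/2}` enters: `z^op` is `q^{-α/2}` times an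
amplified `z^*`, and `z^{*op}` is `q^{α/2}` times an amplified `z`. This gives `z^{*op} = q^α
(z^op)^*`, and it explains the factor in `d^op = q^{α/2} z^op`, after which `d^op` is free of `α`.
The two representations of `C(SU_q(2))` are the amplification of `a` over `(k, l)` and that of the
transpose of `a` over `(n, l)`; they commute because the generators do (`commute_generators`), and
closure does the rest (`CSU_commute`).

For the derivatives, the spectrum of `y²` is `{0} ∪ {q^{2j}}` with `0` as its only accumulation
point, so a `C^(1)` function on it is a sequence `a_j = L + D q^{2j} + o(q^{2j})` (`SeqDiff`). Since
the weights of `z` and their inverses have such expansions, `F^(1)(D_q)` consists of the banded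
matrices whose diagonals all have one (`discDiff_eq`), which is visibly a `*`-algebra. The weights
of `z` tend to `1`, so commutators with `z` and `z^*` tend to `0` along diagonals, hence are
`O(q^{2j})` and divisible by `y²` (`exists_yOp_sq_mul_eq`).

Finally, the unitary matching the bases for `α` and `β` is the identity in coordinates, hence
intertwines all transported operators, whereas the derivative formulas carry a coefficient
`q^{±α/2}` that distinguishes `α` from `β` (`basisChange_ne`). -/

theorem star_wshift_basisVec {ι : Type} [DecidableEq ι] (σ : ι ↪ ι) (a : ι → ℂ)
    (ha : ∃ C : ℝ, ∀ i, ‖a i‖ ≤ C) (i : ι) :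
    star (wshift σ a) (basisVec (σ i)) = conj (a i) • basisVec i := by
  ext j
  rw [star_wshift_apply σ a ha]
  simp [basisVec, lp.single_apply, Pi.single_apply, σ.injective.eq_iff]
  split_ifs with h
  · rw [h]
  · rfl

theorem wshift_apply_emb {ι : Type} (σ : ι ↪ ι) (a : ι → ℂ)
    (ha : ∃ C : ℝ, ∀ i, ‖a i‖ ≤ C) (x : Ell2 ι) (i : ι) :
    wshift σ a x (σ i) = a i * x i := by
  classical
  rw [← inner_basisVec, ← ContinuousLinearMap.adjoint_inner_left,
    ← ContinuousLinearMap.star_eq_adjoint, star_wshift_basisVec σ a ha, inner_smul_left,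
    inner_basisVec, Complex.conj_conj]

theorem wshift_apply_notMem {ι : Type} (σ : ι ↪ ι) (a : ι → ℂ)
    (ha : ∃ C : ℝ, ∀ i, ‖a i‖ ≤ C) (x : Ell2 ι) (i : ι) (hi : ∀ j, σ j ≠ i) :
    wshift σ a x i = 0 := by
  classical
  rw [← inner_basisVec, ← ContinuousLinearMap.adjoint_inner_left,
    ← ContinuousLinearMap.star_eq_adjoint]
  have : star (wshift σ a) (basisVec i) = 0 := by
    ext j
    rw [star_wshift_apply σ a ha]
    simp [basisVec, lp.single_apply, hi j]
  rw [this, inner_zero_left]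

/-! ### Amplifications `1 ⊗ a` on `ℓ²(J × I)`. -/

section Amplification

variable {I J K : Type}

/-- The `j`-th slice of a vector in `ℓ²(K) = ℓ²(J × I)`. -/
def slice (e : J × I ≃ K) (j : J) : Ell2 K →ₗ[ℂ] Ell2 I where
  toFun x := ⟨fun i => x (e (j, i)), by
    apply memℓp_gen
    have : Function.Injective fun i => e (j, i) := fun i i' h => by simpa using h
    simpa [Function.comp_def] using (summable_sq x).comp_injective this⟩
  map_add' x y := rfl
  map_smul' c x := rfl

theorem slice_apply (e : J × I ≃ K) (j : J) (x : Ell2 K) (i : I) :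
    slice e j x i = x (e (j, i)) := rfl

theorem ext_slice {e : J × I ≃ K} {x y : Ell2 K} (h : ∀ j, slice e j x = slice e j y) :
    x = y := by
  ext k
  obtain ⟨⟨j, i⟩, rfl⟩ := e.surjective k
  exact congrArg (fun z : Ell2 I => z i) (h j)

/-- Fubini for the absolutely convergent series of the inner product; this is the decomposition of
`ℓ²(K)` into an orthogonal sum of slices. -/
theorem hasSum_inner_slice (e : J × I ≃ K) (x y : Ell2 K) :
    HasSum (fun j => ⟪slice e j x, slice e j y⟫_ℂ) ⟪x, y⟫_ℂ := by
  have h := (e.hasSum_iff (f := fun k => ⟪x k, y k⟫_ℂ)).mpr (lp.hasSum_inner x y)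
  exact h.prod_fiberwise fun j => lp.hasSum_inner (slice e j x) (slice e j y)

theorem hasSum_norm_slice (e : J × I ≃ K) (x : Ell2 K) :
    HasSum (fun j => ‖slice e j x‖ ^ 2) (‖x‖ ^ 2) := by
  have h := hasSum_inner_slice e x x
  simp only [inner_self_eq_norm_sq_to_K] at h
  exact_mod_cast h

/-- Each slice satisfies `‖a x_j‖² ≤ ‖a‖² ‖x_j‖²`, and the squared norms of the slices add up to
`‖x‖²`. -/
theorem memℓp_amp (e : J × I ≃ K) (a : Op I) (x : Ell2 K) :
    Memℓp (fun k => a (slice e (e.symm k).1 x) (e.symm k).2) 2 := by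
  apply memℓp_gen
  rw [← e.summable_iff]
  simp only [Function.comp_def, Equiv.symm_apply_apply, ENNReal.toReal_ofNat, Real.rpow_ofNat]
  rw [summable_prod_of_nonneg fun _ => by positivity]
  refine ⟨fun j => summable_sq (a (slice e j x)), ?_⟩
  simp only [← norm_sq_eq]
  refine Summable.of_nonneg_of_le (fun j => by positivity) (fun j => ?_)
    ((hasSum_norm_slice e x).summable.mul_left (‖a‖ ^ 2))
  rw [← mul_pow]
  gcongr
  exact a.le_opNorm _

/-- The linear map underlying the amplification of an operator. -/
def ampLin (e : J × I ≃ K) (a : Op I) : Ell2 K →ₗ[ℂ] Ell2 K where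
  toFun x := ⟨_, memℓp_amp e a x⟩
  map_add' x y := by ext k; simp; rfl
  map_smul' c x := by ext k; simp

theorem slice_ampLin (e : J × I ≃ K) (a : Op I) (x : Ell2 K) (j : J) :
    slice e j (ampLin e a x) = a (slice e j x) := by
  ext i
  change a (slice e (e.symm (e (j, i))).1 x) (e.symm (e (j, i))).2 = _
  simp

/-- The amplification `1 ⊗ a` on `ℓ²(K) = ℓ²(J) ⊗ ℓ²(I)` of an operator `a` on `ℓ²(I)`. -/
def ampOp (e : J × I ≃ K) (a : Op I) : Op K :=
  (ampLin e a).mkContinuous ‖a‖ fun x => by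
    apply le_of_sq_le_sq _ (by positivity)
    rw [mul_pow]
    refine hasSum_le (fun j => ?_) (hasSum_norm_slice e _)
      ((hasSum_norm_slice e x).mul_left (‖a‖ ^ 2))
    rw [slice_ampLin, ← mul_pow]
    gcongr
    exact a.le_opNorm _

theorem slice_ampOp (e : J × I ≃ K) (a : Op I) (x : Ell2 K) (j : J) :
    slice e j (ampOp e a x) = a (slice e j x) := slice_ampLin e a x j

/-- Amplification as a `*`-homomorphism. -/
def amp (e : J × I ≃ K) : Op I →⋆ₐ[ℂ] Op K where
  toFun := ampOp e
  map_one' := by ext1 x; exact ext_slice fun j => slice_ampOp e 1 x j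
  map_mul' a b := by
    ext1 x
    refine ext_slice (e := e) fun j => ?_
    rw [mul_apply_eq_comp, slice_ampOp, slice_ampOp, slice_ampOp, mul_apply_eq_comp]
  map_zero' := by
    ext1 x
    refine ext_slice (e := e) fun j => ?_
    rw [slice_ampOp]
    simp
  map_add' a b := by
    ext1 x
    refine ext_slice (e := e) fun j => ?_
    rw [_root_.add_apply, map_add, slice_ampOp, slice_ampOp, slice_ampOp, _root_.add_apply]
  commutes' c := by
    ext1 x
    refine ext_slice (e := e) fun j => ?_
    rw [slice_ampOp, Algebra.algebraMap_eq_smul_one, Algebra.algebraMap_eq_smul_one]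
    simp
  map_star' a := by
    rw [ContinuousLinearMap.star_eq_adjoint, ContinuousLinearMap.star_eq_adjoint,
      ContinuousLinearMap.eq_adjoint_iff]
    intro x y
    -- Both inner products are sums over slices, so the adjoint may be moved across inside each
    -- slice.
    refine (hasSum_inner_slice e _ _).unique ?_
    convert! hasSum_inner_slice e x (ampOp e a y) using 2 with j
    rw [slice_ampOp, slice_ampOp, ContinuousLinearMap.adjoint_inner_left]

theorem amp_apply (e : J × I ≃ K) (a : Op I) (x : Ell2 K) (j : J) (i : I) :
    amp e a x (e (j, i)) = a (slice e j x) i :=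
  congrArg (fun z : Ell2 I => z i) (slice_ampOp e a x j)

end Amplification

/-! ### Transposition on `ℓ²(I)`. -/

section Transposition

variable {I : Type}

/-- Entrywise complex conjugation on `ℓ²(I)`. -/
def conjL : Ell2 I →L⋆[ℂ] Ell2 I := (starₗᵢ ℂ : Ell2 I ≃ₗᵢ⋆[ℂ] Ell2 I).toContinuousLinearEquiv

theorem conjL_apply (x : Ell2 I) (i : I) : conjL x i = conj (x i) := rfl

theorem conjL_conjL (x : Ell2 I) : conjL (conjL x) = x := star_star x

theorem inner_conjL (x y : Ell2 I) : ⟪conjL x, conjL y⟫_ℂ = ⟪y, x⟫_ℂ := by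
  rw [lp.inner_eq_tsum, lp.inner_eq_tsum]
  refine tsum_congr fun i => ?_
  simp [conjL_apply, mul_comm]

/-- The transpose of an operator on `ℓ²(I)`. -/
def transpOp (a : Op I) : Op I := conjL.comp ((star a).comp conjL)

theorem transpOp_apply (a : Op I) (x : Ell2 I) : transpOp a x = conjL (star a (conjL x)) := rfl

/-- Transposition as a `*`-homomorphism from the opposite algebra. -/
def transp : (Op I)ᵐᵒᵖ →⋆ₐ[ℂ] Op I where
  toFun a := transpOp a.unop
  map_one' := by ext1 x; simp [transpOp_apply, conjL_conjL]
  map_mul' a b := by ext1 x; simp [transpOp_apply, conjL_conjL, mul_apply_eq_comp]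
  map_zero' := by ext1 x; simp [transpOp_apply]
  map_add' a b := by ext1 x; simp [transpOp_apply]
  commutes' c := by
    ext1 x
    simp [transpOp_apply, Algebra.algebraMap_eq_smul_one, conjL_conjL]
  map_star' a := by
    rw [ContinuousLinearMap.star_eq_adjoint, ContinuousLinearMap.eq_adjoint_iff]
    intro x y
    rw [transpOp_apply, transpOp_apply, ← conjL_conjL y, inner_conjL, ← conjL_conjL x,
      inner_conjL, conjL_conjL, conjL_conjL]
    simp [ContinuousLinearMap.star_eq_adjoint, ContinuousLinearMap.adjoint_inner_left]

theorem transp_apply (a : Op I) (x : Ell2 I) :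
    transp (MulOpposite.op a) x = conjL (star a (conjL x)) := rfl

/-- Involutivity lets statements about the opposite algebra be carried over to the algebra itself
and back. -/
theorem transp_transp (a : Op I) : transp (MulOpposite.op (transp (MulOpposite.op a))) = a := by
  ext1 x
  rw [transp_apply, ← map_star, ← MulOpposite.op_star, transp_apply, conjL_conjL, conjL_conjL,
    star_star]

theorem transp_wshift_apply (σ : I ↪ I) (a : I → ℂ) (ha : ∃ C : ℝ, ∀ i, ‖a i‖ ≤ C)
    (x : Ell2 I) (i : I) : transp (MulOpposite.op (wshift σ a)) x i = a i * x (σ i) := by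
  rw [transp_apply, conjL_apply, star_wshift_apply σ a ha, conjL_apply]
  simp

end Transposition

/-! ### Sequences that are differentiable along `r^j → 0`. -/

/-- The sequence `a` is differentiable along the geometric sequence `r^j → 0`, that is,
`a_j = L + D r^j + o(r^j)`. -/
def SeqDiff (r : ℝ) (a : ℕ → ℂ) : Prop :=
  ∃ L D : ℂ, Tendsto (fun j => (a j - L) / ((r ^ j : ℝ) : ℂ)) atTop (𝓝 D)

section SeqDiff

variable {r : ℝ} {a b : ℕ → ℂ}

theorem tendsto_of_tendsto_div (hr : r ∈ Set.Ioo (0 : ℝ) 1) {L D : ℂ}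
    (h : Tendsto (fun j => (a j - L) / ((r ^ j : ℝ) : ℂ)) atTop (𝓝 D)) :
    Tendsto a atTop (𝓝 L) := by
  have h1 : Tendsto (fun j : ℕ => ((r ^ j : ℝ) : ℂ)) atTop (𝓝 0) := by
    have := (Complex.continuous_ofReal.tendsto 0).comp
      (tendsto_pow_atTop_nhds_zero_of_lt_one hr.1.le hr.2)
    simpa [Function.comp_def] using this
  have h2 := (h.mul h1).add_const L
  simp only [mul_zero, zero_add] at h2
  refine h2.congr fun j => ?_
  have : ((r ^ j : ℝ) : ℂ) ≠ 0 := by exact_mod_cast (pow_pos hr.1 j).ne'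
  rw [div_mul_cancel₀ _ this, sub_add_cancel]

/-- A convergent sequence of difference quotients is bounded. With `L = 0` this estimate is what
allows division by `y²`. -/
theorem SeqDiff.exists_norm_le (hr : r ∈ Set.Ioo (0 : ℝ) 1) (h : SeqDiff r a) :
    ∃ (L : ℂ) (C : ℝ), 0 ≤ C ∧ ∀ j, ‖a j - L‖ ≤ C * r ^ j := by
  obtain ⟨L, D, hD⟩ := h
  obtain ⟨C, hC⟩ := (Metric.isBounded_range_of_tendsto _ hD).exists_norm_le
  have hC' : ∀ j, ‖(a j - L) / ((r ^ j : ℝ) : ℂ)‖ ≤ C := fun j => hC _ ⟨j, rfl⟩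
  refine ⟨L, C, (norm_nonneg _).trans (hC' 0), fun j => ?_⟩
  have := hC' j
  rwa [norm_div, Complex.norm_real, Real.norm_of_nonneg (pow_pos hr.1 j).le,
    div_le_iff₀ (pow_pos hr.1 j)] at this

theorem SeqDiff.bdd (hr : r ∈ Set.Ioo (0 : ℝ) 1) (h : SeqDiff r a) : ∃ C : ℝ, ∀ j, ‖a j‖ ≤ C := by
  obtain ⟨L, D, hD⟩ := h
  obtain ⟨C, hC⟩ := (Metric.isBounded_range_of_tendsto _
    (tendsto_of_tendsto_div hr hD)).exists_norm_le
  exact ⟨C, fun j => hC _ ⟨j, rfl⟩⟩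

theorem SeqDiff.const (c : ℂ) : SeqDiff r fun _ => c := ⟨c, 0, by simp⟩

theorem SeqDiff.add (ha : SeqDiff r a) (hb : SeqDiff r b) : SeqDiff r fun j => a j + b j := by
  obtain ⟨L, D, h⟩ := ha
  obtain ⟨L', D', h'⟩ := hb
  exact ⟨L + L', D + D', (h.add h').congr fun j => by ring⟩

/-- Leibniz rule: `ab - LL' = (a - L) b + L (b - L')`. -/
theorem SeqDiff.mul (hr : r ∈ Set.Ioo (0 : ℝ) 1) (ha : SeqDiff r a) (hb : SeqDiff r b) :
    SeqDiff r fun j => a j * b j := by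
  obtain ⟨L, D, h⟩ := ha
  obtain ⟨L', D', h'⟩ := hb
  exact ⟨L * L', D * L' + L * D',
    ((h.mul (tendsto_of_tendsto_div hr h')).add (h'.const_mul L)).congr fun j => by ring⟩

theorem SeqDiff.sum {κ : Type} {F : Finset κ} {f : κ → ℕ → ℂ} (h : ∀ k ∈ F, SeqDiff r (f k)) :
    SeqDiff r fun j => ∑ k ∈ F, f k j := by
  classical
  induction F using Finset.induction_on with
  | empty => simpa using SeqDiff.const 0
  | insert k F hk ih =>
    simp only [Finset.sum_insert hk]
    exact (h k (by simp)).add (ih fun k' hk' => h k' (by simp [hk']))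

theorem SeqDiff.prod (hr : r ∈ Set.Ioo (0 : ℝ) 1) {κ : Type} {F : Finset κ} {f : κ → ℕ → ℂ}
    (h : ∀ k ∈ F, SeqDiff r (f k)) : SeqDiff r fun j => ∏ k ∈ F, f k j := by
  classical
  induction F using Finset.induction_on with
  | empty => simpa using SeqDiff.const 1
  | insert k F hk ih =>
    simp only [Finset.prod_insert hk]
    exact (h k (by simp)).mul hr (ih fun k' hk' => h k' (by simp [hk']))

theorem SeqDiff.conj (ha : SeqDiff r a) : SeqDiff r fun j => conj (a j) := by
  obtain ⟨L, D, h⟩ := ha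
  exact ⟨conj L, conj D, ((Complex.continuous_conj.tendsto D).comp h).congr fun j => by simp⟩

theorem SeqDiff.shift (hr : r ∈ Set.Ioo (0 : ℝ) 1) (ha : SeqDiff r a) (k : ℕ) :
    SeqDiff r fun j => a (j + k) := by
  obtain ⟨L, D, h⟩ := ha
  refine ⟨L, D * ((r ^ k : ℝ) : ℂ),
    (((tendsto_add_atTop_iff_nat k).mpr h).mul_const ((r ^ k : ℝ) : ℂ)).congr fun j => ?_⟩
  have : ((r : ℝ) : ℂ) ≠ 0 := by exact_mod_cast hr.1.ne'
  push_cast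
  rw [pow_add]
  field_simp

theorem SeqDiff.of_shift (k : ℕ)
    (ha : SeqDiff r fun j => a (j + k)) : SeqDiff r a := by
  obtain ⟨L, D, h⟩ := ha
  refine ⟨L, D / ((r ^ k : ℝ) : ℂ), (tendsto_add_atTop_iff_nat k).mp
    ((h.div_const ((r ^ k : ℝ) : ℂ)).congr fun j => ?_)⟩
  rw [div_div]
  push_cast
  rw [pow_add]

theorem SeqDiff.of_eventually_eq_zero (h : ∃ N, ∀ j, N ≤ j → a j = 0) : SeqDiff r a := by
  obtain ⟨N, hN⟩ := h
  refine ⟨0, 0, tendsto_const_nhds.congr' ?_⟩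
  filter_upwards [eventually_ge_atTop N] with j hj
  rw [hN j hj]
  simp

theorem tendsto_pow_punctured {r : ℝ} (hr : r ∈ Set.Ioo (0 : ℝ) 1) :
    Tendsto (fun j : ℕ => r ^ j) atTop (𝓝[Set.range fun j : ℕ => r ^ j] 0) :=
  tendsto_nhdsWithin_iff.mpr ⟨tendsto_pow_atTop_nhds_zero_of_lt_one hr.1.le hr.2,
    Eventually.of_forall fun j => ⟨j, rfl⟩⟩

/-- Points `r^j` close to `0` have large exponent `j`, so limits in `j` control limits at `0` along
the set. -/
theorem nhdsWithin_range_pow_le {r : ℝ} (hr : r ∈ Set.Ioo (0 : ℝ) 1) :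
    𝓝[Set.range fun j : ℕ => r ^ j] 0 ≤ map (fun j : ℕ => r ^ j) atTop := by
  intro A hA
  rw [mem_map, mem_atTop_sets] at hA
  obtain ⟨N, hN⟩ := hA
  rw [mem_nhdsWithin]
  refine ⟨Set.Iio (r ^ N), isOpen_Iio, pow_pos hr.1 N, ?_⟩
  rintro _ ⟨hj, j, rfl⟩
  exact hN j ((pow_lt_pow_iff_right_of_lt_one₀ hr.1 hr.2).mp hj).le

theorem range_pow_diff {r : ℝ} (hr : r ∈ Set.Ioo (0 : ℝ) 1) :
    (insert 0 (Set.range fun j : ℕ => r ^ j)) \ {0} = Set.range fun j : ℕ => r ^ j := by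
  rw [Set.insert_sdiff_self_of_notMem]
  rintro ⟨j, hj⟩
  exact (pow_pos hr.1 j).ne' hj

theorem seqDiff_of_differentiableWithinAt (hr : r ∈ Set.Ioo (0 : ℝ) 1) {f : ℝ → ℂ}
    (hf : DifferentiableWithinAt ℝ f (insert 0 (Set.range fun j : ℕ => r ^ j)) 0) :
    SeqDiff r fun j => f (r ^ j) := by
  refine ⟨f 0, derivWithin f (insert 0 (Set.range fun j : ℕ => r ^ j)) 0, ?_⟩
  have h := hasDerivWithinAt_iff_tendsto_slope.mp hf.hasDerivWithinAt
  rw [range_pow_diff hr] at h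
  refine (h.comp (tendsto_pow_punctured hr)).congr fun j => ?_
  simp [slope_def_module, div_eq_inv_mul]

/-- Prescribe `a_j` at `r^j` and `L` at `0`. The points `r^j` are isolated in the set and impose no
condition; at `0` the slopes are exactly the quotients in `SeqDiff`. -/
theorem SeqDiff.exists_differentiableOn (hr : r ∈ Set.Ioo (0 : ℝ) 1) (ha : SeqDiff r a) :
    ∃ f : ℝ → ℂ, DifferentiableOn ℝ f (insert 0 (Set.range fun j : ℕ => r ^ j)) ∧
      ∀ j : ℕ, f (r ^ j) = a j := by
  classical
  obtain ⟨L, D, h⟩ := ha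
  have hinj := pow_right_injective₀ hr.1 hr.2.ne
  set f : ℝ → ℂ := fun t => if t = 0 then L else a (Function.invFun (fun j : ℕ => r ^ j) t)
    with hf
  have hfj : ∀ j : ℕ, f (r ^ j) = a j := fun j => by
    have : Function.invFun (fun j : ℕ => r ^ j) (r ^ j) = j :=
      Function.leftInverse_invFun hinj j
    simp only [hf, if_neg (pow_pos hr.1 j).ne', this]
  refine ⟨f, ?_, hfj⟩
  rintro t (rfl | ⟨j, rfl⟩)
  · refine HasDerivWithinAt.differentiableWithinAt (f' := D) ?_
    rw [hasDerivWithinAt_iff_tendsto_slope, range_pow_diff hr]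
    refine Tendsto.mono_left ?_ (nhdsWithin_range_pow_le hr)
    rw [tendsto_map'_iff]
    refine h.congr fun j => ?_
    simp only [Function.comp_apply, slope_def_module, hfj]
    simp [hf, div_eq_inv_mul]
  -- This window meets the set only in `r^j`; the right endpoint is written `r^j / r` so that `j =
  -- 0` is included.
  · rw [← differentiableWithinAt_inter (t := Set.Ioo (r ^ (j + 1)) (r ^ j / r)) (Ioo_mem_nhds
      ((pow_lt_pow_iff_right_of_lt_one₀ hr.1 hr.2).mpr (by omega))
      ((lt_div_iff₀ hr.1).mpr (mul_lt_of_lt_one_right (pow_pos hr.1 j) hr.2)))]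
    have key : ∀ s ∈ insert 0 (Set.range fun j : ℕ => r ^ j) ∩ Set.Ioo (r ^ (j + 1)) (r ^ j / r),
        s = r ^ j := by
      rintro s ⟨rfl | ⟨i, rfl⟩, h1, h2⟩
      · exact absurd (pow_pos hr.1 (j + 1)) (not_lt.mpr h1.le)
      · simp only [lt_div_iff₀ hr.1, ← pow_succ,
          pow_lt_pow_iff_right_of_lt_one₀ hr.1 hr.2] at h1 h2
        have : i = j := by omega
        rw [this]
    exact DifferentiableWithinAt.of_subsingleton fun s hs s' hs' =>
      (key s hs).trans (key s' hs').symm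

theorem seqDiff_of_differentiableAt (hr : r ∈ Set.Ioo (0 : ℝ) 1) {f : ℝ → ℂ}
    (hf : DifferentiableAt ℝ f 0) : SeqDiff r fun j => f (r ^ j) :=
  seqDiff_of_differentiableWithinAt hr hf.differentiableWithinAt

end SeqDiff

theorem sq_mem_Ioo (q : QParam) : (q : ℝ) ^ 2 ∈ Set.Ioo (0 : ℝ) 1 :=
  ⟨pow_pos q.2.1 2, pow_lt_one₀ q.2.1.le q.2.2 two_ne_zero⟩

/-! ### Diagonal operators and the spectrum of `y²`. -/

section Diagonal

theorem diag_mul {ι : Type} {a b : ι → ℂ} (ha : ∃ C : ℝ, ∀ i, ‖a i‖ ≤ C)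
    (hb : ∃ C : ℝ, ∀ i, ‖b i‖ ≤ C) :
    wshift (Function.Embedding.refl ι) a * wshift (Function.Embedding.refl ι) b =
      wshift (Function.Embedding.refl ι) fun i => a i * b i := by
  obtain ⟨C, hC⟩ := ha
  obtain ⟨C', hC'⟩ := hb
  have hab : ∃ C : ℝ, ∀ i, ‖a i * b i‖ ≤ C :=
    ⟨C * C', fun i => by
      rw [norm_mul]
      exact mul_le_mul (hC i) (hC' i) (norm_nonneg _) ((norm_nonneg _).trans (hC i))⟩
  ext x i
  rw [mul_apply_eq_comp]
  have h1 := wshift_apply_emb (Function.Embedding.refl ι) a ⟨C, hC⟩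
    (wshift (Function.Embedding.refl ι) b x) i
  have h2 := wshift_apply_emb (Function.Embedding.refl ι) b ⟨C', hC'⟩ x i
  have h3 := wshift_apply_emb (Function.Embedding.refl ι) (fun i => a i * b i) hab x i
  simp only [Function.Embedding.refl_apply] at h1 h2 h3
  rw [h1, h2, h3, mul_assoc]

theorem diag_one {ι : Type} : wshift (Function.Embedding.refl ι) (fun _ => 1) = 1 := by
  ext x i
  simpa using wshift_apply_emb (Function.Embedding.refl ι) (fun _ => 1) ⟨1, by simp⟩ x i

end Diagonal

theorem yOp_sq_apply (q : QParam) (x : Ell2 ℕ) (n : ℕ) :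
    (yOp q ^ 2) x n = ((((q : ℝ) ^ 2) ^ n : ℝ) : ℂ) * x n := by
  have h := wshift_apply_emb (Function.Embedding.refl ℕ) _ (bdd_pow q)
  simp only [Function.Embedding.refl_apply] at h
  rw [sq, mul_apply_eq_comp, yOp, ofY, h, h]
  push_cast
  ring

theorem yOp_sq_basisVec (q : QParam) (n : ℕ) :
    (yOp q ^ 2) (basisVec n) = ((q : ℝ) ^ 2) ^ n • basisVec n := by
  ext i
  change _ = ((q : ℝ) ^ 2) ^ n • (basisVec n : Ell2 ℕ) i
  rw [yOp_sq_apply, ← Complex.coe_smul, smul_eq_mul, entry_basis]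
  split_ifs with h
  · rw [h]
  · simp

/-- If `c` is neither `0` nor some `q^{2j}`, then `c - q^{2j}` is nonzero with nonzero limit `c`, so
its inverses are bounded and give a diagonal inverse of `c - y²`. The other inclusion tests an
assumed inverse on the eigenvectors `e_n`. -/
theorem spectrum_yOp_sq (q : QParam) :
    spectrum ℝ (yOp q ^ 2) = insert 0 (Set.range fun j : ℕ => ((q : ℝ) ^ 2) ^ j) := by
  have hr := sq_mem_Ioo q
  ext c
  constructor
  · intro hc
    by_contra hcS
    rw [Set.mem_insert_iff, Set.mem_range, not_or] at hcS
    obtain ⟨hc0, hcj⟩ := hcS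
    apply hc
    have hne : ∀ j : ℕ, ((c : ℂ) - ((((q : ℝ) ^ 2) ^ j : ℝ) : ℂ)) ≠ 0 := fun j h =>
      hcj ⟨j, by
        have := sub_eq_zero.mp h
        exact_mod_cast this.symm⟩
    have hlim : Tendsto (fun j : ℕ => ((c : ℂ) - ((((q : ℝ) ^ 2) ^ j : ℝ) : ℂ))) atTop
        (𝓝 (c : ℂ)) := by
      have := (Complex.continuous_ofReal.tendsto _).comp
        ((tendsto_pow_atTop_nhds_zero_of_lt_one hr.1.le hr.2).const_sub c)
      simpa [Function.comp_def] using this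
    have hb1 : ∃ C : ℝ, ∀ j : ℕ, ‖((c : ℂ) - ((((q : ℝ) ^ 2) ^ j : ℝ) : ℂ))‖ ≤ C := by
      obtain ⟨C, hC⟩ := (Metric.isBounded_range_of_tendsto _ hlim).exists_norm_le
      exact ⟨C, fun j => hC _ ⟨j, rfl⟩⟩
    have hb2 : ∃ C : ℝ, ∀ j : ℕ, ‖((c : ℂ) - ((((q : ℝ) ^ 2) ^ j : ℝ) : ℂ))⁻¹‖ ≤ C := by
      obtain ⟨C, hC⟩ := (Metric.isBounded_range_of_tendsto _
        (hlim.inv₀ (by exact_mod_cast hc0))).exists_norm_le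
      exact ⟨C, fun j => hC _ ⟨j, rfl⟩⟩
    have heq : algebraMap ℝ (Op ℕ) c - yOp q ^ 2 = wshift (Function.Embedding.refl ℕ)
        fun j => (c : ℂ) - ((((q : ℝ) ^ 2) ^ j : ℝ) : ℂ) := by
      ext x i
      have h := wshift_apply_emb (Function.Embedding.refl ℕ) _ hb1 x i
      simp only [Function.Embedding.refl_apply] at h
      rw [h, _root_.sub_apply, Algebra.algebraMap_eq_smul_one, lp.coeFn_sub, Pi.sub_apply,
        yOp_sq_apply, sub_mul]
      rfl
    rw [spectrum.mem_resolventSet_iff, heq]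
    have h1 := diag_mul hb1 hb2
    have h2 := diag_mul hb2 hb1
    simp_rw [mul_inv_cancel₀ (hne _)] at h1
    simp_rw [inv_mul_cancel₀ (hne _)] at h2
    exact ⟨⟨_, _, h1.trans diag_one, h2.trans diag_one⟩, rfl⟩
  -- An inverse of norm `C` forces `1 ≤ C |c - q^{2n}|` for all `n`. This fails for `c = q^{2j}` at
  -- `n = j`, and for `c = 0` as `n → ∞`.
  · have key : ∀ c : ℝ, IsUnit (algebraMap ℝ (Op ℕ) c - yOp q ^ 2) →
        ∃ C : ℝ, ∀ n : ℕ, 1 ≤ C * |c - ((q : ℝ) ^ 2) ^ n| := by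
      rintro c ⟨U, hU⟩
      refine ⟨‖(↑U⁻¹ : Op ℕ)‖, fun n => ?_⟩
      have h1 : (U : Op ℕ) (basisVec n) = (c - ((q : ℝ) ^ 2) ^ n) • basisVec n := by
        rw [hU, _root_.sub_apply, yOp_sq_basisVec, sub_smul, Algebra.algebraMap_eq_smul_one]
        rfl
      have h2 : (↑U⁻¹ * ↑U : Op ℕ) (basisVec n) = basisVec n := by simp
      rw [mul_apply_eq_comp, h1] at h2
      have h3 := (↑U⁻¹ : Op ℕ).le_opNorm ((c - ((q : ℝ) ^ 2) ^ n) • basisVec n)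
      rwa [h2, norm_smul, norm_basisVec, mul_one, Real.norm_eq_abs] at h3
    rintro (rfl | ⟨j, rfl⟩) hU
    · obtain ⟨C, hC⟩ := key _ hU
      have h1 : Tendsto (fun n : ℕ => C * |0 - ((q : ℝ) ^ 2) ^ n|) atTop (𝓝 0) := by
        simpa using
          ((tendsto_pow_atTop_nhds_zero_of_lt_one hr.1.le hr.2).const_sub 0).abs.const_mul C
      exact absurd (ge_of_tendsto' h1 hC) (by norm_num)
    · obtain ⟨C, hC⟩ := key _ hU
      have := hC j
      simp at this
      linarith

theorem diffOnSpec_iff (q : QParam) (f : ℝ → ℂ) : DiffOnSpec q f ↔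
    DifferentiableOn ℝ f (insert 0 (Set.range fun j : ℕ => ((q : ℝ) ^ 2) ^ j)) := by
  rw [DiffOnSpec, spectrum_yOp_sq]

theorem DiffOnSpec.seqDiff {q : QParam} {f : ℝ → ℂ} (hf : DiffOnSpec q f) :
    SeqDiff ((q : ℝ) ^ 2) fun j => f (((q : ℝ) ^ 2) ^ j) :=
  seqDiff_of_differentiableWithinAt (sq_mem_Ioo q)
    ((diffOnSpec_iff q f).mp hf 0 (Set.mem_insert _ _))

/-! ### `F^(1)(D_q)` as an algebra of banded matrices. -/

/-- The matrix entries of `T` are differentiable along the diagonals. -/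
def DiagDiff (q : QParam) (T : Op ℕ) : Prop :=
  ∀ a b : ℕ, SeqDiff ((q : ℝ) ^ 2) fun j => entry T (j + a) (j + b)

section DiagDiff

variable {q : QParam} {T S : Op ℕ}

theorem DiagDiff.add (hT : DiagDiff q T) (hS : DiagDiff q S) : DiagDiff q (T + S) :=
  fun a b => (hT a b).add (hS a b)

theorem DiagDiff.star (hT : DiagDiff q T) : DiagDiff q (star T) := fun a b => by
  simp only [entry_star]
  exact (hT b a).conj

/-- Because `S` is banded, an entry of `T * S` far enough down a diagonal is a sum of a fixed number
of products of entries running along fixed diagonals of `T` and `S`. -/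
theorem DiagDiff.mul {L : ℕ} (hT : DiagDiff q T) (hS : DiagDiff q S) (hL : IsBand L S) :
    DiagDiff q (T * S) := by
  intro a b
  -- After moving down by `L`, the `2L + 1` row indices at which column `j + L + b` of `S` can be
  -- nonzero start at `j + b`, with no truncation at the corner of the matrix.
  refine SeqDiff.of_shift L ?_
  have h : ∀ j, entry (T * S) (j + L + a) (j + L + b) = ∑ m ∈ Finset.range (2 * L + 1),
      entry T (j + (L + a)) (j + (b + m)) * entry S (j + (b + m)) (j + (L + b)) := by
    intro j
    rw [entry_mul hL, show j + L + b + L + 1 = (j + b) + (2 * L + 1) by ring,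
      Finset.sum_range_add, Finset.sum_eq_zero, zero_add]
    · refine Finset.sum_congr rfl fun m _ => ?_
      simp only [add_assoc]
    · intro k hk
      rw [Finset.mem_range] at hk
      rw [hL k _ (by omega), mul_zero]
  simp only [h]
  exact SeqDiff.sum fun m _ => (hT _ _).mul (sq_mem_Ioo q) (hS _ _)

theorem diagDiff_wshift (σ : ℕ ↪ ℕ) (k : ℕ) (hσ : ∀ j, σ j = j + k) {a : ℕ → ℂ}
    (ha : SeqDiff ((q : ℝ) ^ 2) a) : DiagDiff q (wshift σ a) := by
  intro c d
  simp only [entry_wshift σ a (ha.bdd (sq_mem_Ioo q)), hσ]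
  by_cases h : c = d + k
  · convert! ha.shift (sq_mem_Ioo q) d using 2 with j
    rw [if_pos (by omega)]
  · convert! SeqDiff.const 0 using 2 with j
    rw [if_neg (by omega)]

theorem diagDiff_algebraMap (c : ℂ) : DiagDiff q (algebraMap ℂ (Op ℕ) c) := by
  have : algebraMap ℂ (Op ℕ) c = wshift (Function.Embedding.refl ℕ) fun _ => c := by
    ext x i
    have h := wshift_apply_emb (Function.Embedding.refl ℕ) (fun _ => c) ⟨‖c‖, fun _ => le_rfl⟩ x i
    simp only [Function.Embedding.refl_apply] at h
    rw [h, Algebra.algebraMap_eq_smul_one]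
    rfl
  rw [this]
  exact diagDiff_wshift _ 0 (fun _ => rfl) (SeqDiff.const c)

end DiagDiff

/-- The `*`-algebra of banded operators that are differentiable along the diagonals. -/
def diffAlg (q : QParam) : StarSubalgebra ℂ (Op ℕ) where
  carrier := {T | (∃ K, IsBand K T) ∧ DiagDiff q T}
  mul_mem' := by
    rintro T S ⟨⟨K, hT⟩, hT'⟩ ⟨⟨L, hS⟩, hS'⟩
    exact ⟨⟨_, hT.mul hS⟩, hT'.mul hS' hS⟩
  add_mem' := by
    rintro T S ⟨⟨K, hT⟩, hT'⟩ ⟨⟨L, hS⟩, hS'⟩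
    exact ⟨⟨_, hT.add hS⟩, hT'.add hS'⟩
  algebraMap_mem' c := ⟨bandAlg.algebraMap_mem c, diagDiff_algebraMap c⟩
  star_mem' := by
    rintro T ⟨⟨K, hT⟩, hT'⟩
    exact ⟨⟨K, hT.star⟩, hT'.star⟩

theorem wshift_mem_diffAlg {q : QParam} (σ : ℕ ↪ ℕ) (k : ℕ) (hσ : ∀ j, σ j = j + k) {a : ℕ → ℂ}
    (ha : SeqDiff ((q : ℝ) ^ 2) a) : wshift σ a ∈ diffAlg q := by
  refine ⟨⟨k, fun i j h => ?_⟩, diagDiff_wshift σ k hσ ha⟩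
  rw [entry_wshift σ a (ha.bdd (sq_mem_Ioo q)), if_neg]
  rw [hσ]
  omega

theorem differentiableAt_sqrt_one_sub (c : ℝ) :
    DifferentiableAt ℝ (fun t : ℝ => ((√(1 - c * t) : ℝ) : ℂ)) 0 := by
  have h1 : DifferentiableAt ℝ (fun t : ℝ => 1 - c * t) 0 := by fun_prop
  exact Complex.ofRealCLM.differentiableAt.comp (0 : ℝ) (h1.sqrt (by simp))

theorem one_sub_pow_pos (q : QParam) (n : ℕ) : 0 < 1 - (q : ℝ) ^ (2 * (n + 1)) := by
  have := pow_lt_one₀ q.2.1.le q.2.2 (n := 2 * (n + 1)) (by omega)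
  linarith

/-- The weights of the shift `z`. -/
def zWeight (q : QParam) (n : ℕ) : ℂ := ((√(1 - (q : ℝ) ^ (2 * (n + 1))) : ℝ) : ℂ)

theorem zWeight_ne_zero (q : QParam) (n : ℕ) : zWeight q n ≠ 0 := by
  have := Real.sqrt_pos.mpr (one_sub_pow_pos q n)
  rw [zWeight]
  exact_mod_cast this.ne'

theorem zWeight_eq (q : QParam) (n : ℕ) :
    zWeight q n = ((√(1 - (q : ℝ) ^ 2 * ((q : ℝ) ^ 2) ^ n) : ℝ) : ℂ) := by
  rw [zWeight, ← pow_succ', ← pow_mul]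

theorem seqDiff_zWeight (q : QParam) : SeqDiff ((q : ℝ) ^ 2) (zWeight q) := by
  rw [funext (zWeight_eq q)]
  exact seqDiff_of_differentiableAt (sq_mem_Ioo q) (differentiableAt_sqrt_one_sub _)

/-- The weight is `√(1 - q² t)` at `t = q^{2n}`, which is differentiable at `t = 0` with value `1`
there. Invertible weights make it possible to pass from `s^n` to `z^n` within the same class of
coefficients. -/
theorem seqDiff_inv_zWeight (q : QParam) : SeqDiff ((q : ℝ) ^ 2) fun n => (zWeight q n)⁻¹ := by
  have h0 : ((√(1 - (q : ℝ) ^ 2 * 0) : ℝ) : ℂ) ≠ 0 := by simp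
  have h := seqDiff_of_differentiableAt (sq_mem_Ioo q)
    ((differentiableAt_sqrt_one_sub ((q : ℝ) ^ 2)).fun_inv h0)
  simpa only [← zWeight_eq] using h

theorem zOp_mem_diffAlg (q : QParam) : zOp q ∈ diffAlg q :=
  wshift_mem_diffAlg succEmb 1 (fun _ => rfl) (seqDiff_zWeight q)

theorem ofYSq_eq (q : QParam) (f : ℝ → ℂ) :
    ofYSq q f = wshift (Function.Embedding.refl ℕ) fun j => f (((q : ℝ) ^ 2) ^ j) := by
  rw [ofYSq, ofY]
  congr 1
  ext j
  rw [← pow_mul, ← pow_mul, mul_comm]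

theorem ofYSq_mem_diffAlg {q : QParam} {f : ℝ → ℂ} (hf : DiffOnSpec q f) :
    ofYSq q f ∈ diffAlg q := by
  rw [ofYSq_eq]
  exact wshift_mem_diffAlg _ 0 (fun _ => rfl) hf.seqDiff

theorem z_pow_basisVec (q : QParam) (n j : ℕ) : (zOp q ^ n) (basisVec j) =
    (∏ i ∈ Finset.range n, zWeight q (j + i)) • basisVec (j + n) := by
  induction n with
  | zero => simp
  | succ n ih =>
    rw [pow_succ', mul_apply_eq_comp, ih, map_smul, zOp, wshift_basisVec _ _ (bdd_sqrt q),
      smul_smul, Finset.prod_range_succ]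
    rfl

theorem entry_z_pow_ofYSq {q : QParam} {f : ℝ → ℂ} (hf : DiffOnSpec q f) (n i j : ℕ) :
    entry (zOp q ^ n * ofYSq q f) i j = if i = j + n then
      f (((q : ℝ) ^ 2) ^ j) * ∏ i ∈ Finset.range n, zWeight q (j + i) else 0 := by
  rw [entry, mul_apply_eq_comp, ofYSq_eq, wshift_basisVec _ _ (hf.seqDiff.bdd (sq_mem_Ioo q)),
    map_smul]
  simp only [Function.Embedding.refl_apply, z_pow_basisVec, smul_smul]
  change _ * (basisVec (j + n) : Ell2 ℕ) i = _
  rw [entry_basis, mul_ite, mul_one, mul_zero]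

theorem DiffOnSpec.conj {q : QParam} {f : ℝ → ℂ} (hf : DiffOnSpec q f) :
    DiffOnSpec q fun t => conj (f t) := fun t ht =>
  Complex.conjCLE.differentiableAt.comp_differentiableWithinAt t (hf t ht)

theorem star_ofYSq {q : QParam} {f : ℝ → ℂ} (hf : DiffOnSpec q f) :
    star (ofYSq q f) = ofYSq q fun t => conj (f t) := by
  apply op_ext
  intro i j
  rw [entry_star, ofYSq_eq, ofYSq_eq, entry_wshift _ _ (hf.seqDiff.bdd (sq_mem_Ioo q)),
    entry_wshift _ _ (hf.conj.seqDiff.bdd (sq_mem_Ioo q))]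
  by_cases hij : i = j
  · subst hij; simp
  · simp [hij, Ne.symm hij]

theorem conj_zWeight (q : QParam) (n : ℕ) : conj (zWeight q n) = zWeight q n :=
  Complex.conj_ofReal _

theorem entry_ofYSq_star_pow {q : QParam} {f : ℝ → ℂ} (hf : DiffOnSpec q f) (n i j : ℕ) :
    entry (ofYSq q f * star (zOp q) ^ n) i j = if j = i + n then
      f (((q : ℝ) ^ 2) ^ i) * ∏ k ∈ Finset.range n, zWeight q (i + k) else 0 := by
  have : ofYSq q f * star (zOp q) ^ n = star (zOp q ^ n * ofYSq q fun t => conj (f t)) := by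
    rw [star_mul, star_pow, star_ofYSq hf.conj]
    simp
  rw [this, entry_star, entry_z_pow_ofYSq hf.conj]
  split_ifs <;> simp [conj_zWeight]

/-- The operator `z^n f(y²)` has one diagonal, with entries `f(q^{2j})` times a product of weights
of `z`. Dividing the diagonals of a given matrix by these products recovers the functions `f`, since
the quotient is again differentiable along the spectrum. -/
theorem discDiff_eq (q : QParam) : discDiff q = (diffAlg q : Set (Op ℕ)) := by
  ext T
  constructor
  · rintro ⟨N, M, f, hf, rfl⟩
    have hz := zOp_mem_diffAlg q
    have hY : ∀ j, ofYSq q (f j) ∈ diffAlg q := fun j => ofYSq_mem_diffAlg (hf j)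
    exact add_mem (sum_mem fun n _ => mul_mem (pow_mem hz n) (hY _))
      (sum_mem fun n _ => mul_mem (hY _) (pow_mem (star_mem hz) n))
  · rintro ⟨⟨K, hK⟩, hT⟩
    -- At least one of `k.toNat` and `(-k).toNat` is zero, so this handles the diagonals below and
    -- above the main one at once.
    have hseq : ∀ k : ℤ, ∃ f : ℝ → ℂ, DiffOnSpec q f ∧ ∀ j : ℕ, f (((q : ℝ) ^ 2) ^ j) =
        entry T (j + k.toNat) (j + (-k).toNat) *
          ∏ i ∈ Finset.range (k.toNat + (-k).toNat), (zWeight q (j + i))⁻¹ := by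
      intro k
      simp only [diffOnSpec_iff]
      refine SeqDiff.exists_differentiableOn (sq_mem_Ioo q) ((hT _ _).mul (sq_mem_Ioo q) ?_)
      exact SeqDiff.prod (sq_mem_Ioo q) fun i _ =>
        (seqDiff_inv_zWeight q).shift (sq_mem_Ioo q) i
    choose f hf hfj using hseq
    have hcancel : ∀ (x : ℂ) (n j : ℕ), x * (∏ i ∈ Finset.range n, (zWeight q (j + i))⁻¹) *
        ∏ i ∈ Finset.range n, zWeight q (j + i) = x := by
      intro x n j
      rw [mul_assoc, ← Finset.prod_mul_distrib]
      simp [inv_mul_cancel₀ (zWeight_ne_zero q _)]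
    refine ⟨K, K, f, hf, op_ext fun i j => ?_⟩
    rw [entry_add, entry_sum, entry_sum]
    simp_rw [entry_z_pow_ofYSq (hf _), entry_ofYSq_star_pow (hf _), hfj]
    simp only [Int.toNat_natCast, Int.toNat_neg_natCast, neg_neg, add_zero, zero_add, hcancel]
    rcases le_or_gt j i with hij | hij
    · rw [Finset.sum_eq_single (i - j), Finset.sum_eq_zero]
      · rw [if_pos (by omega), add_zero, show j + (i - j) = i by omega]
      · intro n hn
        rw [if_neg]
        simp at hn
        omega
      · intro n _ hn
        rw [if_neg]
        omega
      · intro hn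
        rw [if_pos (by omega), show j + (i - j) = i by omega]
        simp at hn
        exact hK i j (by omega)
    · rw [Finset.sum_eq_zero, Finset.sum_eq_single (j - i)]
      · rw [if_pos (by omega), zero_add, show i + (j - i) = j by omega]
      · intro n hn hn2
        rw [if_neg]
        omega
      · intro hn
        rw [if_pos (by omega), show i + (j - i) = j by omega]
        simp at hn
        exact hK i j (by omega)
      · intro n hn
        rw [if_neg]
        omega

theorem mem_discDiff_iff {q : QParam} {T : Op ℕ} : T ∈ discDiff q ↔ T ∈ diffAlg q := by
  rw [discDiff_eq]
  rfl

theorem discPoly_le_diffAlg (q : QParam) : discPoly q ≤ diffAlg q :=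
  StarAlgebra.adjoin_le (by simpa using zOp_mem_diffAlg q)

theorem diffAlg_le_discAlg (q : QParam) : diffAlg q ≤ discAlg q := fun T hT =>
  (mem_discAlg_iff q T).mpr hT.1

/-! ### Coordinates of `z` and `y`, and `y = √(1 - z z^*)`. -/

theorem zOp_apply_zero (q : QParam) (x : Ell2 ℕ) : zOp q x 0 = 0 :=
  wshift_apply_notMem succEmb _ (bdd_sqrt q) x 0 fun j => Nat.succ_ne_zero j

theorem zOp_apply_succ (q : QParam) (x : Ell2 ℕ) (n : ℕ) :
    zOp q x (n + 1) = zWeight q n * x n :=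
  wshift_apply_emb succEmb _ (bdd_sqrt q) x n

theorem star_zOp_apply (q : QParam) (x : Ell2 ℕ) (n : ℕ) :
    (star (zOp q) x) n = zWeight q n * x (n + 1) := by
  rw [zOp, star_wshift_apply _ _ (bdd_sqrt q), Complex.conj_ofReal]
  rfl

theorem ofY_apply {q : QParam} {g : ℝ → ℂ} (hg : BddOnSpec q g) (x : Ell2 ℕ) (n : ℕ) :
    ofY q g x n = g ((q : ℝ) ^ n) * x n :=
  wshift_apply_emb (Function.Embedding.refl ℕ) _ hg.bdd x n

theorem yOp_apply (q : QParam) (x : Ell2 ℕ) (n : ℕ) :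
    yOp q x n = (((q : ℝ) ^ n : ℝ) : ℂ) * x n :=
  wshift_apply_emb (Function.Embedding.refl ℕ) _ (bdd_pow q) x n

theorem zWeight_mul_self (q : QParam) (n : ℕ) :
    zWeight q n * zWeight q n =
      1 - (((q : ℝ) ^ (n + 1) : ℝ) : ℂ) * (((q : ℝ) ^ (n + 1) : ℝ) : ℂ) := by
  rw [zWeight, ← Complex.ofReal_mul, Real.mul_self_sqrt (one_sub_pow_pos q n).le]
  push_cast
  ring

theorem yOp_mul_self (q : QParam) : yOp q * yOp q = 1 - zOp q * star (zOp q) := by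
  ext x n
  change _ = x n - (zOp q * star (zOp q)) x n
  rw [mul_apply_eq_comp, mul_apply_eq_comp, yOp_apply, yOp_apply]
  rcases n with _ | n
  · simp [zOp_apply_zero]
  · rw [zOp_apply_succ, star_zOp_apply, ← mul_assoc, ← mul_assoc, zWeight_mul_self]
    ring

/-- The operator `√y`. -/
def sqrtY (q : QParam) : Op ℕ :=
  wshift (Function.Embedding.refl ℕ) fun n => ((√((q : ℝ) ^ n) : ℝ) : ℂ)

theorem star_sqrtY_mul_self (q : QParam) : star (sqrtY q) * sqrtY q = yOp q := by
  have hb : ∃ C : ℝ, ∀ n : ℕ, ‖((√((q : ℝ) ^ n) : ℝ) : ℂ)‖ ≤ C := ⟨1, fun n => by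
    rw [Complex.norm_real, Real.norm_of_nonneg (Real.sqrt_nonneg _)]
    exact Real.sqrt_le_one.mpr (pow_le_q q n)⟩
  ext x n
  have h := wshift_apply_emb (Function.Embedding.refl ℕ) _ hb x n
  simp only [Function.Embedding.refl_apply] at h
  rw [mul_apply_eq_comp, sqrtY, star_wshift_apply _ _ hb, Function.Embedding.refl_apply, h,
    yOp_apply, ← mul_assoc, Complex.conj_ofReal, ← Complex.ofReal_mul,
    Real.mul_self_sqrt (pow_pos_q q n).le]

/-- Uniqueness of the positive square root. Positivity of `B` is certified by the factorization `C^*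
C`, a form that survives `*`-homomorphisms. -/
theorem opSqrt_eq_of_mul_self {E : Type} [NormedAddCommGroup E] [InnerProductSpace ℂ E]
    [CompleteSpace E] {A B C : E →L[ℂ] E} (h : B * B = A) (hB : star C * C = B) :
    opSqrt A = B :=
  CFC.sqrt_unique h (hB ▸ star_mul_self_nonneg C)

theorem opSqrt_one_sub (q : QParam) : opSqrt (1 - zOp q * star (zOp q)) = yOp q :=
  opSqrt_eq_of_mul_self (yOp_mul_self q) (star_sqrtY_mul_self q)

/-! ### Division by `y²` and the partial derivatives on `F^(1)(D_q)`. -/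

/-- Each of the finitely many diagonals is a bounded weighted shift, or the adjoint of one if it
lies above the main diagonal. -/
theorem exists_isBand_entry_eq {K : ℕ} {m : ℕ → ℕ → ℂ}
    (hK : ∀ i j, (i + K < j ∨ j + K < i) → m i j = 0) (hm : ∃ C : ℝ, ∀ i j, ‖m i j‖ ≤ C) :
    ∃ T : Op ℕ, IsBand K T ∧ ∀ i j, entry T i j = m i j := by
  obtain ⟨C, hC⟩ := hm
  have h1 : ∀ n : ℕ, ∃ C : ℝ, ∀ j, ‖m (j + n) j‖ ≤ C := fun n => ⟨C, fun j => hC _ _⟩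
  have h2 : ∀ n : ℕ, ∃ C : ℝ, ∀ j, ‖conj (m j (j + n))‖ ≤ C := fun n =>
    ⟨C, fun j => by simpa using hC _ _⟩
  have key : ∀ i j, entry (∑ n ∈ Finset.range (K + 1),
      wshift (addRightEmbedding n) (fun j => m (j + n) j) +
      ∑ n ∈ Finset.Icc 1 K, star (wshift (addRightEmbedding n) fun j => conj (m j (j + n)))) i j =
      m i j := by
    intro i j
    rw [entry_add, entry_sum, entry_sum]
    simp_rw [entry_star, entry_wshift _ _ (h1 _), entry_wshift _ _ (h2 _),
      addRightEmbedding_apply]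
    rcases le_or_gt j i with hij | hij
    · rw [Finset.sum_eq_single (i - j), Finset.sum_eq_zero]
      · rw [if_pos (by omega), add_zero, show j + (i - j) = i by omega]
      · intro n hn
        rw [if_neg, map_zero]
        simp at hn
        omega
      · intro n _ hn
        rw [if_neg]
        omega
      · intro hn
        rw [if_pos (by omega), show j + (i - j) = i by omega]
        simp at hn
        exact hK i j (by omega)
    · rw [Finset.sum_eq_zero, Finset.sum_eq_single (j - i)]
      · rw [if_pos (by omega), zero_add, show i + (j - i) = j by omega, Complex.conj_conj]
      · intro n hn hn2
        rw [if_neg, map_zero]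
        omega
      · intro hn
        rw [if_pos (by omega), show i + (j - i) = j by omega, Complex.conj_conj]
        simp at hn
        exact hK i j (by omega)
      · intro n hn
        rw [if_neg]
        omega
  exact ⟨_, fun i j h => (key i j).trans (hK i j h), key⟩

theorem entry_yOp_sq_mul (q : QParam) (T : Op ℕ) (i j : ℕ) :
    entry (yOp q ^ 2 * T) i j = ((((q : ℝ) ^ 2) ^ i : ℝ) : ℂ) * entry T i j :=
  yOp_sq_apply q _ i

theorem sq_pow_ne_zero (q : QParam) (i : ℕ) : ((((q : ℝ) ^ 2) ^ i : ℝ) : ℂ) ≠ 0 := by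
  exact_mod_cast (pow_pos (sq_mem_Ioo q).1 i).ne'

theorem yOp_sq_mul_injective (q : QParam) {T S : Op ℕ} (h : yOp q ^ 2 * T = yOp q ^ 2 * S) :
    T = S := by
  refine op_ext fun i j => ?_
  have := congrArg (fun T => entry T i j) h
  simp only [entry_yOp_sq_mul] at this
  exact mul_left_cancel₀ (sq_pow_ne_zero q i) this

/-- An operator that is differentiable along the diagonals with limits `0` is divisible by `y²`. -/
theorem exists_yOp_sq_mul_eq {q : QParam} {D : Op ℕ} (hD : D ∈ diffAlg q)
    (h0 : ∀ a b, Tendsto (fun j => entry D (j + a) (j + b)) atTop (𝓝 0)) :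
    ∃ h : discAlg q, yOp q ^ 2 * (h : Op ℕ) = D := by
  obtain ⟨⟨K, hK⟩, hD⟩ := hD
  have hr := sq_mem_Ioo q
  set r := (q : ℝ) ^ 2 with hr_def
  have hb : ∀ a b, ∃ C : ℝ, 0 ≤ C ∧ ∀ j, ‖entry D (j + a) (j + b)‖ ≤ C * r ^ j := by
    intro a b
    obtain ⟨L, C, hC0, hC⟩ := (hD a b).exists_norm_le hr
    have hL : Tendsto (fun j => entry D (j + a) (j + b)) atTop (𝓝 L) := by
      rw [tendsto_iff_norm_sub_tendsto_zero]
      refine squeeze_zero (fun _ => norm_nonneg _) hC ?_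
      simpa using (tendsto_pow_atTop_nhds_zero_of_lt_one hr.1.le hr.2).const_mul C
    -- The constant term of the expansion is the limit along the diagonal, hence `0`, and the
    -- entries are `O(r^j)`.
    rw [tendsto_nhds_unique hL (h0 a b)] at hC
    exact ⟨C, hC0, by simpa using hC⟩
  choose C hC0 hC using hb
  -- Inside the band, write `(i, j) = (n + a, n + b)` with `n = min i j` and `a, b ≤ K`. The sum of
  -- the finitely many constants dominates each of them, and dividing by `r^{n+a}` instead of `r^n`
  -- costs at most `r^{-K}`.
  have hbd : ∀ i j, ‖((r ^ i : ℝ) : ℂ)⁻¹ * entry D i j‖ ≤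
      (∑ a ∈ Finset.range (K + 1), ∑ b ∈ Finset.range (K + 1), C a b) / r ^ K := by
    intro i j
    have hsum0 : 0 ≤ ∑ a ∈ Finset.range (K + 1), ∑ b ∈ Finset.range (K + 1), C a b :=
      Finset.sum_nonneg fun a _ => Finset.sum_nonneg fun b _ => hC0 a b
    by_cases hij : i + K < j ∨ j + K < i
    · rw [hK i j hij]
      simp only [mul_zero, norm_zero]
      exact div_nonneg hsum0 (pow_pos hr.1 K).le
    · obtain ⟨n, a, b, rfl, rfl, ha, hb⟩ : ∃ n a b, i = n + a ∧ j = n + b ∧ a ≤ K ∧ b ≤ K :=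
        ⟨min i j, i - min i j, j - min i j, by omega, by omega, by omega, by omega⟩
      have h1 : C a b ≤ ∑ a ∈ Finset.range (K + 1), ∑ b ∈ Finset.range (K + 1), C a b :=
        (Finset.single_le_sum (f := fun b => C a b) (fun b _ => hC0 a b)
          (Finset.mem_range.mpr (by omega))).trans
        (Finset.single_le_sum (f := fun a => ∑ b ∈ Finset.range (K + 1), C a b)
          (fun a _ => Finset.sum_nonneg fun b _ => hC0 a b) (Finset.mem_range.mpr (by omega)))
      rw [norm_mul, norm_inv, Complex.norm_real, Real.norm_of_nonneg (pow_pos hr.1 _).le,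
        le_div_iff₀ (pow_pos hr.1 K), mul_right_comm, inv_mul_eq_div, div_mul_eq_mul_div,
        div_le_iff₀ (pow_pos hr.1 _), pow_add]
      calc r ^ K * ‖entry D (n + a) (n + b)‖ ≤ r ^ a * (C a b * r ^ n) :=
            mul_le_mul (pow_le_pow_of_le_one hr.1.le hr.2.le ha) (hC a b n) (norm_nonneg _)
              (pow_pos hr.1 a).le
        _ = C a b * (r ^ n * r ^ a) := by ring
        _ ≤ _ := mul_le_mul_of_nonneg_right h1 (by have := hr.1; positivity)
  obtain ⟨T, hT, hTe⟩ := exists_isBand_entry_eq (K := K)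
    (m := fun i j => ((r ^ i : ℝ) : ℂ)⁻¹ * entry D i j)
    (fun i j h => by rw [hK i j h, mul_zero]) ⟨_, hbd⟩
  refine ⟨⟨T, (mem_discAlg_iff q T).mpr ⟨K, hT⟩⟩, op_ext fun i j => ?_⟩
  rw [entry_yOp_sq_mul, hTe]
  exact mul_inv_cancel_left₀ (sq_pow_ne_zero q i) _

theorem entry_star_zOp_mul (q : QParam) (T : Op ℕ) (i j : ℕ) :
    entry (star (zOp q) * T) i j = zWeight q i * entry T (i + 1) j :=
  star_zOp_apply q _ i

theorem entry_zOp_mul_succ (q : QParam) (T : Op ℕ) (i j : ℕ) :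
    entry (zOp q * T) (i + 1) j = zWeight q i * entry T i j :=
  zOp_apply_succ q _ i

theorem entry_zOp_mul_zero (q : QParam) (T : Op ℕ) (j : ℕ) : entry (zOp q * T) 0 j = 0 :=
  zOp_apply_zero q _

theorem entry_mul_star_zOp_succ (q : QParam) (T : Op ℕ) (i j : ℕ) :
    entry (T * star (zOp q)) i (j + 1) = zWeight q j * entry T i j := by
  have h := entry_zOp_mul_succ q (star T) j i
  rw [entry_star] at h
  rw [← star_star (T * star (zOp q)), entry_star, star_mul, star_star, h, map_mul, conj_zWeight,
    Complex.conj_conj]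

theorem entry_mul_star_zOp_zero (q : QParam) (T : Op ℕ) (i : ℕ) :
    entry (T * star (zOp q)) i 0 = 0 := by
  rw [← star_star (T * star (zOp q)), entry_star, star_mul, star_star, entry_zOp_mul_zero,
    map_zero]

theorem entry_mul_zOp (q : QParam) (T : Op ℕ) (i j : ℕ) :
    entry (T * zOp q) i j = zWeight q j * entry T i (j + 1) := by
  have h := entry_star_zOp_mul q (star T) j i
  rw [entry_star] at h
  rw [← star_star (T * zOp q), entry_star, star_mul, h, map_mul, conj_zWeight, Complex.conj_conj]

theorem entry_sub (T S : Op ℕ) (i j : ℕ) : entry (T - S) i j = entry T i j - entry S i j := rfl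

theorem tendsto_zWeight (q : QParam) : Tendsto (zWeight q) atTop (𝓝 1) := by
  have h := (differentiableAt_sqrt_one_sub ((q : ℝ) ^ 2)).continuousAt.tendsto.comp
    (tendsto_pow_atTop_nhds_zero_of_lt_one (sq_mem_Ioo q).1.le (sq_mem_Ioo q).2)
  simpa [Function.comp_def, ← zWeight_eq] using h

/-- The two terms of the commutator pick out neighbouring entries of one diagonal of `T`, which have
a common limit, multiplied by weights of `z` that tend to `1`. -/
theorem DiagDiff.tendsto_star_commutator {q : QParam} {T : Op ℕ} (hT : DiagDiff q T) (a b : ℕ) :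
    Tendsto (fun j => entry (Star.star (zOp q) * T - T * Star.star (zOp q)) (j + a) (j + b)) atTop
      (𝓝 0) := by
  rw [← tendsto_add_atTop_iff_nat 1]
  have h : ∀ j, entry (Star.star (zOp q) * T - T * Star.star (zOp q)) (j + 1 + a) (j + 1 + b) =
      zWeight q (j + (1 + a)) * entry T (j + 1 + (a + 1)) (j + 1 + b) -
        zWeight q (j + b) * entry T (j + (a + 1)) (j + b) := by
    intro j
    rw [entry_sub, entry_star_zOp_mul, show j + 1 + b = j + b + 1 by ring,
      entry_mul_star_zOp_succ, show j + 1 + a = j + (a + 1) by ring,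
      show j + 1 + (a + 1) = j + (a + 1) + 1 by ring, add_comm 1 a]
  simp only [h]
  obtain ⟨L, D, hL⟩ := hT (a + 1) b
  have hL := tendsto_of_tendsto_div (sq_mem_Ioo q) hL
  have hL1 := (tendsto_add_atTop_iff_nat 1).mpr hL
  have hw : ∀ k, Tendsto (fun j => zWeight q (j + k)) atTop (𝓝 1) := fun k =>
    (tendsto_add_atTop_iff_nat k).mpr (tendsto_zWeight q)
  simpa using ((hw (1 + a)).mul hL1).sub ((hw b).mul hL)

/-- Follows from the previous case by taking adjoints: `[z, T] = -[z^*, T^*]^*`. -/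
theorem DiagDiff.tendsto_commutator {q : QParam} {T : Op ℕ} (hT : DiagDiff q T) (a b : ℕ) :
    Tendsto (fun j => entry (zOp q * T - T * zOp q) (j + a) (j + b)) atTop (𝓝 0) := by
  have h := ((Complex.continuous_conj.tendsto 0).comp (hT.star.tendsto_star_commutator b a)).neg
  rw [map_zero, neg_zero] at h
  refine h.congr fun j => ?_
  rw [← star_star (zOp q * T - T * zOp q), entry_star, star_sub, star_mul, star_mul]
  simp [entry_sub]

theorem exists_isPartialZ {q : QParam} {g : Op ℕ} (hg : g ∈ diffAlg q) :
    ∃ h : discAlg q, IsPartialZ q g h := by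
  have hz := zOp_mem_diffAlg q
  obtain ⟨h, hh⟩ := exists_yOp_sq_mul_eq
    (sub_mem (mul_mem (star_mem hz) hg) (mul_mem hg (star_mem hz)))
    hg.2.tendsto_star_commutator
  refine ⟨(((1 - (q : ℝ) ^ 2)⁻¹ : ℝ) : ℂ) • h, ?_⟩
  rw [IsPartialZ, ← hh]
  exact mul_smul_comm _ _ _

theorem exists_isPartialZbar {q : QParam} {g : Op ℕ} (hg : g ∈ diffAlg q) :
    ∃ h : discAlg q, IsPartialZbar q g h := by
  have hz := zOp_mem_diffAlg q
  obtain ⟨h, hh⟩ := exists_yOp_sq_mul_eq (sub_mem (mul_mem hz hg) (mul_mem hg hz))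
    hg.2.tendsto_commutator
  refine ⟨((-(1 - (q : ℝ) ^ 2)⁻¹ : ℝ) : ℂ) • h, ?_⟩
  rw [IsPartialZbar, ← hh]
  exact mul_smul_comm _ _ _

theorem IsPartialZ.unique {q : QParam} {g : Op ℕ} {h h' : discAlg q} (hh : IsPartialZ q g h)
    (hh' : IsPartialZ q g h') : h = h' :=
  Subtype.ext (yOp_sq_mul_injective q (hh.trans hh'.symm))

theorem IsPartialZbar.unique {q : QParam} {g : Op ℕ} {h h' : discAlg q}
    (hh : IsPartialZbar q g h) (hh' : IsPartialZbar q g h') : h = h' :=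
  Subtype.ext (yOp_sq_mul_injective q (hh.trans hh'.symm))

theorem IsPartialZ.add {q : QParam} {g g' h h' : Op ℕ} (hh : IsPartialZ q g h)
    (hh' : IsPartialZ q g' h') : IsPartialZ q (g + g') (h + h') := by
  rw [IsPartialZ, mul_add, hh, hh', ← smul_add]
  congr 1
  noncomm_ring

theorem IsPartialZ.smul {q : QParam} {g h : Op ℕ} (hh : IsPartialZ q g h) (c : ℂ) :
    IsPartialZ q (c • g) (c • h) := by
  rw [IsPartialZ, mul_smul_comm, hh, mul_smul_comm, smul_mul_assoc, ← smul_sub, smul_comm]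

theorem IsPartialZbar.add {q : QParam} {g g' h h' : Op ℕ} (hh : IsPartialZbar q g h)
    (hh' : IsPartialZbar q g' h') : IsPartialZbar q (g + g') (h + h') := by
  rw [IsPartialZbar, mul_add, hh, hh', ← smul_add]
  congr 1
  noncomm_ring

theorem IsPartialZbar.smul {q : QParam} {g h : Op ℕ} (hh : IsPartialZbar q g h) (c : ℂ) :
    IsPartialZbar q (c • g) (c • h) := by
  rw [IsPartialZbar, mul_smul_comm, hh, mul_smul_comm, smul_mul_assoc, ← smul_sub, smul_comm]

/-- A linear relation that is single valued and defined on a subspace is the restriction of a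
linear map. -/
theorem exists_linearMap_of_relation {V W : Type} [AddCommGroup V] [Module ℂ V] [AddCommGroup W]
    [Module ℂ W] (D : Submodule ℂ V) (P : V → W → Prop) (hex : ∀ g ∈ D, ∃ h, P g h)
    (huniq : ∀ g h h', P g h → P g h' → h = h')
    (hadd : ∀ g g' h h', P g h → P g' h' → P (g + g') (h + h'))
    (hsmul : ∀ (c : ℂ) g h, P g h → P (c • g) (c • h)) :
    ∃ f : V →ₗ[ℂ] W, ∀ g ∈ D, ∀ h, P g h → f g = h := by
  choose F hF using fun g : D => hex g g.2
  obtain ⟨f, hf⟩ := LinearMap.exists_extend (p := D)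
    { toFun := F
      map_add' := fun g g' => huniq _ _ _ (hF (g + g')) (hadd _ _ _ _ (hF g) (hF g'))
      map_smul' := fun c g => huniq _ _ _ (hF (c • g)) (hsmul _ _ _ (hF g)) }
  refine ⟨f, fun g hg h hP => ?_⟩
  have := LinearMap.congr_fun hf ⟨g, hg⟩
  exact this.trans (huniq _ _ _ (hF ⟨g, hg⟩) hP)

/-- The subspace `F^(1)(D_q)` of `F(D_q)`. -/
def discDiffSub (q : QParam) : Submodule ℂ (discAlg q) :=
  (diffAlg q).toSubalgebra.toSubmodule.comap (discAlg q).toSubalgebra.val.toLinearMap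

theorem mem_discDiffSub {q : QParam} {g : discAlg q} :
    g ∈ discDiffSub q ↔ (g : Op ℕ) ∈ discDiff q := by
  rw [mem_discDiff_iff]
  rfl

/-- The derivative is extended from `F^(1)(D_q)` to all of `F(D_q)` in an arbitrary linear way. This
makes `TensorProduct.map` available on the whole tensor product; restricting to `chartDiff` later
removes the arbitrariness. -/
theorem exists_partialZ_linearMap (q : QParam) : ∃ f : discAlg q →ₗ[ℂ] discAlg q,
    ∀ g : discAlg q, (g : Op ℕ) ∈ discDiff q → ∀ h : discAlg q, IsPartialZ q g h → f g = h := by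
  obtain ⟨f, hf⟩ := exists_linearMap_of_relation (discDiffSub q)
    (fun g h : discAlg q => IsPartialZ q g h) (fun g hg => exists_isPartialZ hg)
    (fun _ _ _ h h' => h.unique h') (fun _ _ _ _ h h' => h.add h') (fun c _ _ h => h.smul c)
  exact ⟨f, fun g hg => hf g (mem_discDiffSub.mpr hg)⟩

theorem exists_partialZbar_linearMap (q : QParam) : ∃ f : discAlg q →ₗ[ℂ] discAlg q,
    ∀ g : discAlg q, (g : Op ℕ) ∈ discDiff q → ∀ h : discAlg q, IsPartialZbar q g h →
      f g = h := by
  obtain ⟨f, hf⟩ := exists_linearMap_of_relation (discDiffSub q)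
    (fun g h : discAlg q => IsPartialZbar q g h) (fun g hg => exists_isPartialZbar hg)
    (fun _ _ _ h h' => h.unique h') (fun _ _ _ _ h h' => h.add h') (fun c _ _ h => h.smul c)
  exact ⟨f, fun g hg => hf g (mem_discDiffSub.mpr hg)⟩

/-! ### Matrix units and their partial derivatives. -/

/-- The matrix unit `s^{#(k-n)} δ_{q^n}(y)`. -/
def matUnit (q : QParam) (n k : ℕ) : discAlg q := sharp (sElt q) ((k : ℤ) - n) * deltaElt q n

theorem entry_matUnit (q : QParam) (n k i j : ℕ) :
    entry (matUnit q n k : Op ℕ) i j = if i = k ∧ j = n then 1 else 0 := by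
  have hd : ∀ m : ℕ, deltaFn q n ((q : ℝ) ^ m) = if m = n then 1 else 0 := by
    intro m
    simp only [deltaFn, (pow_right_injective₀ q.2.1 q.2.2.ne).eq_iff]
  rcases le_or_gt n k with h | h
  · have : (matUnit q n k : Op ℕ) = sOp ^ (k - n) * ofY q (deltaFn q n) := by
      rw [matUnit, sharp, if_pos (by omega), show ((k : ℤ) - n).toNat = k - n by omega]
      rfl
    rw [this, entry_s_pow_ofY (deltaFn_bdd q n), hd]
    split_ifs <;> first | rfl | omega
  -- For `k < n` the adjoint turns `s^*` into `s`, whose powers act on basis vectors without a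
  -- boundary case.
  · have : (matUnit q n k : Op ℕ) = star (ofY q (deltaFn q n) * sOp ^ (n - k)) := by
      rw [matUnit, sharp, if_neg (by omega), star_mul, star_ofY (deltaFn_bdd q n),
        show (-((k : ℤ) - n)).toNat = n - k by omega, star_pow]
      have : (fun t => conj (deltaFn q n t)) = deltaFn q n := by
        ext t
        rw [deltaFn]
        split_ifs <;> simp
      rw [this]
      rfl
    rw [this, entry_star, entry, mul_apply_eq_comp, s_pow_basisVec, ofY_apply (deltaFn_bdd q n),
      hd, entry_basis]
    split_ifs <;> first | omega | simp

/-- A matrix with a single nonzero entry vanishes eventually along every diagonal. -/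
theorem matUnit_mem_discDiff (q : QParam) (n k : ℕ) : (matUnit q n k : Op ℕ) ∈ discDiff q := by
  rw [mem_discDiff_iff]
  refine ⟨(mem_discAlg_iff q _).mp (matUnit q n k).2, fun a b => ?_⟩
  refine SeqDiff.of_eventually_eq_zero ⟨n + 1, fun j hj => ?_⟩
  rw [entry_matUnit, if_neg]
  omega

/-- The normalization constant of the basis of `L₂(D_q)`. -/
def normConst (q : QParam) (α : AParam) (n : ℕ) : ℝ :=
  (q : ℝ) ^ (-((α : ℝ) * n / 2)) / √(1 - (q : ℝ))

theorem normConst_pos (q : QParam) (α : AParam) (n : ℕ) : 0 < normConst q α n :=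
  div_pos (Real.rpow_pos_of_pos q.2.1 _) (Real.sqrt_pos.mpr (by linarith [q.2.2]))

theorem rpow_mul_normConst_succ (q : QParam) (α : AParam) (n : ℕ) :
    (q : ℝ) ^ ((α : ℝ) / 2) * normConst q α (n + 1) = normConst q α n := by
  rw [normConst, normConst, ← mul_div_assoc, ← Real.rpow_add q.2.1]
  congr 2
  push_cast
  ring

theorem rpow_neg_mul_normConst (q : QParam) (α : AParam) (n : ℕ) :
    (q : ℝ) ^ (-((α : ℝ) / 2)) * normConst q α n = normConst q α (n + 1) := by
  rw [← rpow_mul_normConst_succ, ← mul_assoc, ← Real.rpow_add q.2.1, neg_add_cancel,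
    Real.rpow_zero, one_mul]

/-- The orthonormal basis `q^{-αn/2} (1-q)^{-1/2} s^{#(k-n)} δ_{q^n}(y)` of `L₂(D_q)`. -/
def discBasis (q : QParam) (α : AParam) (n k : ℕ) : discAlg q :=
  ((normConst q α n : ℝ) : ℂ) • matUnit q n k

theorem entry_discBasis (q : QParam) (α : AParam) (n k i j : ℕ) :
    entry (discBasis q α n k : Op ℕ) i j =
      if i = k ∧ j = n then ((normConst q α n : ℝ) : ℂ) else 0 := by
  change ((normConst q α n : ℝ) : ℂ) * entry (matUnit q n k : Op ℕ) i j = _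
  rw [entry_matUnit, mul_ite, mul_one, mul_zero]

theorem discBasis_mem_discDiff (q : QParam) (α : AParam) (n k : ℕ) :
    (discBasis q α n k : Op ℕ) ∈ discDiff q :=
  mem_discDiffSub.mp (Submodule.smul_mem _ _ (mem_discDiffSub.mpr (matUnit_mem_discDiff q n k)))

/-- For the matrix unit `E_{kn}`, the product `z^* E_{kn}` lies in row `k - 1` and `E_{kn} z^*` in
row `k`; dividing by `y²` gives `q^{-2(k-1)}` and `q^{-2k}`, whence the extra `q²` in the first
term. The factor `q^{α/2}` is the ratio of the normalizations of columns `n` and `n + 1`. -/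
theorem isPartialZ_discBasis (q : QParam) (α : AParam) (n k : ℕ) :
    IsPartialZ q (discBasis q α n k)
      (((((q : ℝ) ^ (-(2 * (k : ℤ))) / (1 - (q : ℝ) ^ 2) : ℝ) : ℂ) •
        ((((q : ℝ) ^ 2 * √(1 - (q : ℝ) ^ (2 * k)) : ℝ) : ℂ) • discBasis q α n (k - 1) -
          (((q : ℝ) ^ ((α : ℝ) / 2) * √(1 - (q : ℝ) ^ (2 * (n + 1))) : ℝ) : ℂ) •
            discBasis q α (n + 1) k) : discAlg q) : Op ℕ) := by
  have hq : (q : ℝ) ≠ 0 := q.2.1.ne'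
  refine op_ext fun i j => ?_
  rw [entry_yOp_sq_mul, entry_smul, entry_sub, entry_star_zOp_mul]
  change _ * (_ * (_ * entry (discBasis q α n (k - 1) : Op ℕ) i j -
    _ * entry (discBasis q α (n + 1) k : Op ℕ) i j)) = _
  have h2 : entry ((discBasis q α n k : Op ℕ) * star (zOp q)) i j =
      if i = k ∧ j = n + 1 then zWeight q n * ((normConst q α n : ℝ) : ℂ) else 0 := by
    rcases j with _ | j
    · rw [entry_mul_star_zOp_zero, if_neg (by omega)]
    · rw [entry_mul_star_zOp_succ, entry_discBasis]
      simp only [add_left_inj, mul_ite, mul_zero]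
      split_ifs with h
      · rw [h.2]
      · rfl
  rw [h2, entry_discBasis, entry_discBasis, entry_discBasis]
  -- Column `n` sees only `z^* g`, column `n + 1` only `g z^*`. The case `k = 0` is separate because
  -- `k - 1` truncates; its coefficient `√(1 - q^0)` is `0`.
  by_cases hj : j = n
  · subst hj
    simp only [and_true, Nat.left_eq_add, one_ne_zero, and_false, if_false, mul_zero, sub_zero]
    rcases k with _ | k
    · simp
    · simp only [Nat.add_sub_cancel, add_left_inj]
      split_ifs with h
      · subst h
        rw [zWeight, ← pow_mul]
        have : (q : ℝ) ^ (2 * i) * ((q : ℝ) ^ (-(2 * ((i + 1 : ℕ) : ℤ))) * (q : ℝ) ^ 2) = 1 := by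
          rw [← zpow_natCast, ← zpow_natCast, ← zpow_add₀ hq, ← zpow_add₀ hq]
          convert zpow_zero (q : ℝ)
          push_cast
          ring
        simp only [← Complex.ofReal_mul, Complex.ofReal_inj]
        linear_combination (1 - (q : ℝ) ^ 2)⁻¹ * √(1 - (q : ℝ) ^ (2 * (i + 1))) *
          normConst q α j * this
      · simp
  · by_cases hj' : i = k ∧ j = n + 1
    · obtain ⟨rfl, rfl⟩ := hj'
      simp only [hj, and_false, if_false, and_self, if_true, mul_zero, zero_sub]
      rw [zWeight, ← pow_mul, ← rpow_mul_normConst_succ q α n]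
      have : (q : ℝ) ^ (2 * i) * (q : ℝ) ^ (-(2 * (i : ℤ))) = 1 := by
        rw [← zpow_natCast, ← zpow_add₀ hq]
        convert zpow_zero (q : ℝ)
        push_cast
        ring
      simp only [← Complex.ofReal_mul, ← Complex.ofReal_neg, Complex.ofReal_inj]
      linear_combination -(1 - (q : ℝ) ^ 2)⁻¹ * √(1 - (q : ℝ) ^ (2 * (n + 1))) *
          (q : ℝ) ^ ((α : ℝ) / 2) * normConst q α (n + 1) * this
    · simp [hj, hj']

theorem isPartialZbar_discBasis (q : QParam) (α : AParam) (n k : ℕ) :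
    IsPartialZbar q (discBasis q α n k)
      ((((-((q : ℝ) ^ (-(2 * (k : ℤ))) / (1 - (q : ℝ) ^ 2)) : ℝ) : ℂ) •
        ((((q : ℝ) ^ (-2 : ℤ) * √(1 - (q : ℝ) ^ (2 * (k + 1))) : ℝ) : ℂ) •
            discBasis q α n (k + 1) -
          (((q : ℝ) ^ (-((α : ℝ) / 2)) * √(1 - (q : ℝ) ^ (2 * n)) : ℝ) : ℂ) •
            discBasis q α (n - 1) k) : discAlg q) : Op ℕ) := by
  have hq : (q : ℝ) ≠ 0 := q.2.1.ne'
  refine op_ext fun i j => ?_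
  rw [entry_yOp_sq_mul, entry_smul, entry_sub, entry_mul_zOp]
  change _ * (_ * (_ * entry (discBasis q α n (k + 1) : Op ℕ) i j -
    _ * entry (discBasis q α (n - 1) k : Op ℕ) i j)) = _
  have h2 : entry (zOp q * (discBasis q α n k : Op ℕ)) i j =
      if i = k + 1 ∧ j = n then zWeight q k * ((normConst q α n : ℝ) : ℂ) else 0 := by
    rcases i with _ | i
    · rw [entry_zOp_mul_zero, if_neg (by omega)]
    · rw [entry_zOp_mul_succ, entry_discBasis]
      simp only [add_left_inj, mul_ite, mul_zero]
      split_ifs with h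
      · rw [h.1]
      · rfl
  rw [h2, entry_discBasis, entry_discBasis, entry_discBasis]
  -- Row `k` sees only `g z` and row `k + 1` only `z g`. Here `n - 1` truncates at `n = 0`, where
  -- the coefficient vanishes.
  by_cases hi : i = k
  · subst hi
    simp only [true_and, Nat.left_eq_add, one_ne_zero, false_and, if_false, mul_zero, zero_sub]
    rcases n with _ | n
    · simp
    · simp only [Nat.add_sub_cancel, add_left_inj]
      split_ifs with h
      · subst h
        rw [zWeight, ← pow_mul, ← rpow_neg_mul_normConst]
        have : (q : ℝ) ^ (2 * i) * (q : ℝ) ^ (-(2 * (i : ℤ))) = 1 := by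
          rw [← zpow_natCast, ← zpow_add₀ hq]
          convert zpow_zero (q : ℝ)
          push_cast
          ring
        simp only [← Complex.ofReal_mul, ← Complex.ofReal_neg, Complex.ofReal_inj]
        linear_combination (1 - (q : ℝ) ^ 2)⁻¹ * √(1 - (q : ℝ) ^ (2 * (j + 1))) *
          (q : ℝ) ^ (-((α : ℝ) / 2)) * normConst q α j * this
      · simp
  · by_cases hj' : i = k + 1 ∧ j = n
    · obtain ⟨rfl, rfl⟩ := hj'
      simp only [hi, false_and, if_false, and_self, if_true, mul_zero, sub_zero]
      rw [zWeight, ← pow_mul]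
      have : (q : ℝ) ^ (2 * (k + 1)) * ((q : ℝ) ^ (-(2 * (k : ℤ))) * (q : ℝ) ^ (-2 : ℤ)) = 1 := by
        rw [← zpow_natCast, ← zpow_add₀ hq, ← zpow_add₀ hq]
        convert zpow_zero (q : ℝ)
        push_cast
        ring
      simp only [← Complex.ofReal_mul, Complex.ofReal_inj]
      linear_combination -(1 - (q : ℝ) ^ 2)⁻¹ * √(1 - (q : ℝ) ^ (2 * (k + 1))) *
          normConst q α j * this
    · simp [hi, hj']

/-! ### Differentiable functions on the circle and the algebra `F^(1)(D_q) ⊗ C^(1)(S¹)`. -/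

theorem ofCont_fn (f : C(S1, ℂ)) : (ofCont f).fn =ᵐ[volume] f :=
  ContinuousMap.coeFn_toLp (p := ∞) (𝕜 := ℂ) volume f

/-- Lebesgue measure is positive on nonempty open sets, so continuous functions that agree almost
everywhere are equal. This makes `∂/∂t` well defined on classes in `L_∞(S¹)`. -/
theorem ofCont_injective : Function.Injective ofCont := fun _ _ h =>
  ContinuousMap.toLp_injective (p := ∞) (𝕜 := ℂ) volume h

theorem ofCont_add (f g : C(S1, ℂ)) : ofCont (f + g) = ofCont f + ofCont g :=
  map_add (ContinuousMap.toLp (E := ℂ) ∞ (volume : Measure S1) ℂ) f g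

theorem ofCont_smul (c : ℂ) (f : C(S1, ℂ)) : ofCont (c • f) = c • ofCont f :=
  map_smul (ContinuousMap.toLp (E := ℂ) ∞ (volume : Measure S1) ℂ) c f

theorem ofCont_mul (f g : C(S1, ℂ)) : ofCont (f * g) = ofCont f * ofCont g := by
  apply Linf.ext_ae
  filter_upwards [ofCont_fn (f * g), Linf.coe_mul (ofCont f) (ofCont g), ofCont_fn f,
    ofCont_fn g] with t h1 h2 h3 h4
  simp [h1, h2, h3, h4]

theorem ofCont_star (f : C(S1, ℂ)) : ofCont (star f) = star (ofCont f) := by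
  apply Linf.ext_ae
  filter_upwards [ofCont_fn (star f), Linf.coe_star (ofCont f), ofCont_fn f] with t h1 h2 h3
  simp [h1, h2, h3]

theorem ofCont_one : ofCont 1 = 1 := by
  apply Linf.ext_ae
  filter_upwards [ofCont_fn 1, Linf.coe_one] with t h1 h2
  simp [h1, h2]

theorem HasCircDeriv.add {f f' g g' : C(S1, ℂ)} (hf : HasCircDeriv f f')
    (hg : HasCircDeriv g g') : HasCircDeriv (f + g) (f' + g') := fun t => (hf t).add (hg t)

theorem HasCircDeriv.smul {f f' : C(S1, ℂ)} (hf : HasCircDeriv f f') (c : ℂ) :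
    HasCircDeriv (c • f) (c • f') := fun t => (hf t).const_smul c

theorem HasCircDeriv.mul {f f' g g' : C(S1, ℂ)} (hf : HasCircDeriv f f')
    (hg : HasCircDeriv g g') : HasCircDeriv (f * g) (f' * g + f * g') := fun t =>
  (hf t).mul (hg t)

theorem HasCircDeriv.star {f f' : C(S1, ℂ)} (hf : HasCircDeriv f f') :
    HasCircDeriv (star f) (star f') := fun t => (hf t).star

theorem HasCircDeriv.const (c : ℂ) : HasCircDeriv (ContinuousMap.const _ c) 0 := fun t =>
  hasDerivAt_const t c

theorem HasCircDeriv.unique {f f' f'' : C(S1, ℂ)} (h : HasCircDeriv f f')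
    (h' : HasCircDeriv f f'') : f' = f'' := by
  ext x
  obtain ⟨t, rfl⟩ := QuotientAddGroup.mk_surjective x
  exact (h t).unique (h' t)

theorem hasCircDeriv_fourier (l : ℤ) :
    HasCircDeriv (fourier l) ((Complex.I * (l : ℂ)) • fourier l) := by
  intro t
  have h := hasDerivAt_fourier (2 * Real.pi) l t
  convert! h using 1
  have : (Real.pi : ℂ) ≠ 0 := by exact_mod_cast Real.pi_ne_zero
  simp only [ContinuousMap.coe_smul, Pi.smul_apply, smul_eq_mul]
  push_cast
  field_simp

/-- The subspace `C^(1)(S¹)` of `L_∞(S¹)`. -/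
def circDiffSub : Submodule ℂ Linf where
  carrier := circDiff
  add_mem' := by
    rintro _ _ ⟨f, f', hf, rfl⟩ ⟨g, g', hg, rfl⟩
    exact ⟨_, _, hf.add hg, (ofCont_add f g).symm⟩
  zero_mem' := ⟨0, 0, HasCircDeriv.const 0, by simpa using (ofCont_smul 0 0).symm⟩
  smul_mem' := by
    rintro c _ ⟨f, f', hf, rfl⟩
    exact ⟨_, _, hf.smul c, (ofCont_smul c f).symm⟩

theorem one_mem_circDiff : 1 ∈ circDiff := ⟨1, 0, HasCircDeriv.const 1, ofCont_one.symm⟩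

theorem mul_mem_circDiff {φ ψ : Linf} (hφ : φ ∈ circDiff) (hψ : ψ ∈ circDiff) :
    φ * ψ ∈ circDiff := by
  obtain ⟨f, f', hf, rfl⟩ := hφ
  obtain ⟨g, g', hg, rfl⟩ := hψ
  exact ⟨_, _, hf.mul hg, (ofCont_mul f g).symm⟩

theorem star_mem_circDiff {φ : Linf} (hφ : φ ∈ circDiff) : star φ ∈ circDiff := by
  obtain ⟨f, f', hf, rfl⟩ := hφ
  exact ⟨_, _, hf.star, (ofCont_star f).symm⟩

theorem exists_partialT_linearMap : ∃ F : Linf →ₗ[ℂ] Linf, ∀ f f' : C(S1, ℂ),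
    HasCircDeriv f f' → F (ofCont f) = ofCont f' := by
  obtain ⟨F, hF⟩ := exists_linearMap_of_relation circDiffSub
    (fun φ ψ => ∃ f f', HasCircDeriv f f' ∧ φ = ofCont f ∧ ψ = ofCont f')
    (by rintro _ ⟨f, f', hf, rfl⟩; exact ⟨_, f, f', hf, rfl, rfl⟩)
    (by
      rintro _ _ _ ⟨f, f', hf, rfl, rfl⟩ ⟨g, g', hg, h, rfl⟩
      obtain rfl := ofCont_injective h
      rw [hf.unique hg])
    (by
      rintro _ _ _ _ ⟨f, f', hf, rfl, rfl⟩ ⟨g, g', hg, rfl, rfl⟩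
      exact ⟨_, _, hf.add hg, (ofCont_add _ _).symm, (ofCont_add _ _).symm⟩)
    (by
      rintro c _ _ ⟨f, f', hf, rfl, rfl⟩
      exact ⟨_, _, hf.smul c, (ofCont_smul _ _).symm, (ofCont_smul _ _).symm⟩)
  exact ⟨F, fun f f' hf => hF _ ⟨f, f', hf, rfl⟩ _ ⟨f, f', hf, rfl, rfl⟩⟩

/-- The `*`-subalgebra `F^(1)(D_q) ⊗ C^(1)(S¹)` of `F(D_q) ⊗ L_∞(S¹)`. -/
def chartDiffAlg (q : QParam) : StarSubalgebra ℂ (ChartAlg q) where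
  carrier := chartDiff q
  add_mem' := add_mem
  mul_mem' := by
    intro v w hv hw
    simp only [SetLike.mem_coe] at hv hw ⊢
    refine Submodule.span_induction (p := fun v _ => v * w ∈ chartDiff q) ?_ ?_ ?_ ?_ hv
    · rintro _ ⟨g, φ, hg, hφ, rfl⟩
      refine Submodule.span_induction (p := fun w _ => g ⊗ₜ[ℂ] φ * w ∈ chartDiff q) ?_ ?_ ?_ ?_ hw
      · rintro _ ⟨g', φ', hg', hφ', rfl⟩
        rw [Algebra.TensorProduct.tmul_mul_tmul]
        refine tmul_mem_chartDiff ?_ (mul_mem_circDiff hφ hφ')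
        rw [mem_discDiff_iff] at *
        exact mul_mem hg hg'
      · simp
      · intro x y _ _ hx hy
        rw [mul_add]
        exact add_mem hx hy
      · intro c x _ hx
        rw [mul_smul_comm]
        exact Submodule.smul_mem _ c hx
    · simp
    · intro x y _ _ hx hy
      rw [add_mul]
      exact add_mem hx hy
    · intro c x _ hx
      rw [smul_mul_assoc]
      exact Submodule.smul_mem _ c hx
  algebraMap_mem' c := by
    rw [Algebra.algebraMap_eq_smul_one]
    refine Submodule.smul_mem _ c ?_
    rw [Algebra.TensorProduct.one_def]
    refine tmul_mem_chartDiff ?_ one_mem_circDiff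
    rw [mem_discDiff_iff]
    exact one_mem _
  star_mem' := by
    intro v hv
    simp only [SetLike.mem_coe] at hv ⊢
    refine Submodule.span_induction (p := fun v _ => star v ∈ chartDiff q) ?_ ?_ ?_ ?_ hv
    · rintro _ ⟨g, φ, hg, hφ, rfl⟩
      rw [TensorProduct.star_tmul]
      refine tmul_mem_chartDiff ?_ (star_mem_circDiff hφ)
      rw [mem_discDiff_iff] at *
      exact star_mem hg
    · simp
    · intro x y _ _ hx hy
      rw [star_add]
      exact add_mem hx hy
    · intro c x _ hx
      rw [star_smul]
      exact Submodule.smul_mem _ _ hx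

/-! ### Fourier analysis on the circle. -/

/-- The orthonormal basis `(2π)^{-1/2} e^{ilt}` of `L₂(S¹)`. -/
def circBasis (l : ℤ) : Linf := ((1 / √(2 * Real.pi) : ℝ) : ℂ) • ofCont (fourier l)

theorem circBasis_fn (l : ℤ) :
    (circBasis l).fn =ᵐ[volume] fun t => ((1 / √(2 * Real.pi) : ℝ) : ℂ) * fourier l t := by
  filter_upwards [Linf.coe_smul ((1 / √(2 * Real.pi) : ℝ) : ℂ) (ofCont (fourier l)),
    ofCont_fn (fourier l)] with t h1 h2
  rw [circBasis, h1, Pi.smul_apply, h2, smul_eq_mul]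

theorem circBasis_eq_ofCont (l : ℤ) :
    circBasis l = ofCont (((1 / √(2 * Real.pi) : ℝ) : ℂ) • fourier l) :=
  (ofCont_smul _ _).symm

theorem hasCircDeriv_circBasis (l : ℤ) :
    HasCircDeriv (((1 / √(2 * Real.pi) : ℝ) : ℂ) • fourier l)
      (((1 / √(2 * Real.pi) : ℝ) : ℂ) • ((Complex.I * (l : ℂ)) • fourier l)) :=
  (hasCircDeriv_fourier l).smul _

theorem circBasis_mem_circDiff (l : ℤ) : circBasis l ∈ circDiff :=
  ⟨_, _, hasCircDeriv_circBasis l, circBasis_eq_ofCont l⟩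

/-- `fourierCoeff` integrates against normalized Haar measure, while `circInner` uses total mass
`2π`; the quotient `2π / √(2π)` leaves `√(2π)`. -/
theorem circInner_circBasis (l : ℤ) (φ : Linf) :
    circInner (circBasis l) φ = ((√(2 * Real.pi) : ℝ) : ℂ) * fourierCoeff φ.fn l := by
  have h : circInner (circBasis l) φ =
      ((1 / √(2 * Real.pi) : ℝ) : ℂ) * ∫ t : S1, fourier (-l) t • φ.fn t := by
    rw [circInner, ← integral_const_mul]
    apply integral_congr_ae
    filter_upwards [circBasis_fn l] with t h
    rw [h, map_mul, Complex.conj_ofReal, fourier_neg, smul_eq_mul, mul_assoc]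
  have h2 : (0 : ℝ) < √(2 * Real.pi) := Real.sqrt_pos.mpr Real.two_pi_pos
  have h2' : ((√(2 * Real.pi) : ℝ) : ℂ) ≠ 0 := by exact_mod_cast h2.ne'
  have h3 : (2 * Real.pi : ℝ) = √(2 * Real.pi) * √(2 * Real.pi) :=
    (Real.mul_self_sqrt Real.two_pi_pos.le).symm
  rw [h, fourierCoeff, AddCircle.integral_haarAddCircle, ← Complex.coe_smul, smul_eq_mul,
    ← mul_assoc, ← Complex.ofReal_mul]
  congr 2
  field_simp
  rw [sq, ← h3]

theorem circInner_circBasis_circBasis (l m : ℤ) :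
    circInner (circBasis l) (circBasis m) = if l = m then 1 else 0 := by
  have h : fourierCoeff (circBasis m).fn l =
      ((1 / √(2 * Real.pi) : ℝ) : ℂ) * fourierCoeff (T := 2 * Real.pi) (fourier m) l := by
    rw [← fourierCoeff.const_mul]
    refine congrFun (fourierCoeff_congr_ae ?_) l
    have hac : AddCircle.haarAddCircle (T := 2 * Real.pi) ≪ volume :=
      Measure.absolutelyContinuous_smul (ENNReal.ofReal_pos.mpr Real.two_pi_pos).ne'
    exact hac.ae_eq (circBasis_fn m)
  have h2 : ((√(2 * Real.pi) : ℝ) : ℂ) ≠ 0 := by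
    exact_mod_cast (Real.sqrt_pos.mpr Real.two_pi_pos).ne'
  rw [circInner_circBasis, h, fourierCoeff_fourier, Pi.single_apply, ← mul_assoc]
  push_cast
  rw [mul_one_div_cancel h2, one_mul]

/-- Parseval's identity for `φ`, which is square integrable because the circle has finite measure.
-/
theorem hasSum_sq_circInner (φ : Linf) :
    HasSum (fun l => ‖circInner (circBasis l) φ‖ ^ 2) (circInner φ φ).re := by
  have hm : MemLp φ.fn 2 (AddCircle.haarAddCircle (T := 2 * Real.pi)) :=
    (φ.memLp.mono_exponent le_top).haarAddCircle
  obtain ⟨F, hF⟩ : ∃ F : Lp ℂ 2 (AddCircle.haarAddCircle (T := 2 * Real.pi)),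
      F =ᵐ[AddCircle.haarAddCircle] φ.fn := ⟨MemLp.toLp φ.fn hm, hm.coeFn_toLp⟩
  have h := hasSum_sq_fourierCoeff F
  have h1 : ∀ l, fourierCoeff F l = fourierCoeff φ.fn l := fun l =>
    congrFun (fourierCoeff_congr_ae hF) l
  have h2 : ∫ t, ‖F t‖ ^ 2 ∂(AddCircle.haarAddCircle (T := 2 * Real.pi)) =
      (2 * Real.pi)⁻¹ * ∫ t : S1, ‖φ.fn t‖ ^ 2 := by
    refine Eq.trans ?_ AddCircle.integral_haarAddCircle
    apply integral_congr_ae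
    filter_upwards [hF] with t h
    rw [h]
  have h3 : circInner φ φ = ((∫ t : S1, ‖φ.fn t‖ ^ 2 : ℝ) : ℂ) := by
    rw [circInner, ← integral_complex_ofReal]
    simp [Complex.conj_mul']
  simp only [h1, h2] at h
  convert! h.mul_left (2 * Real.pi) using 1
  · ext l
    rw [circInner_circBasis, norm_mul, mul_pow, Complex.norm_real, Real.norm_eq_abs, sq_abs,
      Real.sq_sqrt Real.two_pi_pos.le]
  · rw [h3, Complex.ofReal_re, mul_inv_cancel_left₀ Real.two_pi_pos.ne']

theorem circInner_circBasis_uElt_mul (l : ℤ) (φ : Linf) :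
    circInner (circBasis (l + 1)) (uElt * φ) = circInner (circBasis l) φ := by
  apply integral_congr_ae
  filter_upwards [circBasis_fn l, circBasis_fn (l + 1), Linf.coe_mul uElt φ,
    ofCont_fn (fourier 1)] with t h1 h2 h3 h4
  have : conj (fourier 1 t) * fourier 1 t = 1 := by
    rw [← fourier_neg, ← fourier_add]; simp
  rw [h1, h2, h3, Pi.mul_apply, uElt, h4, map_mul, map_mul, fourier_add, map_mul]
  linear_combination conj (((1 / √(2 * Real.pi) : ℝ) : ℂ)) * conj (fourier l t) * φ.fn t * this

theorem circInner_circBasis_star_uElt_mul (l : ℤ) (φ : Linf) :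
    circInner (circBasis l) (star uElt * φ) = circInner (circBasis (l + 1)) φ := by
  apply integral_congr_ae
  filter_upwards [circBasis_fn l, circBasis_fn (l + 1), Linf.coe_mul (star uElt) φ,
    ofCont_fn (fourier 1), Linf.coe_star uElt] with t h1 h2 h3 h4 h5
  rw [h1, h2, h3, Pi.mul_apply, h5, Pi.star_apply, uElt, h4, map_mul, map_mul, fourier_add,
    map_mul]
  change _ * (conj (fourier 1 t) * _) = _
  ring

/-! ### The orthonormal basis of the completion. -/

/-- The squared distance from `x` to its partial Fourier sum over `F` is `‖x‖² - ∑_{i ∈ F} |⟪v i,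
x⟫|²`, which tends to `0` when Bessel's inequality is an equality. -/
theorem mem_closure_span_of_hasSum {E ι : Type} [NormedAddCommGroup E] [InnerProductSpace ℂ E]
    {v : ι → E} (hv : Orthonormal ℂ v) {x : E}
    (h : HasSum (fun i => ‖⟪v i, x⟫_ℂ‖ ^ 2) (‖x‖ ^ 2)) :
    x ∈ (Submodule.span ℂ (Set.range v)).topologicalClosure := by
  have key : ∀ F : Finset ι, ‖x - ∑ i ∈ F, ⟪v i, x⟫_ℂ • v i‖ ^ 2 =
      ‖x‖ ^ 2 - ∑ i ∈ F, ‖⟪v i, x⟫_ℂ‖ ^ 2 := by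
    intro F
    set p := ∑ i ∈ F, ⟪v i, x⟫_ℂ • v i with hp
    have h1 : ⟪p, x⟫_ℂ = ((∑ i ∈ F, ‖⟪v i, x⟫_ℂ‖ ^ 2 : ℝ) : ℂ) := by
      rw [hp, sum_inner]
      push_cast
      refine Finset.sum_congr rfl fun i _ => ?_
      rw [inner_smul_left, Complex.conj_mul']
    have h2 : ⟪p, p⟫_ℂ = ((∑ i ∈ F, ‖⟪v i, x⟫_ℂ‖ ^ 2 : ℝ) : ℂ) := by
      rw [hp, hv.inner_sum]
      push_cast
      exact Finset.sum_congr rfl fun i _ => Complex.conj_mul' _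
    have h3 : ‖p‖ ^ 2 = ∑ i ∈ F, ‖⟪v i, x⟫_ℂ‖ ^ 2 := by
      rw [inner_self_eq_norm_sq_to_K] at h2
      exact Complex.ofReal_injective ((Complex.ofReal_pow _ _).trans h2)
    rw [norm_sub_sq (𝕜 := ℂ), ← inner_conj_symm, h1, h3, Complex.conj_ofReal]
    have h4 : ∀ c : ℝ, RCLike.re (c : ℂ) = c := fun c => Complex.ofReal_re c
    rw [h4]
    ring
  refine mem_closure_of_tendsto (f := fun F : Finset ι => ∑ i ∈ F, ⟪v i, x⟫_ℂ • v i)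
    (b := atTop) ?_ (Eventually.of_forall fun F => Submodule.sum_mem _ fun i _ =>
      Submodule.smul_mem _ _ (Submodule.subset_span ⟨i, rfl⟩))
  rw [tendsto_iff_norm_sub_tendsto_zero]
  have h0 : Tendsto (fun F : Finset ι => ‖x - ∑ i ∈ F, ⟪v i, x⟫_ℂ • v i‖ ^ 2) atTop (𝓝 0) := by
    simp only [key]
    have h5 := (tendsto_const_nhds (x := ‖x‖ ^ 2)).sub h
    rwa [sub_self] at h5
  have h4 := (Real.continuous_sqrt.tendsto 0).comp h0
  simp only [Function.comp_def, Real.sqrt_zero, Real.sqrt_sq (norm_nonneg _)] at h4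
  simpa only [norm_sub_rev] using h4

/-- The normalization `(1 - q) q^{αn} N_n² = 1`, arranged so that pairing with a basis element
produces a single `N_n⁻¹`. -/
theorem normConst_sq (q : QParam) (α : AParam) (n : ℕ) :
    (1 - (q : ℝ)) * ((q : ℝ) ^ n) ^ (α : ℝ) * normConst q α n = (normConst q α n)⁻¹ := by
  have h1 : (0 : ℝ) < 1 - q := by linarith [q.2.2]
  have h2 : ((q : ℝ) ^ n) ^ (α : ℝ) * ((q : ℝ) ^ (-((α : ℝ) * n / 2)) *
      (q : ℝ) ^ (-((α : ℝ) * n / 2))) = 1 := by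
    rw [← Real.rpow_natCast, ← Real.rpow_mul q.2.1.le, ← Real.rpow_add q.2.1,
      ← Real.rpow_add q.2.1]
    convert Real.rpow_zero (q : ℝ) using 2
    ring
  have h3 : √(1 - (q : ℝ)) * √(1 - (q : ℝ)) = 1 - q := Real.mul_self_sqrt h1.le
  have h4 : √(1 - (q : ℝ)) ≠ 0 := (Real.sqrt_pos.mpr h1).ne'
  refine eq_inv_of_mul_eq_one_left ?_
  rw [normConst]
  field_simp
  rw [sq √(1 - (q : ℝ)), h3]
  linear_combination (1 - (q : ℝ)) * h2

theorem basisFn_eq (q : QParam) (α : AParam) (n k : ℕ) (l : ℤ) :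
    basisFn q α n k l = discBasis q α n k ⊗ₜ[ℂ] circBasis l := rfl

theorem basisFn_mem_chartDiff (q : QParam) (α : AParam) (n k : ℕ) (l : ℤ) :
    basisFn q α n k l ∈ chartDiff q :=
  tmul_mem_chartDiff (discBasis_mem_discDiff q α n k) (circBasis_mem_circDiff l)

theorem discInner_discBasis (q : QParam) (α : AParam) (n k : ℕ) (f : Op ℕ) :
    discInner q α (discBasis q α n k) f =
      (((normConst q α n)⁻¹ : ℝ) : ℂ) * entry f k n := by
  have hB : ∀ m, (discBasis q α n k : Op ℕ) (basisVec m) =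
      if m = n then ((normConst q α n : ℝ) : ℂ) • basisVec k else 0 := by
    intro m
    ext i
    change entry (discBasis q α n k : Op ℕ) i m = _
    rw [entry_discBasis]
    by_cases h : m = n
    · simp only [h, and_true, if_true]
      change _ = ((normConst q α n : ℝ) : ℂ) * (basisVec k : Ell2 ℕ) i
      rw [entry_basis, mul_ite, mul_one, mul_zero]
    · simp [h]
  rw [discInner, trace_eq, tsum_eq_single n]
  · rw [hB, if_pos rfl, inner_smul_left, inner_basisVec, Complex.conj_ofReal, ← mul_assoc,
      ← mul_assoc, ← Complex.ofReal_mul, ← Complex.ofReal_mul, normConst_sq]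
    rfl
  · intro m hm
    rw [hB, if_neg hm, inner_zero_left, mul_zero]

theorem discInner_self (q : QParam) (α : AParam) (f : Op ℕ) :
    discInner q α f f = (((1 - (q : ℝ)) *
        ∑' n : ℕ, ((q : ℝ) ^ n) ^ (α : ℝ) * ‖f (basisVec n)‖ ^ 2 : ℝ) : ℂ) := by
  simp [discInner, trace_eq, inner_self_eq_norm_sq_to_K, Complex.ofReal_tsum]

/-- Parseval in `ℓ²(ℕ)` for each column `f e_n`, summed over `n` with the weights `(1 - q) q^{αn}`;
boundedness of `f` gives the convergence. -/
theorem hasSum_sq_discInner (q : QParam) (α : AParam) (f : Op ℕ) :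
    HasSum (fun p : ℕ × ℕ => ‖discInner q α (discBasis q α p.1 p.2) f‖ ^ 2)
      (discInner q α f f).re := by
  have hterm : ∀ n k, ‖discInner q α (discBasis q α n k) f‖ ^ 2 =
      (1 - (q : ℝ)) * (((q : ℝ) ^ n) ^ (α : ℝ) * ‖f (basisVec n) k‖ ^ 2) := by
    intro n k
    rw [discInner_discBasis, norm_mul, Complex.norm_real, mul_pow, Real.norm_eq_abs, sq_abs, sq,
      ← normConst_sq]
    -- The preceding rewrite expanded both factors `N_n⁻¹`; folding the second one back lets it
    -- cancel against the `N_n` of the first.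
    nth_rw 2 [normConst_sq]
    rw [mul_assoc _ (normConst q α n), mul_inv_cancel₀ (normConst_pos q α n).ne', mul_one,
      mul_assoc]
    rfl
  have hn : ∀ n, HasSum (fun k => ‖discInner q α (discBasis q α n k) f‖ ^ 2)
      ((1 - (q : ℝ)) * (((q : ℝ) ^ n) ^ (α : ℝ) * ‖f (basisVec n)‖ ^ 2)) := by
    intro n
    simp only [hterm]
    rw [norm_sq_eq]
    exact ((summable_sq (f (basisVec n))).hasSum.mul_left _).mul_left _
  have hs : Summable fun n : ℕ => ((q : ℝ) ^ n) ^ (α : ℝ) * ‖f (basisVec n)‖ ^ 2 := by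
    refine Summable.of_nonneg_of_le (fun n =>
      mul_nonneg (Real.rpow_nonneg (pow_pos_q q n).le _) (sq_nonneg _)) (fun n => ?_)
      ((summable_weight q α).mul_right (‖f‖ ^ 2))
    refine mul_le_mul_of_nonneg_left ?_ (Real.rpow_nonneg (pow_pos_q q n).le _)
    exact pow_le_pow_left₀ (norm_nonneg _) (norm_apply_basisVec_le f n) 2
  have hsum : Summable fun p : ℕ × ℕ => ‖discInner q α (discBasis q α p.1 p.2) f‖ ^ 2 := by
    rw [summable_prod_of_nonneg fun _ => by positivity]
    refine ⟨fun n => (hn n).summable, ?_⟩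
    simp only [(hn _).tsum_eq]
    exact hs.mul_left _
  rw [discInner_self, Complex.ofReal_re, ← tsum_mul_left]
  convert! hsum.hasSum using 1
  rw [hsum.tsum_prod]
  simp only [(hn _).tsum_eq]

theorem inner_basisFn (q : QParam) (α : AParam) (n k : ℕ) (l : ℤ) (f : discAlg q) (φ : Linf) :
    ⟪toHilb q α (basisFn q α n k l), toHilb q α (f ⊗ₜ φ)⟫_ℂ =
      (((normConst q α n)⁻¹ : ℝ) : ℂ) * entry (f : Op ℕ) k n * circInner (circBasis l) φ := by
  rw [basisFn_eq, inner_toHilb_tmul, discInner_discBasis]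

theorem orthonormal_basisFn (q : QParam) (α : AParam) :
    Orthonormal ℂ fun p : ℕ × ℕ × ℤ => toHilb q α (basisFn q α p.1 p.2.1 p.2.2) := by
  rw [orthonormal_iff_ite]
  rintro ⟨n, k, l⟩ ⟨n', k', l'⟩
  simp only
  rw [basisFn_eq q α n' k' l', inner_basisFn, entry_discBasis, circInner_circBasis_circBasis]
  have h : (((normConst q α n)⁻¹ : ℝ) : ℂ) * ((normConst q α n : ℝ) : ℂ) = 1 := by
    rw [← Complex.ofReal_mul, inv_mul_cancel₀ (normConst_pos q α n).ne', Complex.ofReal_one]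
  by_cases h1 : n = n' <;> by_cases h2 : k = k' <;> by_cases h3 : l = l' <;>
    simp [h1, h2, h3]
  subst h1
  simpa using h

/-- Both inner products factor on pure tensors, so the product of the two Parseval identities places
each pure tensor in the closed span. Pure tensors span a dense subspace. -/
theorem closure_span_basisFn (q : QParam) (α : AParam) :
    ⊤ ≤ (Submodule.span ℂ (Set.range fun p : ℕ × ℕ × ℤ =>
      toHilb q α (basisFn q α p.1 p.2.1 p.2.2))).topologicalClosure := by
  set S := (Submodule.span ℂ (Set.range fun p : ℕ × ℕ × ℤ =>
      toHilb q α (basisFn q α p.1 p.2.1 p.2.2))).topologicalClosure with hS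
  have hpure : ∀ (f : discAlg q) (φ : Linf), toHilb q α (f ⊗ₜ φ) ∈ S := by
    intro f φ
    refine mem_closure_span_of_hasSum (orthonormal_basisFn q α) ?_
    have h1 := hasSum_sq_discInner q α (f : Op ℕ)
    have h2 := hasSum_sq_circInner φ
    have h := h1.mul h2 (h1.summable.mul_of_nonneg h2.summable (fun _ => sq_nonneg _)
      (fun _ => sq_nonneg _))
    have hnorm : ‖toHilb q α (f ⊗ₜ φ)‖ ^ 2 = (discInner q α f f).re * (circInner φ φ).re := by
      rw [← inner_self_eq_norm_sq (𝕜 := ℂ), inner_toHilb_tmul]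
      change (_ * _ : ℂ).re = _
      rw [Complex.mul_re, discInner_self, Complex.ofReal_im, zero_mul, sub_zero]
    rw [hnorm, ← (Equiv.prodAssoc ℕ ℕ ℤ).hasSum_iff]
    convert! h using 1
    ext ⟨⟨n, k⟩, l⟩
    simp only [Function.comp_apply, Equiv.prodAssoc_apply]
    rw [inner_basisFn, ← discInner_discBasis, norm_mul, mul_pow]
  have hall : ∀ w, toHilb q α w ∈ S := by
    intro w
    induction w using TensorProduct.induction_on with
    | zero => rw [map_zero]; exact zero_mem _
    | tmul f φ => exact hpure f φ
    | add x y hx hy => rw [map_add]; exact add_mem hx hy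
  intro x _
  have hcl : IsClosed (S : Set (Hilb q α)) := Submodule.isClosed_topologicalClosure _
  exact closure_minimal (Set.range_subset_iff.mpr hall) hcl (denseRange_toHilb q α x)

/-- The orthonormal basis `e_{nkl}`. -/
def hilbBasis (q : QParam) (α : AParam) : HilbertBasis (ℕ × ℕ × ℤ) ℂ (Hilb q α) :=
  HilbertBasis.mk (orthonormal_basisFn q α) (closure_span_basisFn q α)

theorem hilbBasis_apply (q : QParam) (α : AParam) (n k : ℕ) (l : ℤ) :
    hilbBasis q α (n, k, l) = toHilb q α (basisFn q α n k l) := by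
  rw [hilbBasis, HilbertBasis.coe_mk]

theorem hilbBasis_repr_tmul (q : QParam) (α : AParam) (n k : ℕ) (l : ℤ) (f : discAlg q)
    (φ : Linf) : (hilbBasis q α).repr (toHilb q α (f ⊗ₜ φ)) (n, k, l) =
      (((normConst q α n)⁻¹ : ℝ) : ℂ) * entry (f : Op ℕ) k n * circInner (circBasis l) φ := by
  rw [HilbertBasis.repr_apply_apply, hilbBasis_apply, inner_basisFn]

/-! ### Multiplication operators in coordinates. -/

/-- The index set of the basis `e_{nkl}`. -/
abbrev Idx : Type := ℕ × ℕ × ℤ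

/-- Fibration of the index set along `k`. -/
def fibK : (ℕ × ℤ) × ℕ ≃ Idx where
  toFun p := (p.1.1, p.2, p.1.2)
  invFun p := ((p.1, p.2.2), p.2.1)
  left_inv _ := rfl
  right_inv _ := rfl

/-- Fibration of the index set along `n`. -/
def fibN : (ℕ × ℤ) × ℕ ≃ Idx where
  toFun p := (p.2, p.1.1, p.1.2)
  invFun p := ((p.2.1, p.2.2), p.1)
  left_inv _ := rfl
  right_inv _ := rfl

/-- Fibration of the index set along `(k, l)`. -/
def fibKL : ℕ × (ℕ × ℤ) ≃ Idx := Equiv.refl _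

/-- Fibration of the index set along `(n, l)`. -/
def fibNL : ℕ × (ℕ × ℤ) ≃ Idx where
  toFun p := (p.2.1, p.1, p.2.2)
  invFun p := (p.2.1, p.1, p.2.2)
  left_inv _ := rfl
  right_inv _ := rfl

theorem basisVec_apply {I : Type} [DecidableEq I] (i j : I) :
    (basisVec j : Ell2 I) i = if i = j then 1 else 0 := by
  simp [basisVec, lp.single_apply, Pi.single_apply]

theorem slice_basisVec {I J K : Type} [DecidableEq I] [DecidableEq J] [DecidableEq K]
    (e : J × I ≃ K) (j j' : J) (i : I) :
    slice e j' (basisVec (e (j, i))) = if j' = j then basisVec i else 0 := by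
  ext i'
  rw [slice_apply, basisVec_apply]
  split_ifs with h1 h2 h2
  · simp only [EmbeddingLike.apply_eq_iff_eq, Prod.mk.injEq] at h1
    rw [basisVec_apply, if_pos h1.2]
  · simp only [EmbeddingLike.apply_eq_iff_eq, Prod.mk.injEq] at h1
    exact absurd h1.1 h2
  · rw [basisVec_apply, if_neg]
    rintro rfl
    exact h1 (by rw [h2])
  · rfl

theorem amp_basisVec {I J K : Type} [DecidableEq I] [DecidableEq J] [DecidableEq K]
    (e : J × I ≃ K) {T : Op I} {i i' : I} {c : ℂ} (h : T (basisVec i) = c • basisVec i') (j : J) :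
    amp e T (basisVec (e (j, i))) = c • basisVec (e (j, i')) := by
  refine ext_slice (e := e) fun j' => ?_
  rw [map_smul, slice_basisVec]
  refine (slice_ampOp e T _ j').trans ?_
  rw [slice_basisVec]
  split_ifs
  · exact h
  · rw [map_zero, smul_zero]

section Transport

variable (q : QParam) (α : AParam)

/-- Transport of operators along the basis `e_{nkl}`. -/
def transport : Op Idx ≃⋆ₐ[ℂ] (Hilb q α →L[ℂ] Hilb q α) :=
  (hilbBasis q α).repr.symm.conjStarAlgEquiv

theorem repr_transport (T : Op Idx) (v : Hilb q α) :
    (hilbBasis q α).repr (transport q α T v) = T ((hilbBasis q α).repr v) :=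
  (hilbBasis q α).repr.apply_symm_apply _

theorem repr_hilbBasis (i : Idx) : (hilbBasis q α).repr (hilbBasis q α i) = basisVec i :=
  (hilbBasis q α).repr_self i

variable {q α}

theorem transport_hilbBasis {T : Op Idx} {i j : Idx} {c : ℂ}
    (h : T (basisVec i) = c • basisVec j) :
    transport q α T (hilbBasis q α i) = c • hilbBasis q α j := by
  apply (hilbBasis q α).repr.injective
  rw [repr_transport, map_smul, repr_hilbBasis, repr_hilbBasis, h]

/-- By additivity only pure tensors matter, and there the identity can be compared coordinate by
coordinate in the basis `e_{nkl}`. -/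
theorem isLeftMul_transport {T : Op Idx} {x : discAlg q} {ψ : Linf}
    (h : ∀ (f : discAlg q) (φ : Linf) (n k : ℕ) (l : ℤ),
      T ((hilbBasis q α).repr (toHilb q α (f ⊗ₜ φ))) (n, k, l) =
        (((normConst q α n)⁻¹ : ℝ) : ℂ) * entry ((x : Op ℕ) * (f : Op ℕ)) k n *
          circInner (circBasis l) (ψ * φ)) :
    IsLeftMul q α (transport q α T) (x ⊗ₜ[ℂ] ψ) := by
  intro w
  induction w using TensorProduct.induction_on with
  | zero => simp
  | add w w' hw hw' => rw [map_add, map_add, hw, hw', mul_add, map_add]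
  | tmul f φ =>
    apply (hilbBasis q α).repr.injective
    ext ⟨n, k, l⟩
    rw [repr_transport, h, Algebra.TensorProduct.tmul_mul_tmul, hilbBasis_repr_tmul]
    rfl

theorem isRightMul_transport {T : Op Idx} {x : discAlg q} {ψ : Linf}
    (h : ∀ (f : discAlg q) (φ : Linf) (n k : ℕ) (l : ℤ),
      T ((hilbBasis q α).repr (toHilb q α (f ⊗ₜ φ))) (n, k, l) =
        (((normConst q α n)⁻¹ : ℝ) : ℂ) * entry ((f : Op ℕ) * (x : Op ℕ)) k n *
          circInner (circBasis l) (ψ * φ)) :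
    IsRightMul q α (transport q α T) (x ⊗ₜ[ℂ] ψ) := by
  intro w
  induction w using TensorProduct.induction_on with
  | zero => simp
  | add w w' hw hw' => rw [map_add, map_add, hw, hw', add_mul, map_add]
  | tmul f φ =>
    apply (hilbBasis q α).repr.injective
    ext ⟨n, k, l⟩
    rw [repr_transport, h, Algebra.TensorProduct.tmul_mul_tmul, hilbBasis_repr_tmul, mul_comm φ ψ]
    rfl

theorem IsLeftMul.unique {T T' : Hilb q α →L[ℂ] Hilb q α} {x : ChartAlg q}
    (h : IsLeftMul q α T x) (h' : IsLeftMul q α T' x) : T = T' :=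
  DFunLike.coe_injective ((denseRange_toHilb q α).equalizer T.continuous T'.continuous
    (funext fun w => (h w).trans (h' w).symm))

theorem IsRightMul.unique {T T' : Hilb q α →L[ℂ] Hilb q α} {x : ChartAlg q}
    (h : IsRightMul q α T x) (h' : IsRightMul q α T' x) : T = T' :=
  DFunLike.coe_injective ((denseRange_toHilb q α).equalizer T.continuous T'.continuous
    (funext fun w => (h w).trans (h' w).symm))

/-- For fixed `n` and `l` the coordinates form a multiple of the `n`-th column of `f`, and left
multiplication acts on columns. -/
theorem slice_fibK (f : discAlg q) (φ : Linf) (n : ℕ) (l : ℤ) :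
    slice fibK (n, l) ((hilbBasis q α).repr (toHilb q α (f ⊗ₜ φ))) =
      ((((normConst q α n)⁻¹ : ℝ) : ℂ) * circInner (circBasis l) φ) •
        (f : Op ℕ) (basisVec n) := by
  ext k
  refine (hilbBasis_repr_tmul q α n k l f φ).trans ?_
  change _ = (_ * _) * entry (f : Op ℕ) k n
  ring

variable (q α)

/-- Left multiplication by operators on `ℓ²(ℕ)`. -/
def leftRep : Op ℕ →⋆ₐ[ℂ] (Hilb q α →L[ℂ] Hilb q α) :=
  ((transport q α : Op Idx ≃⋆ₐ[ℂ] _) : Op Idx →⋆ₐ[ℂ] _).comp (amp fibK)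

/-- The amplification of operators on `ℓ²(ℕ)` acting on the index `n`. -/
def rightRep : Op ℕ →⋆ₐ[ℂ] (Hilb q α →L[ℂ] Hilb q α) :=
  ((transport q α : Op Idx ≃⋆ₐ[ℂ] _) : Op Idx →⋆ₐ[ℂ] _).comp (amp fibN)

variable {q α}

theorem leftRep_apply (T : Op ℕ) : leftRep q α T = transport q α (amp fibK T) := rfl

theorem rightRep_apply (T : Op ℕ) : rightRep q α T = transport q α (amp fibN T) := rfl

theorem isLeftMul_leftRep (x : discAlg q) :
    IsLeftMul q α (leftRep q α (x : Op ℕ)) (x ⊗ₜ[ℂ] 1) := by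
  rw [leftRep_apply]
  refine isLeftMul_transport fun f φ n k l => ?_
  refine (amp_apply fibK (x : Op ℕ) _ (n, l) k).trans ?_
  rw [slice_fibK, map_smul, one_mul]
  change (_ * _) * entry ((x : Op ℕ) * (f : Op ℕ)) k n = _
  ring

theorem leftRep_hilbBasis {T : Op ℕ} {k k' : ℕ} {c : ℂ}
    (h : T (basisVec k) = c • basisVec k') (n : ℕ) (l : ℤ) :
    leftRep q α T (hilbBasis q α (n, k, l)) = c • hilbBasis q α (n, k', l) :=
  transport_hilbBasis (amp_basisVec fibK h (n, l))

theorem rightRep_hilbBasis {T : Op ℕ} {n n' : ℕ} {c : ℂ}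
    (h : T (basisVec n) = c • basisVec n') (k : ℕ) (l : ℤ) :
    rightRep q α T (hilbBasis q α (n, k, l)) = c • hilbBasis q α (n', k, l) :=
  transport_hilbBasis (amp_basisVec fibN h (k, l))

theorem slice_fibN_apply (f : discAlg q) (φ : Linf) (n k : ℕ) (l : ℤ) :
    slice fibN (k, l) ((hilbBasis q α).repr (toHilb q α (f ⊗ₜ φ))) n =
      (((normConst q α n)⁻¹ : ℝ) : ℂ) * entry (f : Op ℕ) k n * circInner (circBasis l) φ :=
  hilbBasis_repr_tmul q α n k l f φ

theorem rpow_neg_mul_inv_normConst_succ (q : QParam) (α : AParam) (n : ℕ) :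
    (q : ℝ) ^ (-((α : ℝ) / 2)) * (normConst q α (n + 1))⁻¹ = (normConst q α n)⁻¹ := by
  rw [← rpow_mul_normConst_succ q α n, mul_inv, Real.rpow_neg q.2.1.le]

theorem rpow_mul_inv_normConst (q : QParam) (α : AParam) (n : ℕ) :
    (q : ℝ) ^ ((α : ℝ) / 2) * (normConst q α n)⁻¹ = (normConst q α (n + 1))⁻¹ := by
  rw [← rpow_neg_mul_inv_normConst_succ, ← mul_assoc, ← Real.rpow_add q.2.1, add_neg_cancel,
    Real.rpow_zero, one_mul]

/-- Right multiplication moves column `n + 1` to column `n`, as `z^*` does on the index `n`, and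
`N_n⁻¹ = q^{-α/2} N_{n+1}⁻¹` accounts for the scalar. -/
theorem isRightMul_zElt : IsRightMul q α
    ((((q : ℝ) ^ (-((α : ℝ) / 2)) : ℝ) : ℂ) • rightRep q α (star (zOp q))) (zElt q ⊗ₜ[ℂ] 1) := by
  rw [← map_smul, rightRep_apply]
  refine isRightMul_transport fun f φ n k l => ?_
  refine (amp_apply fibN _ _ (k, l) n).trans ?_
  change _ * (star (zOp q) _) n = _ * entry ((f : Op ℕ) * zOp q) k n * _
  rw [star_zOp_apply, slice_fibN_apply, entry_mul_zOp,
    ← rpow_neg_mul_inv_normConst_succ q α n, one_mul]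
  push_cast
  ring

theorem isRightMul_star_zElt : IsRightMul q α
    ((((q : ℝ) ^ ((α : ℝ) / 2) : ℝ) : ℂ) • rightRep q α (zOp q)) (star (zElt q) ⊗ₜ[ℂ] 1) := by
  rw [← map_smul, rightRep_apply]
  refine isRightMul_transport fun f φ n k l => ?_
  refine (amp_apply fibN _ _ (k, l) n).trans ?_
  change _ * (zOp q _) n = _ * entry ((f : Op ℕ) * star (zOp q)) k n * _
  rcases n with _ | n
  · rw [zOp_apply_zero, entry_mul_star_zOp_zero]
    simp
  · rw [zOp_apply_succ, slice_fibN_apply, entry_mul_star_zOp_succ,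
      ← rpow_mul_inv_normConst q α n, one_mul]
    push_cast
    ring

theorem entry_mul_yOp (q : QParam) (T : Op ℕ) (i j : ℕ) :
    entry (T * yOp q) i j = (((q : ℝ) ^ j : ℝ) : ℂ) * entry T i j := by
  rw [entry, mul_apply_eq_comp, yOp, ofY, wshift_basisVec _ _ (bdd_pow q), map_smul]
  rfl

theorem isRightMul_yElt : IsRightMul q α (rightRep q α (yOp q)) (yElt q ⊗ₜ[ℂ] 1) := by
  rw [rightRep_apply]
  refine isRightMul_transport fun f φ n k l => ?_
  refine (amp_apply fibN _ _ (k, l) n).trans ?_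
  change _ = _ * entry ((f : Op ℕ) * yOp q) k n * _
  rw [yOp_apply, slice_fibN_apply, entry_mul_yOp, one_mul]
  ring

end Transport

/-! ### Right multiplication by `O(D_q)`. -/

section RightMultiplication

variable (q : QParam) (α : AParam)

/-- The algebra of elements of `F(D_q)` whose right multiplication is bounded. -/
def rightBdd : Subalgebra ℂ (discAlg q) where
  carrier := {x | ∃ T, IsRightMul q α T (x ⊗ₜ[ℂ] 1)}
  mul_mem' := by
    rintro x y ⟨T, hT⟩ ⟨S, hS⟩
    refine ⟨S * T, fun w => ?_⟩
    rw [mul_apply_eq_comp, hT, hS, mul_assoc, Algebra.TensorProduct.tmul_mul_tmul, one_mul]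
  add_mem' := by
    rintro x y ⟨T, hT⟩ ⟨S, hS⟩
    refine ⟨T + S, fun w => ?_⟩
    rw [_root_.add_apply, hT, hS, TensorProduct.add_tmul, mul_add, map_add]
  algebraMap_mem' c := by
    refine ⟨c • 1, fun w => ?_⟩
    rw [Algebra.algebraMap_eq_smul_one, ← TensorProduct.smul_tmul',
      ← Algebra.TensorProduct.one_def, mul_smul_comm, mul_one, map_smul]
    rfl

/-- As an algebra without involution, `O(D_q)` is generated by `z` and `z^*`. Right multiplication
does not respect the involution, so boundedness is needed for each of the two generators separately.
-/
theorem polyToDisc_mem_rightBdd (x : discPoly q) : polyToDisc x ∈ rightBdd q α := by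
  have h : (discPoly q).toSubalgebra ≤ (rightBdd q α).map (discAlg q).toSubalgebra.val := by
    rw [discPoly, StarAlgebra.adjoin_toSubalgebra]
    refine Algebra.adjoin_le ?_
    rintro T (hT | hT)
    · rw [Set.mem_singleton_iff] at hT
      subst hT
      exact ⟨zElt q, ⟨_, isRightMul_zElt⟩, rfl⟩
    · rw [Set.mem_star, Set.mem_singleton_iff] at hT
      obtain rfl : T = star (zOp q) := by rw [← hT, star_star]
      exact ⟨(star (zElt q) : discAlg q), ⟨_, isRightMul_star_zElt⟩, rfl⟩
  obtain ⟨y, hy, hyx⟩ := h x.2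
  have : y = polyToDisc x := Subtype.ext hyx
  exact this ▸ hy

/-- Right multiplication as a representation of the opposite algebra. -/
theorem exists_rightMul_algHom : ∃ R : (discPoly q)ᵐᵒᵖ →ₐ[ℂ] (Hilb q α →L[ℂ] Hilb q α),
    ∀ x : discPoly q, IsRightMul q α (R (MulOpposite.op x)) (polyToDisc x ⊗ₜ[ℂ] 1) := by
  -- A bounded extension is unique by density, so the chosen operators automatically satisfy the
  -- algebraic identities.
  choose R hR using polyToDisc_mem_rightBdd q α
  have hone : R 1 = 1 := (hR 1).unique fun w => by
    change toHilb q α w = toHilb q α (w * 1)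
    rw [mul_one]
  have hmul : ∀ x y, R (x * y) = R y * R x := fun x y => (hR (x * y)).unique fun w => by
    rw [mul_apply_eq_comp, hR, hR, mul_assoc, Algebra.TensorProduct.tmul_mul_tmul, one_mul]
    rfl
  have hadd : ∀ x y, R (x + y) = R x + R y := fun x y => (hR (x + y)).unique fun w => by
    rw [_root_.add_apply, hR, hR, ← map_add, ← mul_add, ← TensorProduct.add_tmul]
    rfl
  have hsmul : ∀ (c : ℂ) x, R (c • x) = c • R x := fun c x => (hR (c • x)).unique fun w => by
    rw [_root_.smul_apply, hR, ← map_smul, ← mul_smul_comm, TensorProduct.smul_tmul']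
    rfl
  refine ⟨AlgHom.ofLinearMap
    { toFun := fun a => R a.unop
      map_add' := fun a b => hadd _ _
      map_smul' := fun c a => hsmul c _ } hone fun a b => hmul _ _, hR⟩

end RightMultiplication

/-! ### Action of `z`, `z^*`, `y` on basis vectors. -/

theorem star_zOp_basisVec (q : QParam) (k : ℕ) : star (zOp q) (basisVec k) =
    ((√(1 - (q : ℝ) ^ (2 * k)) : ℝ) : ℂ) • basisVec (k - 1) := by
  rcases k with _ | k
  · ext i
    rw [star_zOp_apply, entry_basis]
    simp
  · exact (star_wshift_basisVec succEmb _ (bdd_sqrt q) k).trans (by rw [Complex.conj_ofReal]; rfl)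

theorem zOp_basisVec (q : QParam) (k : ℕ) : zOp q (basisVec k) =
    ((√(1 - (q : ℝ) ^ (2 * (k + 1))) : ℝ) : ℂ) • basisVec (k + 1) :=
  wshift_basisVec succEmb _ (bdd_sqrt q) k

theorem yOp_basisVec (q : QParam) (k : ℕ) :
    yOp q (basisVec k) = (((q : ℝ) ^ k : ℝ) : ℂ) • basisVec k :=
  wshift_basisVec _ _ (bdd_pow q) k

/-- The factorization of `y` through `√y` is preserved by `φ`, so `φ(y)` is positive and is the
square root of its square. Applies to both the left and the right action. -/
theorem map_yOp_eq_opSqrt {q : QParam} {E : Type} [NormedAddCommGroup E] [InnerProductSpace ℂ E]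
    [CompleteSpace E] (φ : Op ℕ →⋆ₐ[ℂ] (E →L[ℂ] E)) :
    φ (yOp q) = opSqrt (1 - φ (zOp q) * φ (star (zOp q))) := by
  refine (opSqrt_eq_of_mul_self (C := φ (sqrtY q)) ?_ ?_).symm
  · rw [← map_mul, yOp_mul_self, map_sub, map_one, map_mul]
  · rw [← map_star, ← map_mul, star_sqrtY_mul_self]

theorem star_yOp (q : QParam) : star (yOp q) = yOp q := by
  rw [← star_sqrtY_mul_self, star_mul, star_star]

/-! ### The generators `c`, `d` and their transposes. -/

section Generators

variable (q : QParam)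

theorem bdd_pow_fst : ∃ C : ℝ, ∀ p : ℕ × ℤ, ‖(((q : ℝ) ^ p.1 : ℝ) : ℂ)‖ ≤ C :=
  let ⟨C, hC⟩ := bdd_pow q
  ⟨C, fun p => hC p.1⟩

theorem bdd_sqrt_fst :
    ∃ C : ℝ, ∀ p : ℕ × ℤ, ‖((√(1 - (q : ℝ) ^ (2 * (p.1 + 1))) : ℝ) : ℂ)‖ ≤ C :=
  let ⟨C, hC⟩ := bdd_sqrt q
  ⟨C, fun p => hC p.1⟩

variable (x : Ell2 (ℕ × ℤ)) (k : ℕ) (l : ℤ)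

theorem cOp_apply : cOp q x (k, l) = (((q : ℝ) ^ k : ℝ) : ℂ) * x (k, l - 1) := by
  have h := wshift_apply_emb rightEmb _ (bdd_pow_fst q) x (k, l - 1)
  have h' : rightEmb (k, l - 1) = (k, l) := Prod.ext rfl (sub_add_cancel l 1)
  rwa [h'] at h

theorem star_cOp_apply :
    (star (cOp q) x) (k, l) = (((q : ℝ) ^ k : ℝ) : ℂ) * x (k, l + 1) := by
  rw [cOp, star_wshift_apply _ _ (bdd_pow_fst q), Complex.conj_ofReal]
  rfl

theorem dOp_apply_zero : dOp q x (0, l) = 0 :=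
  wshift_apply_notMem upEmb _ (bdd_sqrt_fst q) x (0, l) fun p h =>
    Nat.succ_ne_zero p.1 (congrArg Prod.fst h)

theorem dOp_apply_succ : dOp q x (k + 1, l) = zWeight q k * x (k, l) :=
  wshift_apply_emb upEmb _ (bdd_sqrt_fst q) x (k, l)

theorem star_dOp_apply : (star (dOp q) x) (k, l) = zWeight q k * x (k + 1, l) := by
  rw [dOp, star_wshift_apply _ _ (bdd_sqrt_fst q), Complex.conj_ofReal]
  rfl

theorem transp_cOp_apply :
    transp (MulOpposite.op (cOp q)) x (k, l) = (((q : ℝ) ^ k : ℝ) : ℂ) * x (k, l + 1) :=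
  transp_wshift_apply rightEmb _ (bdd_pow_fst q) x (k, l)

theorem transp_dOp_apply :
    transp (MulOpposite.op (dOp q)) x (k, l) = zWeight q k * x (k + 1, l) :=
  transp_wshift_apply upEmb _ (bdd_sqrt_fst q) x (k, l)

theorem star_transp_apply (a : Op (ℕ × ℤ)) :
    star (transp (MulOpposite.op a)) x = conjL (a (conjL x)) := by
  rw [← map_star, ← MulOpposite.op_star, transp_apply, star_star]

theorem star_transp_cOp_apply :
    (star (transp (MulOpposite.op (cOp q))) x) (k, l) =
      (((q : ℝ) ^ k : ℝ) : ℂ) * x (k, l - 1) := by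
  rw [star_transp_apply, conjL_apply, cOp_apply, conjL_apply, map_mul, Complex.conj_ofReal,
    Complex.conj_conj]

theorem star_transp_dOp_apply_zero :
    (star (transp (MulOpposite.op (dOp q))) x) (0, l) = 0 := by
  rw [star_transp_apply, conjL_apply, dOp_apply_zero, map_zero]

theorem star_transp_dOp_apply_succ :
    (star (transp (MulOpposite.op (dOp q))) x) (k + 1, l) = zWeight q k * x (k, l) := by
  rw [star_transp_apply, conjL_apply, dOp_apply_succ, conjL_apply, map_mul, conj_zWeight,
    Complex.conj_conj]

theorem cOp_basisVec :
    cOp q (basisVec (k, l)) = (((q : ℝ) ^ k : ℝ) : ℂ) • basisVec (k, l + 1) :=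
  wshift_basisVec rightEmb _ (bdd_pow_fst q) (k, l)

theorem dOp_basisVec : dOp q (basisVec (k, l)) =
    ((√(1 - (q : ℝ) ^ (2 * (k + 1))) : ℝ) : ℂ) • basisVec (k + 1, l) :=
  wshift_basisVec upEmb _ (bdd_sqrt_fst q) (k, l)

theorem transp_cOp_basisVec : transp (MulOpposite.op (cOp q)) (basisVec (k, l)) =
    (((q : ℝ) ^ k : ℝ) : ℂ) • basisVec (k, l - 1) := by
  ext ⟨k', l'⟩
  rw [transp_cOp_apply]
  change _ = _ * (basisVec (k, l - 1) : Ell2 (ℕ × ℤ)) (k', l')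
  rw [basisVec_apply, basisVec_apply]
  simp only [Prod.mk.injEq, eq_sub_iff_add_eq]
  split_ifs with h
  · rw [h.1]
  · simp

theorem transp_dOp_basisVec : transp (MulOpposite.op (dOp q)) (basisVec (k, l)) =
    ((√(1 - (q : ℝ) ^ (2 * k)) : ℝ) : ℂ) • basisVec (k - 1, l) := by
  ext ⟨k', l'⟩
  rw [transp_dOp_apply]
  change _ = _ * (basisVec (k - 1, l) : Ell2 (ℕ × ℤ)) (k', l')
  rw [basisVec_apply, basisVec_apply]
  rcases k with _ | k
  · simp
  · simp only [Prod.mk.injEq, add_left_inj, Nat.add_sub_cancel]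
    split_ifs with h
    · rw [h.1]
      rfl
    · simp

theorem SUqRel_cOp_dOp : SUqRel q (cOp q) (dOp q) := by
  have hc : ∀ x k l, cOp q x (k, l) = (((q : ℝ) ^ k : ℝ) : ℂ) * x (k, l - 1) := cOp_apply q
  have hcs := star_cOp_apply q
  have hd0 := dOp_apply_zero q
  have hd := dOp_apply_succ q
  have hds := star_dOp_apply q
  have hw : ∀ k, zWeight q k * zWeight q k = 1 - ((q : ℝ) : ℂ) ^ (2 * (k + 1)) := fun k => by
    rw [zWeight_mul_self]
    push_cast
    ring
  refine ⟨?_, ?_, ?_, ?_, ?_⟩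
  · ext x ⟨k, l⟩
    change (cOp q * dOp q) x (k, l) = _ * (dOp q * cOp q) x (k, l)
    simp only [mul_apply_eq_comp, hc]
    rcases k with _ | k
    · simp only [hd0, mul_zero]
    · simp only [hd, hc]
      push_cast
      ring
  · ext x ⟨k, l⟩
    change (star (cOp q) * dOp q) x (k, l) = _ * (dOp q * star (cOp q)) x (k, l)
    simp only [mul_apply_eq_comp, hcs]
    rcases k with _ | k
    · simp only [hd0, mul_zero]
    · simp only [hd, hcs]
      push_cast
      ring
  · ext x ⟨k, l⟩
    simp only [mul_apply_eq_comp, hcs, hc, sub_add_cancel, add_sub_cancel_right]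
  · ext x ⟨k, l⟩
    change (star (dOp q) * dOp q) x (k, l) + _ * (cOp q * star (cOp q)) x (k, l) = x (k, l)
    simp only [mul_apply_eq_comp, hcs, hc, hds, hd, sub_add_cancel]
    push_cast
    linear_combination hw k * x (k, l)
  · ext x ⟨k, l⟩
    change (dOp q * star (dOp q)) x (k, l) + (cOp q * star (cOp q)) x (k, l) = x (k, l)
    simp only [mul_apply_eq_comp, hcs, hc, sub_add_cancel]
    rcases k with _ | k
    · simp [hd0]
    · simp only [hd, hds]
      push_cast
      linear_combination hw k * x (k + 1, l)

theorem SUqRel_gen : SUqRel q (cGen q) (dGen q) := by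
  obtain ⟨h1, h2, h3, h4, h5⟩ := SUqRel_cOp_dOp q
  exact ⟨Subtype.ext h1, Subtype.ext h2, Subtype.ext h3, Subtype.ext h4, Subtype.ext h5⟩

end Generators

theorem SUqRel.map {q : QParam} {A B : Type} [Ring A] [StarRing A] [Algebra ℂ A] [Ring B]
    [StarRing B] [Algebra ℂ B] {c d : A} (h : SUqRel q c d) (φ : A →⋆ₐ[ℂ] B) :
    SUqRel q (φ c) (φ d) := by
  obtain ⟨h1, h2, h3, h4, h5⟩ := h
  refine ⟨?_, ?_, ?_, ?_, ?_⟩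
  · rw [← map_mul, h1, map_smul, map_mul]
  · rw [← map_star, ← map_mul, h2, map_smul, map_mul]
  · rw [← map_star, ← map_mul, h3, map_mul]
  · rw [← map_star φ d, ← map_star φ c, ← map_mul, ← map_mul, ← map_smul, ← map_add, h4, map_one]
  · rw [← map_star, ← map_star, ← map_mul, ← map_mul, ← map_add, h5, map_one]

/-- A `*`-homomorphism from an opposite algebra as a `*`-homomorphism into an opposite algebra. -/
def opHom {A B : Type} [Ring A] [StarRing A] [Algebra ℂ A] [Ring B] [StarRing B] [Algebra ℂ B]
    (ρ : Aᵐᵒᵖ →⋆ₐ[ℂ] B) : A →⋆ₐ[ℂ] Bᵐᵒᵖ where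
  toFun a := MulOpposite.op (ρ (MulOpposite.op a))
  map_one' := by rw [MulOpposite.op_one, map_one, MulOpposite.op_one]
  map_mul' a b := by rw [MulOpposite.op_mul, map_mul, MulOpposite.op_mul]
  map_zero' := by rw [MulOpposite.op_zero, map_zero, MulOpposite.op_zero]
  map_add' a b := by rw [MulOpposite.op_add, map_add, MulOpposite.op_add]
  commutes' c := by
    change MulOpposite.op (ρ (algebraMap ℂ Aᵐᵒᵖ c)) = _
    rw [AlgHomClass.commutes]
    rfl
  map_star' a := by rw [MulOpposite.op_star, map_star, MulOpposite.op_star]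

/-- Transposition turns a `*`-homomorphism from an opposite algebra into operators on `ℓ²` into a
`*`-homomorphism. -/
def transpHom {A I : Type} [Ring A] [StarRing A] [Algebra ℂ A] (ρ : Aᵐᵒᵖ →⋆ₐ[ℂ] Op I) :
    A →⋆ₐ[ℂ] Op I := transp.comp (opHom ρ)

/-! ### The representations of `C(SU_q(2))` and `C(SU_q(2))^op`. -/

section Representations

variable (q : QParam) (α : AParam)

/-- The representation of `C(SU_q(2))`. -/
def chartRep : CSU q →⋆ₐ[ℂ] (Hilb q α →L[ℂ] Hilb q α) :=
  (((transport q α : Op Idx ≃⋆ₐ[ℂ] _) : Op Idx →⋆ₐ[ℂ] _).comp (amp fibKL)).comp (CSU q).subtype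

/-- Transposition on `C(SU_q(2))`. -/
def transpCSU : (CSU q)ᵐᵒᵖ →⋆ₐ[ℂ] Op (ℕ × ℤ) where
  toFun a := transp (MulOpposite.op (a.unop : Op (ℕ × ℤ)))
  map_one' := map_one transp
  map_mul' a b := map_mul transp (MulOpposite.op (a.unop : Op (ℕ × ℤ))) (MulOpposite.op b.unop)
  map_zero' := map_zero transp
  map_add' a b := map_add transp (MulOpposite.op (a.unop : Op (ℕ × ℤ))) (MulOpposite.op b.unop)
  commutes' c := AlgHomClass.commutes transp c
  map_star' a := map_star transp (MulOpposite.op (a.unop : Op (ℕ × ℤ)))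

/-- The representation of `C(SU_q(2))^op`. -/
def chartRepOp : (CSU q)ᵐᵒᵖ →⋆ₐ[ℂ] (Hilb q α →L[ℂ] Hilb q α) :=
  (((transport q α : Op Idx ≃⋆ₐ[ℂ] _) : Op Idx →⋆ₐ[ℂ] _).comp (amp fibNL)).comp (transpCSU q)

variable {q α}

theorem chartRep_apply (a : CSU q) :
    chartRep q α a = transport q α (amp fibKL (a : Op (ℕ × ℤ))) := rfl

theorem chartRepOp_apply (a : CSU q) : chartRepOp q α (MulOpposite.op a) =
    transport q α (amp fibNL (transp (MulOpposite.op (a : Op (ℕ × ℤ))))) := rfl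

theorem chartRep_hilbBasis {a : CSU q} {k k' : ℕ} {l l' : ℤ} {c : ℂ}
    (h : (a : Op (ℕ × ℤ)) (basisVec (k, l)) = c • basisVec (k', l')) (n : ℕ) :
    chartRep q α a (hilbBasis q α (n, k, l)) = c • hilbBasis q α (n, k', l') :=
  transport_hilbBasis (amp_basisVec fibKL h n)

theorem chartRepOp_hilbBasis {a : CSU q} {n n' : ℕ} {l l' : ℤ} {c : ℂ}
    (h : transp (MulOpposite.op (a : Op (ℕ × ℤ))) (basisVec (n, l)) = c • basisVec (n', l'))
    (k : ℕ) :
    chartRepOp q α (MulOpposite.op a) (hilbBasis q α (n, k, l)) = c • hilbBasis q α (n', k, l') :=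
  transport_hilbBasis (amp_basisVec fibNL h k)

theorem slice_fibKL_apply (f : discAlg q) (φ : Linf) (n k : ℕ) (l : ℤ) :
    slice fibKL n ((hilbBasis q α).repr (toHilb q α (f ⊗ₜ φ))) (k, l) =
      (((normConst q α n)⁻¹ : ℝ) : ℂ) * entry (f : Op ℕ) k n * circInner (circBasis l) φ :=
  hilbBasis_repr_tmul q α n k l f φ

theorem slice_fibNL_apply (f : discAlg q) (φ : Linf) (n k : ℕ) (l : ℤ) :
    slice fibNL k ((hilbBasis q α).repr (toHilb q α (f ⊗ₜ φ))) (n, l) =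
      (((normConst q α n)⁻¹ : ℝ) : ℂ) * entry (f : Op ℕ) k n * circInner (circBasis l) φ :=
  hilbBasis_repr_tmul q α n k l f φ

theorem entry_yOp_mul (q : QParam) (T : Op ℕ) (i j : ℕ) :
    entry (yOp q * T) i j = (((q : ℝ) ^ i : ℝ) : ℂ) * entry T i j := yOp_apply q _ i

theorem isChartRep_chartRep : IsChartRep q α (chartRep q α) := by
  constructor
  · rw [chartRep_apply]
    refine isLeftMul_transport fun f φ n k l => ?_
    refine (amp_apply fibKL _ _ n (k, l)).trans ?_
    have h := circInner_circBasis_uElt_mul (l - 1) φ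
    rw [sub_add_cancel] at h
    change cOp q _ (k, l) = _ * entry (yOp q * (f : Op ℕ)) k n * _
    rw [cOp_apply, slice_fibKL_apply, entry_yOp_mul, h]
    ring
  · rw [chartRep_apply]
    refine isLeftMul_transport fun f φ n k l => ?_
    refine (amp_apply fibKL _ _ n (k, l)).trans ?_
    change dOp q _ (k, l) = _ * entry (zOp q * (f : Op ℕ)) k n * _
    rcases k with _ | k
    · rw [dOp_apply_zero, entry_zOp_mul_zero]
      simp
    · rw [dOp_apply_succ, slice_fibKL_apply, entry_zOp_mul_succ, one_mul]
      ring

theorem isChartRepOp_chartRepOp : IsChartRepOp q α (chartRepOp q α) := by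
  constructor
  · rw [chartRepOp_apply]
    refine isRightMul_transport fun f φ n k l => ?_
    refine (amp_apply fibNL _ _ k (n, l)).trans ?_
    change transp (MulOpposite.op (cOp q)) _ (n, l) = _ * entry ((f : Op ℕ) * yOp q) k n * _
    rw [transp_cOp_apply, slice_fibNL_apply, entry_mul_yOp, circInner_circBasis_star_uElt_mul]
    ring
  · rw [chartRepOp_apply, TensorProduct.smul_tmul']
    refine isRightMul_transport fun f φ n k l => ?_
    refine (amp_apply fibNL _ _ k (n, l)).trans ?_
    change transp (MulOpposite.op (dOp q)) _ (n, l) = _ * entry ((f : Op ℕ) *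
      ((((q : ℝ) ^ ((α : ℝ) / 2) : ℝ) : ℂ) • zOp q)) k n * _
    -- The factor `q^{α/2}` of `d^op` turns `N_n⁻¹` into `N_{n+1}⁻¹`, so that the operator on
    -- coordinates is the transpose of `d`, without `α`.
    rw [transp_dOp_apply, slice_fibNL_apply, mul_smul_comm, entry_smul, entry_mul_zOp, one_mul,
      ← rpow_mul_inv_normConst q α n]
    push_cast
    ring

end Representations

/-! ### Commutation of the two representations. -/

section Commutation

theorem transp_amp {I J K : Type} (e : J × I ≃ K) (a : Op I) :
    transp (MulOpposite.op (amp e a)) = amp e (transp (MulOpposite.op a)) := by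
  ext1 x
  refine ext_slice (e := e) fun j => ?_
  have h : ∀ y : Ell2 K, slice e j (conjL y) = conjL (slice e j y) := fun y => rfl
  rw [transp_apply, h, ← map_star]
  refine (congrArg conjL (slice_ampOp e (star a) (conjL x) j)).trans ?_
  rw [h]
  exact (slice_ampOp e (transp (MulOpposite.op a)) x j).symm

open scoped CStarAlgebra in
/-- If the image of the generators of `C(SU_q(2))` commutes with `b` and `b^*`, so does the image
of the whole algebra. -/
theorem CSU_commute {q : QParam} {K : Type} (φ : Op (ℕ × ℤ) →⋆ₐ[ℂ] Op K) {b : Op K}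
    (hc : Commute b (φ (cOp q))) (hc' : Commute (star b) (φ (cOp q)))
    (hd : Commute b (φ (dOp q))) (hd' : Commute (star b) (φ (dOp q))) (a : CSU q) :
    Commute b (φ a) ∧ Commute (star b) (φ a) := by
  have hcont : Continuous φ := map_continuous φ
  -- The elements whose image commutes with `b` and `b^*` form a norm closed `*`-subalgebra, so the
  -- generators suffice.
  have h : CSU q ≤ (StarSubalgebra.centralizer ℂ {b}).comap φ := by
    refine StarSubalgebra.topologicalClosure_minimal (StarAlgebra.adjoin_le ?_) ?_
    · rintro x (rfl | rfl)
      · exact (StarSubalgebra.mem_centralizer_iff ℂ).mpr (by rintro _ rfl; exact ⟨hc, hc'⟩)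
      · exact (StarSubalgebra.mem_centralizer_iff ℂ).mpr (by rintro _ rfl; exact ⟨hd, hd'⟩)
    · exact (Set.isClosed_centralizer _).preimage hcont
  exact (StarSubalgebra.mem_centralizer_iff ℂ).mp (h a.2) b rfl

theorem amp_fibKL_apply (a : Op (ℕ × ℤ)) (v : Ell2 Idx) (n k : ℕ) (l : ℤ) :
    amp fibKL a v (n, k, l) = a (slice fibKL n v) (k, l) := amp_apply fibKL a v n (k, l)

theorem amp_fibNL_apply (a : Op (ℕ × ℤ)) (v : Ell2 Idx) (n k : ℕ) (l : ℤ) :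
    amp fibNL a v (n, k, l) = a (slice fibNL k v) (n, l) := amp_apply fibNL a v k (n, l)

theorem slice_fibKL (v : Ell2 Idx) (n k : ℕ) (l : ℤ) :
    slice fibKL n v (k, l) = v (n, k, l) := rfl

theorem slice_fibNL (v : Ell2 Idx) (n k : ℕ) (l : ℤ) :
    slice fibNL k v (n, l) = v (n, k, l) := rfl

theorem commute_of_apply {S T : Op Idx}
    (h : ∀ v n k l, S (T v) (n, k, l) = T (S v) (n, k, l)) : Commute S T := by
  ext v ⟨n, k, l⟩
  exact h v n k l

/-- The two actions share only the index `l`, on which they act by translations of `ℤ`, with weights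
depending on `k` for the left action and on `n` for the right one. The case split on `n` and `k`
treats the boundary of the one-sided shifts. -/
theorem commute_generators (q : QParam) (a b : Op (ℕ × ℤ)) (ha : a = cOp q ∨ a = dOp q)
    (hb : b = cOp q ∨ b = dOp q) :
    Commute (amp fibNL (transp (MulOpposite.op b))) (amp fibKL a) ∧
      Commute (amp fibNL (star (transp (MulOpposite.op b)))) (amp fibKL a) := by
  have h1 := cOp_apply q
  have h2 := dOp_apply_zero q
  have h3 := dOp_apply_succ q
  have h4 := transp_cOp_apply q
  have h5 := transp_dOp_apply q
  have h6 := star_transp_cOp_apply q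
  have h7 := star_transp_dOp_apply_zero q
  have h8 := star_transp_dOp_apply_succ q
  rcases ha with rfl | rfl <;> rcases hb with rfl | rfl <;> constructor <;>
    refine commute_of_apply fun v n k l => ?_ <;> rcases n with _ | n <;>
    rcases k with _ | k <;>
    simp only [amp_fibKL_apply, amp_fibNL_apply, slice_fibKL, slice_fibNL, h1, h2, h3, h4, h5, h6,
      h7, h8, mul_zero, sub_add_cancel, add_sub_cancel_right] <;> ring

/-- The closure argument is used twice: first in `a` with `b` a generator, then in `b` with `a`
arbitrary. Transposing in between exchanges the roles, so that `b` too enters through a homomorphism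
of the algebra itself and not of its opposite. -/
theorem commute_chartReps (q : QParam) (α : AParam) (a : CSU q) (b : (CSU q)ᵐᵒᵖ) :
    chartRep q α a * chartRepOp q α b = chartRepOp q α b * chartRep q α a := by
  have hflip : ∀ S T : Op Idx, Commute S T →
      Commute (transp (MulOpposite.op S)) (transp (MulOpposite.op T)) := by
    intro S T h
    rw [Commute, SemiconjBy, ← map_mul, ← map_mul, ← MulOpposite.op_mul, ← MulOpposite.op_mul,
      h.eq]
  have hgen : ∀ b : Op (ℕ × ℤ), b = cOp q ∨ b = dOp q → ∀ a : CSU q,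
      Commute (amp fibNL (transp (MulOpposite.op b))) (amp fibKL (a : Op (ℕ × ℤ))) ∧
      Commute (star (amp fibNL (transp (MulOpposite.op b)))) (amp fibKL (a : Op (ℕ × ℤ))) := by
    intro b hb a
    refine CSU_commute (amp fibKL) ?_ ?_ ?_ ?_ a
    · exact (commute_generators q _ b (Or.inl rfl) hb).1
    · rw [← map_star]
      exact (commute_generators q _ b (Or.inl rfl) hb).2
    · exact (commute_generators q _ b (Or.inr rfl) hb).1
    · rw [← map_star]
      exact (commute_generators q _ b (Or.inr rfl) hb).2
  have key : Commute (transp (MulOpposite.op (amp fibKL (a : Op (ℕ × ℤ)))))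
      (amp fibNL (b.unop : Op (ℕ × ℤ))) := by
    have hgen' : ∀ b : Op (ℕ × ℤ), b = cOp q ∨ b = dOp q → ∀ a : CSU q,
        Commute (transp (MulOpposite.op (amp fibKL (a : Op (ℕ × ℤ))))) (amp fibNL b) := by
      intro b hb a
      have h := hflip _ _ (hgen b hb a).1.symm
      rwa [transp_amp fibNL, transp_transp] at h
    have hstar : star (transp (MulOpposite.op (amp fibKL (a : Op (ℕ × ℤ))))) =
        transp (MulOpposite.op (amp fibKL ((star a : CSU q) : Op (ℕ × ℤ)))) := by
      rw [← map_star, ← MulOpposite.op_star, ← map_star]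
      rfl
    refine (CSU_commute (amp fibNL) (hgen' _ (Or.inl rfl) a) ?_ (hgen' _ (Or.inr rfl) a) ?_
      b.unop).1
    · rw [hstar]
      exact hgen' _ (Or.inl rfl) _
    · rw [hstar]
      exact hgen' _ (Or.inr rfl) _
  have h := hflip _ _ key
  rw [transp_transp, transp_amp] at h
  have h2 := congrArg (transport q α) h.eq
  rw [map_mul, map_mul] at h2
  exact h2

end Commutation

/-! ### Uniqueness of the representations. -/

section Uniqueness

/-- Closedness makes the subalgebra a C*-algebra, on which `*`-homomorphisms are automatically
continuous. -/
instance (q : QParam) : IsClosed (CSU q : Set (Op (ℕ × ℤ))) :=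
  StarSubalgebra.isClosed_topologicalClosure _

-- Agreement on `c` and `d` propagates to the `*`-algebra they generate, and by automatic continuity
-- to its closure.
open scoped CStarAlgebra in
theorem CSU_hom_ext {q : QParam} {E : Type} [NormedAddCommGroup E] [InnerProductSpace ℂ E]
    [CompleteSpace E] {φ ψ : CSU q →⋆ₐ[ℂ] (E →L[ℂ] E)} (hc : φ (cGen q) = ψ (cGen q))
    (hd : φ (dGen q) = ψ (dGen q)) : φ = ψ := by
  have hφ : Continuous φ := map_continuous φ
  have hψ : Continuous ψ := map_continuous ψ
  let i : StarAlgebra.adjoin ℂ {cOp q, dOp q} → CSU q :=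
    StarSubalgebra.inclusion (StarSubalgebra.le_topologicalClosure _)
  refine StarAlgHomClass.ext_topologicalClosure
    (S := StarAlgebra.adjoin ℂ {cOp q, dOp q}) hφ hψ fun x => ?_
  induction x using StarAlgebra.adjoin_induction_subtype with
  | mem x hx =>
    rcases hx with rfl | rfl
    · exact hc
    · exact hd
  | algebraMap r => exact (AlgHomClass.commutes φ r).trans (AlgHomClass.commutes ψ r).symm
  | add x y hx hy =>
    exact (map_add φ (i x) (i y)).trans
      ((congrArg₂ (· + ·) hx hy).trans (map_add ψ (i x) (i y)).symm)
  | mul x y hx hy =>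
    exact (map_mul φ (i x) (i y)).trans
      ((congrArg₂ (· * ·) hx hy).trans (map_mul ψ (i x) (i y)).symm)
  | star x hx =>
    exact (map_star φ (i x)).trans ((congrArg star hx).trans (map_star ψ (i x)).symm)

theorem IsChartRep.unique {q : QParam} {α : AParam}
    {π π' : CSU q →⋆ₐ[ℂ] (Hilb q α →L[ℂ] Hilb q α)} (h : IsChartRep q α π)
    (h' : IsChartRep q α π') : π = π' :=
  CSU_hom_ext (h.1.unique h'.1) (h.2.unique h'.2)

/-- Transposition converts both maps into `*`-homomorphisms of `C(SU_q(2))` itself, where agreement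
on the generators is enough. -/
theorem IsChartRepOp.unique {q : QParam} {α : AParam}
    {ρ ρ' : (CSU q)ᵐᵒᵖ →⋆ₐ[ℂ] (Hilb q α →L[ℂ] Hilb q α)} (h : IsChartRepOp q α ρ)
    (h' : IsChartRepOp q α ρ') : ρ = ρ' := by
  let τ : (Hilb q α →L[ℂ] Hilb q α) →⋆ₐ[ℂ] Op Idx :=
    ((transport q α).symm : (Hilb q α →L[ℂ] Hilb q α) →⋆ₐ[ℂ] Op Idx)
  have hext : transpHom (τ.comp ρ) = transpHom (τ.comp ρ') := by
    apply CSU_hom_ext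
    · exact congrArg (fun T => transp (MulOpposite.op (τ T))) (h.1.unique h'.1)
    · exact congrArg (fun T => transp (MulOpposite.op (τ T))) (h.2.unique h'.2)
  ext1 b
  have hb : transp (MulOpposite.op (τ (ρ b))) = transp (MulOpposite.op (τ (ρ' b))) :=
    DFunLike.congr_fun hext b.unop
  have hb' := congrArg (fun T => transp (MulOpposite.op T)) hb
  simp only [transp_transp] at hb'
  exact (transport q α).symm.injective hb'

end Uniqueness

/-! ### Comparison of the parameters `α` and `β`. -/

section BasisChange

variable (q : QParam) (α β : AParam)

/-- The unitary operator between the completions for `α` and `β` that maps `e_{nkl}` to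
`e_{nkl}`. -/
def basisChange : Hilb q α ≃ₗᵢ[ℂ] Hilb q β :=
  (hilbBasis q α).repr.trans (hilbBasis q β).repr.symm

theorem basisChange_hilbBasis (i : Idx) :
    basisChange q α β (hilbBasis q α i) = hilbBasis q β i := by
  apply (hilbBasis q β).repr.injective
  rw [repr_hilbBasis, ← repr_hilbBasis q α]
  exact (hilbBasis q β).repr.apply_symm_apply _

theorem basisChange_toHilb (n k : ℕ) (l : ℤ) :
    basisChange q α β (toHilb q α (basisFn q α n k l)) = toHilb q β (basisFn q β n k l) := by
  rw [← hilbBasis_apply, ← hilbBasis_apply, basisChange_hilbBasis]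

/-- In coordinates the change of basis is the identity. Since both representations are transports of
operators on `ℓ²(Idx)` that do not involve `α`, this is their independence of `α`. -/
theorem basisChange_transport (T : Op Idx) (v : Hilb q α) :
    basisChange q α β (transport q α T v) = transport q β T (basisChange q α β v) := by
  apply (hilbBasis q β).repr.injective
  have h : ∀ w, (hilbBasis q β).repr (basisChange q α β w) = (hilbBasis q α).repr w :=
    fun w => (hilbBasis q β).repr.apply_symm_apply _
  rw [repr_transport, h, h, repr_transport]

theorem basisChange_chartRep {π : CSU q →⋆ₐ[ℂ] (Hilb q β →L[ℂ] Hilb q β)}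
    (h : IsChartRep q β π) (a : CSU q) (v : Hilb q α) :
    basisChange q α β (chartRep q α a v) = π a (basisChange q α β v) := by
  rw [h.unique (isChartRep_chartRep), chartRep_apply, chartRep_apply, basisChange_transport]

theorem basisChange_chartRepOp {ρ : (CSU q)ᵐᵒᵖ →⋆ₐ[ℂ] (Hilb q β →L[ℂ] Hilb q β)}
    (h : IsChartRepOp q β ρ) (b : (CSU q)ᵐᵒᵖ) (v : Hilb q α) :
    basisChange q α β (chartRepOp q α b v) = ρ b (basisChange q α β v) := by
  rw [h.unique (isChartRepOp_chartRepOp)]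
  exact basisChange_transport q α β _ v

variable {q α β}

/-- Combinations of two basis functions whose second coefficients differ are not matched by the
change of basis. -/
theorem basisChange_ne {n k n' k' : ℕ} {l : ℤ} {c a x y : ℂ} (hc : c ≠ 0) (hxy : x ≠ y) :
    basisChange q α β (toHilb q α (c • (a • basisFn q α n k l - x • basisFn q α n' k' l))) ≠
      toHilb q β (c • (a • basisFn q β n k l - y • basisFn q β n' k' l)) := by
  intro h
  simp only [map_smul, map_sub, ← hilbBasis_apply, basisChange_hilbBasis] at h
  have h2 := sub_right_inj.mp (smul_right_injective _ hc h)
  exact hxy (smul_left_injective ℂ ((hilbBasis q β).orthonormal.ne_zero _) h2)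

theorem rpow_mul_sqrt_ne {x y : ℝ} (hxy : x ≠ y) :
    (((q : ℝ) ^ x * √(1 - (q : ℝ) ^ (2 * 1)) : ℝ) : ℂ) ≠
      (((q : ℝ) ^ y * √(1 - (q : ℝ) ^ (2 * 1)) : ℝ) : ℂ) := by
  have hs : √(1 - (q : ℝ) ^ (2 * 1)) ≠ 0 :=
    (Real.sqrt_pos.mpr (sub_pos.mpr (pow_lt_one₀ q.2.1.le q.2.2 (by norm_num)))).ne'
  rw [Ne, Complex.ofReal_inj, mul_left_inj' hs, Real.rpow_right_inj q.2.1 q.2.2.ne]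
  exact hxy

end BasisChange

/-! ### Properties of the right representation of `O(D_q)`. -/

section RightRepresentation

variable {q : QParam} {α : AParam} {R : (discPoly q)ᵐᵒᵖ →ₐ[ℂ] (Hilb q α →L[ℂ] Hilb q α)}
  (hR : ∀ x : discPoly q, IsRightMul q α (R (MulOpposite.op x)) (polyToDisc x ⊗ₜ[ℂ] 1))

include hR

theorem rightMul_zGen : R (MulOpposite.op (zGen q)) =
    (((q : ℝ) ^ (-((α : ℝ) / 2)) : ℝ) : ℂ) • rightRep q α (star (zOp q)) :=
  (hR (zGen q)).unique isRightMul_zElt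

theorem rightMul_star_zGen : R (MulOpposite.op (star (zGen q))) =
    (((q : ℝ) ^ ((α : ℝ) / 2) : ℝ) : ℂ) • rightRep q α (zOp q) :=
  (hR (star (zGen q))).unique isRightMul_star_zElt

theorem rightMul_star_zGen_eq : R (MulOpposite.op (star (zGen q))) =
    (((q : ℝ) ^ (α : ℝ) : ℝ) : ℂ) • star (R (MulOpposite.op (zGen q))) := by
  rw [rightMul_zGen hR, rightMul_star_zGen hR, star_smul, ← map_star, star_star, smul_smul,
    ← starRingEnd_apply, Complex.conj_ofReal, ← Complex.ofReal_mul, ← Real.rpow_add q.2.1]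
  congr 4
  ring

theorem rightMul_zGen_hilbBasis (n k : ℕ) (l : ℤ) :
    R (MulOpposite.op (zGen q)) (hilbBasis q α (n, k, l)) =
      (((q : ℝ) ^ (-((α : ℝ) / 2)) * √(1 - (q : ℝ) ^ (2 * n)) : ℝ) : ℂ) •
        hilbBasis q α (n - 1, k, l) := by
  rw [rightMul_zGen hR, _root_.smul_apply, rightRep_hilbBasis (star_zOp_basisVec q n), smul_smul,
    Complex.ofReal_mul]

theorem rightMul_star_zGen_hilbBasis (n k : ℕ) (l : ℤ) :
    R (MulOpposite.op (star (zGen q))) (hilbBasis q α (n, k, l)) =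
      (((q : ℝ) ^ ((α : ℝ) / 2) * √(1 - (q : ℝ) ^ (2 * (n + 1))) : ℝ) : ℂ) •
        hilbBasis q α (n + 1, k, l) := by
  rw [rightMul_star_zGen hR, _root_.smul_apply, rightRep_hilbBasis (zOp_basisVec q n), smul_smul,
    Complex.ofReal_mul]

/-- Otherwise `z^{*op} = q^α z^{*op}` with `q^α < 1`, although `z^{*op}` does not vanish on
`e_{000}`. -/
theorem rightMul_not_star : ¬ ∀ x, R (star x) = star (R x) := by
  intro h
  have h1 : R (MulOpposite.op (star (zGen q))) = star (R (MulOpposite.op (zGen q))) :=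
    h (MulOpposite.op (zGen q))
  have h2 := rightMul_star_zGen_eq hR
  rw [← h1] at h2
  have h3 := congrArg (fun T => T (hilbBasis q α (0, 0, 0))) h2
  simp only [_root_.smul_apply, rightMul_star_zGen_hilbBasis hR] at h3
  have hb : hilbBasis q α (0 + 1, 0, 0) ≠ 0 := (hilbBasis q α).orthonormal.ne_zero _
  rw [smul_smul] at h3
  have h4 := smul_left_injective ℂ hb h3
  simp only [← Complex.ofReal_mul, Complex.ofReal_inj] at h4
  have hs : 0 < √(1 - (q : ℝ) ^ (2 * (0 + 1))) :=
    Real.sqrt_pos.mpr (sub_pos.mpr (pow_lt_one₀ q.2.1.le q.2.2 (by norm_num)))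
  have hp := mul_pos (Real.rpow_pos_of_pos q.2.1 ((α : ℝ) / 2)) hs
  have h5 : (q : ℝ) ^ (α : ℝ) < 1 := Real.rpow_lt_one q.2.1.le q.2.2 α.2
  nlinarith

/-- The factors `q^{α/2}` and `q^{-α/2}` cancel in `z^{*op} z^{op}`, leaving the image of `z z^*`
under a genuine `*`-homomorphism. -/
theorem rightRep_yOp_eq_opSqrt : rightRep q α (yOp q) =
    opSqrt (1 - R (MulOpposite.op (star (zGen q))) * R (MulOpposite.op (zGen q))) := by
  rw [map_yOp_eq_opSqrt, rightMul_zGen hR, rightMul_star_zGen hR, smul_mul_smul_comm,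
    ← Complex.ofReal_mul, ← Real.rpow_add q.2.1, add_neg_cancel, Real.rpow_zero,
    Complex.ofReal_one, one_smul]

end RightRepresentation

/-! ### Relations, basis formulas and the assembly of the theorem. -/

section Relations

variable {q : QParam} {E : Type} [NormedAddCommGroup E] [InnerProductSpace ℂ E] [CompleteSpace E]

theorem SUqRel_map (π : CSU q →⋆ₐ[ℂ] (E →L[ℂ] E)) : SUqRel q (π (cGen q)) (π (dGen q)) :=
  (SUqRel_gen q).map π

theorem SUqRel_op_map (ρ : (CSU q)ᵐᵒᵖ →⋆ₐ[ℂ] (E →L[ℂ] E)) :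
    SUqRel q (MulOpposite.op (ρ (MulOpposite.op (cGen q))))
      (MulOpposite.op (ρ (MulOpposite.op (dGen q)))) :=
  (SUqRel_gen q).map (opHom ρ)

end Relations

section BasisFormulas

variable (q : QParam) (α : AParam) (n k : ℕ) (l : ℤ)

theorem chartRep_cGen_hilbBasis : chartRep q α (cGen q) (hilbBasis q α (n, k, l)) =
    (((q : ℝ) ^ k : ℝ) : ℂ) • hilbBasis q α (n, k, l + 1) :=
  chartRep_hilbBasis (a := cGen q) (cOp_basisVec q k l) n

theorem chartRep_dGen_hilbBasis : chartRep q α (dGen q) (hilbBasis q α (n, k, l)) =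
    ((√(1 - (q : ℝ) ^ (2 * (k + 1))) : ℝ) : ℂ) • hilbBasis q α (n, k + 1, l) :=
  chartRep_hilbBasis (a := dGen q) (dOp_basisVec q k l) n

theorem chartRepOp_cGen_hilbBasis :
    chartRepOp q α (MulOpposite.op (cGen q)) (hilbBasis q α (n, k, l)) =
      (((q : ℝ) ^ n : ℝ) : ℂ) • hilbBasis q α (n, k, l - 1) :=
  chartRepOp_hilbBasis (a := cGen q) (transp_cOp_basisVec q n l) k

theorem chartRepOp_dGen_hilbBasis :
    chartRepOp q α (MulOpposite.op (dGen q)) (hilbBasis q α (n, k, l)) =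
      ((√(1 - (q : ℝ) ^ (2 * n)) : ℝ) : ℂ) • hilbBasis q α (n - 1, k, l) :=
  chartRepOp_hilbBasis (a := dGen q) (transp_dOp_basisVec q n l) k

end BasisFormulas

section Derivatives

variable {q : QParam}

theorem partialZ_basisFn {f : discAlg q →ₗ[ℂ] discAlg q}
    (hf : ∀ g : discAlg q, (g : Op ℕ) ∈ discDiff q → ∀ h : discAlg q, IsPartialZ q g h → f g = h)
    (α : AParam) (n k : ℕ) (l : ℤ) :
    TensorProduct.map f LinearMap.id (basisFn q α n k l) =
      (((q : ℝ) ^ (-(2 * (k : ℤ))) / (1 - (q : ℝ) ^ 2) : ℝ) : ℂ) •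
        ((((q : ℝ) ^ 2 * √(1 - (q : ℝ) ^ (2 * k)) : ℝ) : ℂ) • basisFn q α n (k - 1) l -
          (((q : ℝ) ^ ((α : ℝ) / 2) * √(1 - (q : ℝ) ^ (2 * (n + 1))) : ℝ) : ℂ) •
            basisFn q α (n + 1) k l) := by
  simp only [basisFn_eq, TensorProduct.map_tmul, LinearMap.id_apply]
  rw [hf _ (discBasis_mem_discDiff q α n k) _ (isPartialZ_discBasis q α n k)]
  simp only [← TensorProduct.smul_tmul', TensorProduct.sub_tmul]

theorem partialZbar_basisFn {f : discAlg q →ₗ[ℂ] discAlg q}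
    (hf : ∀ g : discAlg q, (g : Op ℕ) ∈ discDiff q → ∀ h : discAlg q, IsPartialZbar q g h →
      f g = h) (α : AParam) (n k : ℕ) (l : ℤ) :
    TensorProduct.map f LinearMap.id (basisFn q α n k l) =
      ((-((q : ℝ) ^ (-(2 * (k : ℤ))) / (1 - (q : ℝ) ^ 2)) : ℝ) : ℂ) •
        ((((q : ℝ) ^ (-2 : ℤ) * √(1 - (q : ℝ) ^ (2 * (k + 1))) : ℝ) : ℂ) •
            basisFn q α n (k + 1) l -
          (((q : ℝ) ^ (-((α : ℝ) / 2)) * √(1 - (q : ℝ) ^ (2 * n)) : ℝ) : ℂ) •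
            basisFn q α (n - 1) k l) := by
  simp only [basisFn_eq, TensorProduct.map_tmul, LinearMap.id_apply]
  rw [hf _ (discBasis_mem_discDiff q α n k) _ (isPartialZbar_discBasis q α n k)]
  simp only [← TensorProduct.smul_tmul', TensorProduct.sub_tmul]

theorem partialT_basisFn {F : Linf →ₗ[ℂ] Linf}
    (hF : ∀ f f' : C(S1, ℂ), HasCircDeriv f f' → F (ofCont f) = ofCont f')
    (α : AParam) (n k : ℕ) (l : ℤ) :
    TensorProduct.map LinearMap.id F (basisFn q α n k l) =
      (Complex.I * (l : ℂ)) • basisFn q α n k l := by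
  have h : F (circBasis l) = (Complex.I * (l : ℂ)) • circBasis l := by
    rw [circBasis_eq_ofCont, hF _ _ (hasCircDeriv_circBasis l), ← ofCont_smul, smul_comm]
  rw [basisFn_eq, TensorProduct.map_tmul, h, LinearMap.id_apply, TensorProduct.tmul_smul]

theorem zpow_div_one_sub_sq_ne_zero (q : QParam) (m : ℤ) :
    (((q : ℝ) ^ m / (1 - (q : ℝ) ^ 2) : ℝ) : ℂ) ≠ 0 :=
  Complex.ofReal_ne_zero.mpr (div_pos (zpow_pos q.2.1 m)
    (sub_pos.mpr (pow_lt_one₀ q.2.1.le q.2.2 two_ne_zero))).ne'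

end Derivatives

end QuantumSU2

end

set_option maxHeartbeats 1000000 in
theorem theorem2 (q : QParam) (α : AParam) :
    -- `y = √(1 - z z^*)`
    opSqrt (1 - zOp q * star (zOp q)) = yOp q ∧
    -- `F^(1)(D_q)` is a `*`-algebra between `O(D_q)` and `F(D_q)`
    (∃ S : StarSubalgebra ℂ (Op ℕ),
      (S : Set (Op ℕ)) = discDiff q ∧ discPoly q ≤ S ∧ S ≤ discAlg q) ∧
    -- `F^(1)(D_q) ⊗ C^(1)(S¹)` is a `*`-subalgebra of `F(D_q) ⊗ L_∞(S¹)`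
    (∃ S : StarSubalgebra ℂ (ChartAlg q), (S : Set (ChartAlg q)) = chartDiff q) ∧
    -- the inner product; the trace converges
    (∀ (f g : discAlg q) (φ ψ : Linf),
      Summable (fun n => inner ℂ (basisVec n)
        ((star (f : Op ℕ) * (g : Op ℕ) * yPow q α) (basisVec n))) ∧
      inner ℂ (toHilb q α (f ⊗ₜ[ℂ] φ)) (toHilb q α (g ⊗ₜ[ℂ] ψ)) =
        ((1 - (q : ℝ) : ℝ) : ℂ) * opTrace (star (f : Op ℕ) * (g : Op ℕ) * yPow q α) *
          ∫ t : S1, star (φ.fn t) * ψ.fn t) ∧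
    -- the basis functions are differentiable
    ∃ he : ∀ (β : AParam) (n k : ℕ) (l : ℤ), basisFn q β n k l ∈ chartDiff q,
    -- the orthonormal basis
    ∃ e : HilbertBasis (ℕ × ℕ × ℤ) ℂ (Hilb q α),
      (∀ (n k : ℕ) (l : ℤ), e (n, k, l) = toHilb q α (basisFn q α n k l)) ∧
    -- the operators `y` and `y^op` of left and right multiplication by `y`
    ∃ Y Yop : Hilb q α →L[ℂ] Hilb q α,
      IsLeftMul q α Y (yElt q ⊗ₜ[ℂ] 1) ∧ IsRightMul q α Yop (yElt q ⊗ₜ[ℂ] 1) ∧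
    -- left multiplication: a bounded `*`-representation of `O(D_q)`
    (∃ L : discPoly q →⋆ₐ[ℂ] (Hilb q α →L[ℂ] Hilb q α),
      (∀ x, IsLeftMul q α (L x) (polyToDisc x ⊗ₜ[ℂ] 1)) ∧
      Y = opSqrt (1 - L (zGen q) * L (star (zGen q))) ∧
      (∀ (n k : ℕ) (l : ℤ),
        L (zGen q) (e (n, k, l)) =
          ((√(1 - (q : ℝ) ^ (2 * (k + 1))) : ℝ) : ℂ) • e (n, k + 1, l) ∧
        -- for `k = 0` the coefficient vanishes
        L (star (zGen q)) (e (n, k, l)) =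
          ((√(1 - (q : ℝ) ^ (2 * k)) : ℝ) : ℂ) • e (n, k - 1, l) ∧
        Y (e (n, k, l)) = (((q : ℝ) ^ k : ℝ) : ℂ) • e (n, k, l))) ∧
    -- right multiplication: a bounded representation of the opposite algebra, not a
    -- `*`-representation
    (∃ R : (discPoly q)ᵐᵒᵖ →ₐ[ℂ] (Hilb q α →L[ℂ] Hilb q α),
      (∀ x : discPoly q, IsRightMul q α (R (MulOpposite.op x)) (polyToDisc x ⊗ₜ[ℂ] 1)) ∧
      (¬ ∀ x, R (star x) = star (R x)) ∧
      R (MulOpposite.op (star (zGen q))) =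
        (((q : ℝ) ^ (α : ℝ) : ℝ) : ℂ) • star (R (MulOpposite.op (zGen q))) ∧
      Yop = star Yop ∧
      Yop = opSqrt (1 - R (MulOpposite.op (star (zGen q))) * R (MulOpposite.op (zGen q))) ∧
      (∀ (n k : ℕ) (l : ℤ),
        -- for `n = 0` the coefficient vanishes
        R (MulOpposite.op (zGen q)) (e (n, k, l)) =
          (((q : ℝ) ^ (-((α : ℝ) / 2)) * √(1 - (q : ℝ) ^ (2 * n)) : ℝ) : ℂ) •
            e (n - 1, k, l) ∧
        R (MulOpposite.op (star (zGen q))) (e (n, k, l)) =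
          (((q : ℝ) ^ ((α : ℝ) / 2) * √(1 - (q : ℝ) ^ (2 * (n + 1))) : ℝ) : ℂ) •
            e (n + 1, k, l) ∧
        Yop (e (n, k, l)) = (((q : ℝ) ^ n : ℝ) : ℂ) • e (n, k, l))) ∧
    -- commuting `*`-representations of `C(SU_q(2))` and `C(SU_q(2))^op`
    ∃ (π : CSU q →⋆ₐ[ℂ] (Hilb q α →L[ℂ] Hilb q α))
      (ρ : (CSU q)ᵐᵒᵖ →⋆ₐ[ℂ] (Hilb q α →L[ℂ] Hilb q α)),
      IsChartRep q α π ∧ IsChartRepOp q α ρ ∧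
      SUqRel q (π (cGen q)) (π (dGen q)) ∧
      SUqRel q (MulOpposite.op (ρ (MulOpposite.op (cGen q))))
        (MulOpposite.op (ρ (MulOpposite.op (dGen q)))) ∧
      (∀ a b, π a * ρ b = ρ b * π a) ∧
      (∀ (n k : ℕ) (l : ℤ),
        π (cGen q) (e (n, k, l)) = (((q : ℝ) ^ k : ℝ) : ℂ) • e (n, k, l + 1) ∧
        π (dGen q) (e (n, k, l)) =
          ((√(1 - (q : ℝ) ^ (2 * (k + 1))) : ℝ) : ℂ) • e (n, k + 1, l) ∧
        ρ (MulOpposite.op (cGen q)) (e (n, k, l)) =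
          (((q : ℝ) ^ n : ℝ) : ℂ) • e (n, k, l - 1) ∧
        -- for `n = 0` the coefficient vanishes
        ρ (MulOpposite.op (dGen q)) (e (n, k, l)) =
          ((√(1 - (q : ℝ) ^ (2 * n)) : ℝ) : ℂ) • e (n - 1, k, l)) ∧
    -- the partial derivatives are well defined on `F^(1)(D_q)`, with values in `F(D_q)`
    (∀ g : discAlg q, (g : Op ℕ) ∈ discDiff q →
      (∃! h : discAlg q, IsPartialZ q g h) ∧ (∃! h : discAlg q, IsPartialZbar q g h)) ∧
    -- the partial derivatives on `F^(1)(D_q) ⊗ C^(1)(S¹)`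
    ∃ Dz Dzbar Dt : chartDiff q →ₗ[ℂ] ChartAlg q,
      (∀ (g h : discAlg q) (φ : Linf) (hg : (g : Op ℕ) ∈ discDiff q) (hφ : φ ∈ circDiff),
        IsPartialZ q g h → Dz ⟨g ⊗ₜ[ℂ] φ, tmul_mem_chartDiff hg hφ⟩ = h ⊗ₜ[ℂ] φ) ∧
      (∀ (g h : discAlg q) (φ : Linf) (hg : (g : Op ℕ) ∈ discDiff q) (hφ : φ ∈ circDiff),
        IsPartialZbar q g h → Dzbar ⟨g ⊗ₜ[ℂ] φ, tmul_mem_chartDiff hg hφ⟩ = h ⊗ₜ[ℂ] φ) ∧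
      (∀ (g : discAlg q) (φ φ' : C(S1, ℂ)) (hg : (g : Op ℕ) ∈ discDiff q)
        (hφ : HasCircDeriv φ φ'),
        Dt ⟨g ⊗ₜ[ℂ] ofCont φ, tmul_mem_chartDiff hg ⟨φ, φ', hφ, rfl⟩⟩ = g ⊗ₜ[ℂ] ofCont φ') ∧
      (∀ (n k : ℕ) (l : ℤ),
        -- for `k = 0` the coefficient of the first term vanishes
        Dz ⟨basisFn q α n k l, he α n k l⟩ =
          (((q : ℝ) ^ (-(2 * (k : ℤ))) / (1 - (q : ℝ) ^ 2) : ℝ) : ℂ) •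
            ((((q : ℝ) ^ 2 * √(1 - (q : ℝ) ^ (2 * k)) : ℝ) : ℂ) • basisFn q α n (k - 1) l -
              (((q : ℝ) ^ ((α : ℝ) / 2) * √(1 - (q : ℝ) ^ (2 * (n + 1))) : ℝ) : ℂ) •
                basisFn q α (n + 1) k l) ∧
        -- for `n = 0` the coefficient of the second term vanishes
        Dzbar ⟨basisFn q α n k l, he α n k l⟩ =
          ((-((q : ℝ) ^ (-(2 * (k : ℤ))) / (1 - (q : ℝ) ^ 2)) : ℝ) : ℂ) •
            ((((q : ℝ) ^ (-2 : ℤ) * √(1 - (q : ℝ) ^ (2 * (k + 1))) : ℝ) : ℂ) •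
                basisFn q α n (k + 1) l -
              (((q : ℝ) ^ (-((α : ℝ) / 2)) * √(1 - (q : ℝ) ^ (2 * n)) : ℝ) : ℂ) •
                basisFn q α (n - 1) k l) ∧
        Dt ⟨basisFn q α n k l, he α n k l⟩ = (Complex.I * (l : ℂ)) • basisFn q α n k l) ∧
      -- in terms of the bases, the representations of `C(SU_q(2))` and `C(SU_q(2))^op` do not
      -- depend on `α`, whereas the actions of the partial derivatives do
      (∀ β : AParam, ∃ U : Hilb q α ≃ₗᵢ[ℂ] Hilb q β,
        (∀ (n k : ℕ) (l : ℤ), U (e (n, k, l)) = toHilb q β (basisFn q β n k l)) ∧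
        (∀ π' : CSU q →⋆ₐ[ℂ] (Hilb q β →L[ℂ] Hilb q β), IsChartRep q β π' →
          ∀ a v, U (π a v) = π' a (U v)) ∧
        (∀ ρ' : (CSU q)ᵐᵒᵖ →⋆ₐ[ℂ] (Hilb q β →L[ℂ] Hilb q β), IsChartRepOp q β ρ' →
          ∀ b v, U (ρ b v) = ρ' b (U v)) ∧
        (α ≠ β →
          (∃ (n k : ℕ) (l : ℤ), U (toHilb q α (Dz ⟨basisFn q α n k l, he α n k l⟩)) ≠
            toHilb q β (Dz ⟨basisFn q β n k l, he β n k l⟩)) ∧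
          (∃ (n k : ℕ) (l : ℤ), U (toHilb q α (Dzbar ⟨basisFn q α n k l, he α n k l⟩)) ≠
            toHilb q β (Dzbar ⟨basisFn q β n k l, he β n k l⟩)))) := by
  refine ⟨opSqrt_one_sub q, ?_, ⟨chartDiffAlg q, rfl⟩, ?_, ?_⟩
  · exact ⟨diffAlg q, (discDiff_eq q).symm, discPoly_le_diffAlg q, diffAlg_le_discAlg q⟩
  · exact fun f g φ ψ => ⟨summable_trace q α f g, inner_toHilb_tmul q α f g φ ψ⟩
  refine ⟨basisFn_mem_chartDiff q, hilbBasis q α, hilbBasis_apply q α,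
    leftRep q α (yOp q), rightRep q α (yOp q), isLeftMul_leftRep (yElt q), isRightMul_yElt,
    ?_, ?_, chartRep q α, chartRepOp q α, isChartRep_chartRep, isChartRepOp_chartRepOp,
    SUqRel_map (chartRep q α), SUqRel_op_map (chartRepOp q α),
    commute_chartReps q α, ?_, ?_, ?_⟩
  · refine ⟨(leftRep q α).comp (discPoly q).subtype, fun x => isLeftMul_leftRep (polyToDisc x),
      map_yOp_eq_opSqrt (leftRep q α), fun n k l => ⟨?_, ?_, ?_⟩⟩
    · exact leftRep_hilbBasis (zOp_basisVec q k) n l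
    · exact leftRep_hilbBasis (star_zOp_basisVec q k) n l
    · exact leftRep_hilbBasis (yOp_basisVec q k) n l
  · obtain ⟨R, hR⟩ := exists_rightMul_algHom q α
    refine ⟨R, hR, rightMul_not_star hR, rightMul_star_zGen_eq hR, ?_,
      rightRep_yOp_eq_opSqrt hR, fun n k l => ⟨rightMul_zGen_hilbBasis hR n k l,
        rightMul_star_zGen_hilbBasis hR n k l, rightRep_hilbBasis (yOp_basisVec q n) k l⟩⟩
    rw [← map_star, star_yOp]
  · exact fun n k l => ⟨chartRep_cGen_hilbBasis q α n k l, chartRep_dGen_hilbBasis q α n k l,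
      chartRepOp_cGen_hilbBasis q α n k l, chartRepOp_dGen_hilbBasis q α n k l⟩
  · refine fun g hg => ⟨?_, ?_⟩
    · obtain ⟨h, hh⟩ := exists_isPartialZ (mem_discDiff_iff.mp hg)
      exact ⟨h, hh, fun h' hh' => IsPartialZ.unique hh' hh⟩
    · obtain ⟨h, hh⟩ := exists_isPartialZbar (mem_discDiff_iff.mp hg)
      exact ⟨h, hh, fun h' hh' => IsPartialZbar.unique hh' hh⟩
  obtain ⟨fz, hfz⟩ := exists_partialZ_linearMap q
  obtain ⟨fzbar, hfzbar⟩ := exists_partialZbar_linearMap q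
  obtain ⟨F, hF⟩ := exists_partialT_linearMap
  -- Restriction to `chartDiff` discards the arbitrary values of the extended derivatives.
  refine ⟨(TensorProduct.map fz LinearMap.id).domRestrict (chartDiff q),
    (TensorProduct.map fzbar LinearMap.id).domRestrict (chartDiff q),
    (TensorProduct.map LinearMap.id F).domRestrict (chartDiff q), ?_, ?_, ?_, ?_, ?_⟩
  · intro g h φ hg hφ hh
    rw [LinearMap.domRestrict_apply, TensorProduct.map_tmul, hfz g hg h hh, LinearMap.id_apply]
  · intro g h φ hg hφ hh
    rw [LinearMap.domRestrict_apply, TensorProduct.map_tmul, hfzbar g hg h hh, LinearMap.id_apply]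
  · intro g φ φ' hg hφ
    rw [LinearMap.domRestrict_apply, TensorProduct.map_tmul, hF φ φ' hφ, LinearMap.id_apply]
  · exact fun n k l => ⟨partialZ_basisFn hfz α n k l, partialZbar_basisFn hfzbar α n k l,
      partialT_basisFn hF α n k l⟩
  intro β
  refine ⟨basisChange q α β, fun n k l => ?_,
    fun π' hπ a v => basisChange_chartRep q α β hπ a v,
    fun ρ' hρ b v => basisChange_chartRepOp q α β hρ b v,
    -- In both cases the coefficient depending on the parameter is `q^{±α/2} √(1 - q²)`, which is
    -- nonzero; for `∂/∂z̄` this requires `n = 1`, since the term vanishes at `n = 0`.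
    fun hαβ => ⟨⟨0, 0, 0, ?_⟩, ⟨1, 0, 0, ?_⟩⟩⟩
  · rw [hilbBasis_apply, basisChange_toHilb]
  · simp only [LinearMap.domRestrict_apply, partialZ_basisFn hfz]
    refine basisChange_ne (zpow_div_one_sub_sq_ne_zero q _) (rpow_mul_sqrt_ne fun h => hαβ ?_)
    exact Subtype.ext (by linarith)
  · simp only [LinearMap.domRestrict_apply, partialZbar_basisFn hfzbar]
    refine basisChange_ne ?_ (rpow_mul_sqrt_ne fun h => hαβ ?_)
    · rw [Complex.ofReal_neg]
      exact neg_ne_zero.mpr (zpow_div_one_sub_sq_ne_zero q _)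
    · exact Subtype.ext (by linarith)
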